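/- **Setting.** Let $n\in\{2,3\}$. A *mixed-dimensional medium* consists of finitely many pairwise disjoint, bounded, connected, flat subdomains $\Omega_s\subset\mathbb R^n$, each relatively open in an affine subspace of dimension $d_s\in\{0,\dots,n\}$, and of finitely many interfaces $\Gamma_g$. An interface coincides as a set with a subdomain $\Omega_{\mathrm{lo}(g)}$, which is touched from the side opposite to a unit normal $\nu_g$ by a subdomain $\Omega_{\mathrm{hi}(g)}$ of one dimension more ($\nu_g$ is outward for $\Omega_{\mathrm{hi}(g)}$). The graph of subdomains and interfaces is connected. The outer boundary $\overline{\bigcup_s\Omega_s}\setminus\bigcup_s\Omega_s$ is the disjoint union of a Dirichlet part of positive $(n-1)$-dimensional measure and a Neumann part. Every subdomain has a conforming simplicial mesh which resolves the interfaces and the two parts of the outer boundary, and every interface has a simplicial mortar mesh; meshes need not match across interfaces. Let $V_h$ be the space of lowest-order Raviart–Thomas fields (zero on $0$-dimensional subdomains) with zero normal component on the Neumann part, $V_{0h}\subset V_h$ those with zero normal component on all interfaces, $\Lambda_h$ and $Q_h$ the piecewise constants on the mortar meshes and on the subdomain meshes, and $W_h=V_{0h}\times\Lambda_h$. Let $R_h:\Lambda_h\to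 V_h$ be a linear extension operator: on the interfaces the normal component of $R_h\mu$ is the $L^2$-projection of $\mu$ to the piecewise constants on the trace mesh, and it vanishes on the outer boundary. Let $K$ be a symmetric positive definite tensor, constant on each subdomain, $\gamma>0$ constant on each interface, and $K_\nu$ measurable on the interfaces and bounded between two positive constants. For $w=(u_0,\lambda)$, $r=(v_0,\mu)\in W_h$ and $q\in Q_h$ put $$a(w,r)=(K^{-1}(u_0+R_h\lambda),v_0+R_h\mu)_\Omega+(\gamma K_\nu^{-1}\lambda,\mu)_\Gamma,\qquad b(r,q)=-(q,\nabla\cdot(v_0+R_h\mu)+[\![\mu]\!])_\Omega,$$ where $[\![\mu]\!]$ on $\Omega_s$ is $-\sum_{\mathrm{lo}(g)=s}\mu_g$, and $$a^D(w,r)=\sum_T\sum_{f\subset\partial T}\big((u_0+R_h\lambda)|_T\cdot\nu_f\big)\big((v_0+R_h\mu)|_T\cdot\nu_f\big)(K^{-1}\phi_f,\phi_f)_T+(\gamma K_\nu^{-1}\lambda,\mu)_\Gamma,$$ where $T$ runs over the elements of positive dimension, $f$ over the facets of $T$, $\nu_f$ is the outer unit normal, and $\phi_f$ the local Raviart–Thomas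 basis function of $f$. Let $A,D_A:W_h\to W_h'$ and $B:W_h\to Q_h'$ be the operators of $a$, $a^D$, $b$, let $\mathcal A=\begin{pmatrix}A&B^T\\-B&0\end{pmatrix}$, $D_h=D_A^{-1}B^T:Q_h\to W_h$, $|||(r,q)|||^2=a(r,r)+a^D(D_hq,D_hq)$, and $$\mathcal L(w,p;r,q)=a(w,r)+a^D(D_hp,r)+a^D(D_hq,w).$$ Call $\alpha,\beta>0$ *well-posedness constants* if $|\mathcal L(x;y)|\le\alpha\,|||x|||\,|||y|||$ for all $x,y\in W_h\times Q_h$ and $\inf_{y\ne0}\sup_{x\neq0}\frac{\mathcal L(x;y)}{|||x|||\,|||y|||}\ge\beta$. **Theorem.** 1. For every such discretization $A$, $D_A$ and $BD_A^{-1}B^T$ are bijective. 2. For all $\sigma,\theta$ there are well-posedness constants $\alpha,\beta>0$, depending only on $n,\sigma,\theta$, that are common to all such discretizations whose subdomain meshes are shape regular with constant $\sigma$ (each element $T$ of positive dimension contains a ball of the affine subspace spanned by $T$, of radius $r>0$ with $\operatorname{diam}T\le\sigma r$) and for which, on each subdomain, the ratio of any two eigenvalues of $K$ on the tangent space is at most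 $\theta$ (so $\theta=1$ for scalar $K$). 3. For every such discretization let $\alpha,\beta>0$ be any well-posedness constants. Let $H_w:W_h'\to W_h$ and $H_p:Q_h'\to Q_h$ be symmetric positive definite and let $c_{1,w},c_{1,p}>0$ and $c_{2,w},c_{2,p}$ be real numbers with $$c_{1,w}\langle f,H_wf\rangle\le\langle f,A^{-1}f\rangle\le c_{2,w}\langle f,H_wf\rangle,\qquad c_{1,p}\langle g,H_pg\rangle\le\langle g,(BD_A^{-1}B^T)^{-1}g\rangle\le c_{2,p}\langle g,H_pg\rangle$$ for all $f\in W_h'$, $g\in Q_h'$. Let $\mathcal M_D=\operatorname{diag}(H_w,H_p)$, $c_2=\max\{c_{2,w},c_{2,p}\}$, $c_1=\min\{c_{1,w},c_{1,p}\}$. Then $\mathcal M_D$ and $\mathcal M_D\mathcal A$ are bijective and $$\kappa(\mathcal M_D\mathcal A)=\|\mathcal M_D\mathcal A\|\,\|(\mathcal M_D\mathcal A)^{-1}\|\le\frac{\alpha c_2}{\beta c_1},$$ both for the operator norm induced by $|||\cdot|||$ and for the one induced by $\|x\|_{\mathcal M_D^{-1}}=\langle\mathcal M_D^{-1}x,x\rangle^{1/2}$.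 -/

import Mathlib

open MeasureTheory Set Topology
open scoped ENNReal InnerProductSpace

noncomputable section

namespace MixedDim

/-! ### Simplices in `ℝⁿ` and lowest-order Raviart–Thomas fields on them -/

/-- The ambient Euclidean space `ℝⁿ`. -/
abbrev E (n : ℕ) := EuclideanSpace ℝ (Fin n)

section Simplices

variable {n d : ℕ}

/-- The relatively open simplex: all barycentric coordinates are positive. (Unlike
`Affine.Simplex.interior`, a `0`-simplex is its own relatively open simplex.) -/
def openCell (T : Affine.Simplex ℝ (E n) d) : Set (E n) := T.setInterior (Ioi 0)

/-- The relatively open facet opposite to the vertex `k`. It is empty if `d = 0`. -/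
def openFacet (T : Affine.Simplex ℝ (E n) d) (k : Fin (d + 1)) : Set (E n) :=
  {x | ∃ w : Fin (d + 1) → ℝ, ∑ i, w i = 1 ∧ w k = 0 ∧ (∀ i, i ≠ k → 0 < w i) ∧
    Finset.univ.affineCombination ℝ T.points w = x}

/-- The closed facet opposite to the vertex `k`. It is empty if `d = 0`. -/
def closedFacet (T : Affine.Simplex ℝ (E n) d) (k : Fin (d + 1)) : Set (E n) :=
  convexHull ℝ (T.points '' {k}ᶜ)

/-- The orthogonal projection of the vertex `k` to the plane of the opposite facet
(only relevant for `d ≥ 1`). -/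
def foot (T : Affine.Simplex ℝ (E n) d) (k : Fin (d + 1)) : E n :=
  if h : d ≠ 0 then haveI : NeZero d := ⟨h⟩; T.altitudeFoot k else T.points k

/-- The height of the simplex over the facet opposite to the vertex `k`. -/
def height (T : Affine.Simplex ℝ (E n) d) (k : Fin (d + 1)) : ℝ := dist (T.points k) (foot T k)

/-- The unit outward normal, in the plane of the simplex, of the facet opposite to `k`. -/
def normal (T : Affine.Simplex ℝ (E n) d) (k : Fin (d + 1)) : E n :=
  (height T k)⁻¹ • (foot T k - T.points k)

/-- A lowest-order Raviart–Thomas field on a simplex `T` is a field `x ↦ a + b (x - x₀)` with `a`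
tangent to `T`, `b ∈ ℝ`, and `x₀` the first vertex of `T`; it is stored as the pair `(a, b)`.
This is its value at the point `x`. -/
def rtEval (T : Affine.Simplex ℝ (E n) d) (v : E n × ℝ) (x : E n) : E n :=
  v.1 + v.2 • (x - T.points 0)

/-- The tangential divergence of `x ↦ a + b (x - x₀)` on a `d`-dimensional simplex is `d b`. -/
def rtDiv (d : ℕ) (v : E n × ℝ) : ℝ := d * v.2

/-- The outward normal component on the facet opposite to `k`: it is constant on the
plane of that facet, so it is evaluated at the foot of the altitude. -/
def normalTrace (T : Affine.Simplex ℝ (E n) d) (k : Fin (d + 1)) (v : E n × ℝ) : ℝ :=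
  ⟪rtEval T v (foot T k), normal T k⟫_ℝ

/-- The Raviart–Thomas basis field `x ↦ (x - x_k) / height_k` of the facet opposite to `k`: it has
outward normal component one on that facet and zero on the other facets. -/
def rtBasis (T : Affine.Simplex ℝ (E n) d) (k : Fin (d + 1)) : E n × ℝ :=
  ((height T k)⁻¹ • (T.points 0 - T.points k), (height T k)⁻¹)

/-- The `d`-dimensional volume of a set (length, area, ...; number of points for `d = 0`). -/
def vol (d : ℕ) (s : Set (E n)) : ℝ := (Measure.euclideanHausdorffMeasure d : Measure (E n)).real s

theorem measure_closedInterior_lt_top (T : Affine.Simplex ℝ (E n) d) :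
    (Measure.euclideanHausdorffMeasure d : Measure (E n)) T.closedInterior < ∞ := by
  set S := affineSpan ℝ (range T.points) with hS
  have : Nonempty S := ⟨⟨T.points 0, mem_affineSpan ℝ (mem_range_self 0)⟩⟩
  have hd : Module.finrank ℝ S.direction = d := by
    rw [hS, direction_affineSpan]
    exact T.independent.finrank_vectorSpan (by simp)
  have hsub : T.closedInterior ⊆ (S : Set (E n)) := T.closedInterior_subset_affineSpan
  have himg : ((↑) : S → E n) '' (((↑) : S → E n) ⁻¹' T.closedInterior) = T.closedInterior := by
    rw [image_preimage_eq_inter_range]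
    refine inter_eq_self_of_subset_left (fun x hx => ⟨⟨x, hsub hx⟩, rfl⟩)
  have hc : IsCompact (((↑) : S → E n) ⁻¹' T.closedInterior) := by
    refine Topology.IsInducing.subtypeVal.isCompact_iff.mpr ?_
    exact (congrArg IsCompact himg).mpr T.isCompact_closedInterior
  rw [← himg, AffineSubspace.euclideanHausdorffMeasure_coe_image]
  let p : S := Classical.arbitrary S
  have h := EuclideanGeometry.euclideanHausdorffMeasure_eq (V := S.direction) (P := S) p
  rw [hd] at h
  have hm : MeasurableEmbedding (IsometryEquiv.vaddConst p) :=
    (IsometryEquiv.vaddConst p).toHomeomorph.measurableEmbedding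
  rw [h, hm.map_apply]
  exact ((IsometryEquiv.vaddConst p).toHomeomorph.isCompact_preimage.mpr hc).measure_lt_top

theorem rtEval_continuous (T : Affine.Simplex ℝ (E n) d) (v : E n × ℝ) :
    Continuous (rtEval T v) := by
  unfold rtEval; fun_prop

theorem rtEval_add (T : Affine.Simplex ℝ (E n) d) (u v : E n × ℝ) (x : E n) :
    rtEval T (u + v) x = rtEval T u x + rtEval T v x := by
  simp only [rtEval, Prod.fst_add, Prod.snd_add, add_smul]; abel

theorem rtEval_smul (T : Affine.Simplex ℝ (E n) d) (c : ℝ) (v : E n × ℝ) (x : E n) :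
    rtEval T (c • v) x = c • rtEval T v x := by
  simp only [rtEval, Prod.smul_fst, Prod.smul_snd, smul_add, smul_smul, smul_eq_mul]

theorem normalTrace_add (T : Affine.Simplex ℝ (E n) d) (k : Fin (d + 1)) (u v : E n × ℝ) :
    normalTrace T k (u + v) = normalTrace T k u + normalTrace T k v := by
  simp only [normalTrace, rtEval_add, inner_add_left]

theorem normalTrace_smul (T : Affine.Simplex ℝ (E n) d) (k : Fin (d + 1)) (c : ℝ)
    (v : E n × ℝ) : normalTrace T k (c • v) = c * normalTrace T k v := by
  simp only [normalTrace, rtEval_smul, real_inner_smul_left]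

/-- The weighted `L²` product `∫_T (κ⁻¹ u) · v` of two Raviart–Thomas fields. -/
def cellProduct (T : Affine.Simplex ℝ (E n) d) (κ : E n ≃ₗ[ℝ] E n) (u v : E n × ℝ) : ℝ :=
  ∫ x in T.closedInterior, ⟪κ.symm (rtEval T u x), rtEval T v x⟫_ℝ
    ∂(Measure.euclideanHausdorffMeasure d)

theorem cellProduct_integrable (T : Affine.Simplex ℝ (E n) d) (κ : E n ≃ₗ[ℝ] E n)
    (u v : E n × ℝ) :
    IntegrableOn (fun x => ⟪κ.symm (rtEval T u x), rtEval T v x⟫_ℝ) T.closedInterior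
      (Measure.euclideanHausdorffMeasure d) := by
  refine ContinuousOn.integrableOn_of_subset_isCompact (K := T.closedInterior) ?_
    T.isCompact_closedInterior T.isClosed_closedInterior.measurableSet subset_rfl
    (measure_closedInterior_lt_top T).ne
  have h1 : Continuous κ.symm := κ.symm.toLinearMap.continuous_of_finiteDimensional
  exact ((h1.comp (rtEval_continuous T u)).inner (rtEval_continuous T v)).continuousOn

theorem cellProduct_add_left (T : Affine.Simplex ℝ (E n) d) (κ : E n ≃ₗ[ℝ] E n)
    (u u' v : E n × ℝ) :
    cellProduct T κ (u + u') v = cellProduct T κ u v + cellProduct T κ u' v := by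
  unfold cellProduct
  rw [← integral_add (cellProduct_integrable T κ u v) (cellProduct_integrable T κ u' v)]
  simp only [rtEval_add, map_add, inner_add_left]

theorem cellProduct_add_right (T : Affine.Simplex ℝ (E n) d) (κ : E n ≃ₗ[ℝ] E n)
    (u v v' : E n × ℝ) :
    cellProduct T κ u (v + v') = cellProduct T κ u v + cellProduct T κ u v' := by
  unfold cellProduct
  rw [← integral_add (cellProduct_integrable T κ u v) (cellProduct_integrable T κ u v')]
  simp only [rtEval_add, inner_add_right]

theorem cellProduct_smul_left (T : Affine.Simplex ℝ (E n) d) (κ : E n ≃ₗ[ℝ] E n)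
    (c : ℝ) (u v : E n × ℝ) : cellProduct T κ (c • u) v = c * cellProduct T κ u v := by
  unfold cellProduct
  rw [← integral_const_mul]
  simp only [rtEval_smul, map_smul, real_inner_smul_left]

theorem cellProduct_smul_right (T : Affine.Simplex ℝ (E n) d) (κ : E n ≃ₗ[ℝ] E n)
    (c : ℝ) (u v : E n × ℝ) : cellProduct T κ u (c • v) = c * cellProduct T κ u v := by
  unfold cellProduct
  rw [← integral_const_mul]
  simp only [rtEval_smul, real_inner_smul_right]

/-- The closed cells `cl i` and their relative interiors `op i` partition the set `Ω`, as the
elements of a mesh do: the open cells are disjoint subsets of `Ω`, the closed cells fill its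
closure. -/
def Partitions {ι : Type} (cl op : ι → Set (E n)) (Ω : Set (E n)) : Prop :=
  (⋃ i, cl i) = closure Ω ∧ (∀ i, op i ⊆ Ω) ∧ Pairwise fun i j => Disjoint (op i) (op j)

end Simplices

/-! ### The mixed-dimensional geometry -/

/-- A fractured porous medium in `ℝⁿ`: finitely many flat subdomains `Ω s` of dimensions
`0, …, n`, the interfaces between subdomains of consecutive dimensions, and the partition of the
outer boundary into a Dirichlet and a Neumann part. An interface `g` coincides, as a set, with
its lower-dimensional subdomain `Ω (lo g)`, which `Ω (hi g)` touches from the side opposite to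
the unit vector `nu g`; the two sides of a fracture are different interfaces. -/
structure Geometry (n : ℕ) where
  Sub : Type
  [fintypeSub : Fintype Sub]
  dim : Sub → ℕ
  Ω : Sub → Set (E n)
  /-- The affine subspace that contains the flat subdomain. -/
  plane : Sub → AffineSubspace ℝ (E n)
  finrank_plane : ∀ s, Module.finrank ℝ (plane s).direction = dim s
  relOpen : ∀ s, ∃ U : Set (E n), IsOpen U ∧ Ω s = U ∩ plane s
  isConnected : ∀ s, IsConnected (Ω s)
  isBounded : ∀ s, Bornology.IsBounded (Ω s)
  disjoint : Pairwise fun s t => Disjoint (Ω s) (Ω t)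
  Interface : Type
  [fintypeInterface : Fintype Interface]
  lo : Interface → Sub
  hi : Interface → Sub
  /-- The unit normal of the interface, outward for the higher-dimensional side. -/
  nu : Interface → E n
  dim_hi : ∀ g, dim (hi g) = dim (lo g) + 1
  plane_le : ∀ g, plane (lo g) ≤ plane (hi g)
  norm_nu : ∀ g, ‖nu g‖ = 1
  nu_mem : ∀ g, nu g ∈ (plane (hi g)).direction
  nu_orthogonal : ∀ g, nu g ∈ ((plane (lo g)).direction)ᗮ
  side : ∀ g, ∀ x ∈ Ω (lo g), ∀ᶠ t : ℝ in 𝓝[>] 0, x - t • nu g ∈ Ω (hi g)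
  interface_ext : ∀ g g', lo g = lo g' → hi g = hi g' → nu g = nu g' → g = g'
  /-- The mixed-dimensional medium is connected. -/
  connected : ∀ s t, Relation.EqvGen (fun s t => ∃ g, lo g = s ∧ hi g = t) s t
  dirichlet : Set (E n)
  neumann : Set (E n)
  boundary_eq : dirichlet ∪ neumann = closure (⋃ s, Ω s) \ ⋃ s, Ω s
  boundary_disjoint : Disjoint dirichlet neumann
  dirichlet_pos : 0 < (Measure.euclideanHausdorffMeasure (n - 1) : Measure (E n)) dirichlet

attribute [instance] Geometry.fintypeSub Geometry.fintypeInterface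

/-! ### Meshes -/

/-- Simplicial meshes of all subdomains and mortar meshes of all interfaces. The mesh of a
subdomain is conforming inside the subdomain and resolves its boundary; the meshes on the two
sides of an interface and the mortar mesh need not match. -/
structure Mesh {n : ℕ} (G : Geometry n) where
  Cell : G.Sub → Type
  [fintypeCell : ∀ s, Fintype (Cell s)]
  simplex : ∀ {s}, Cell s → Affine.Simplex ℝ (E n) (G.dim s)
  partitions : ∀ s, Partitions (fun c : Cell s => (simplex c).closedInterior)
    (fun c => openCell (simplex c)) (G.Ω s)
  /-- Two elements meet inside the subdomain only in a common face. -/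
  conforming : ∀ s (c c' : Cell s),
    (simplex c).closedInterior ∩ (simplex c').closedInterior ∩ G.Ω s ⊆
      convexHull ℝ (range (simplex c).points ∩ range (simplex c').points)
  /-- Every facet lies inside the subdomain, or on an interface, or on one of the two parts of the
  outer boundary. -/
  resolved : ∀ s (c : Cell s) (k : Fin (G.dim s + 1)),
    openFacet (simplex c) k ⊆ G.Ω s ∨
    (∃ g, G.hi g = s ∧ openFacet (simplex c) k ⊆ G.Ω (G.lo g) ∧ normal (simplex c) k = G.nu g) ∨
    openFacet (simplex c) k ⊆ G.dirichlet ∨ openFacet (simplex c) k ⊆ G.neumann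
  /-- The facets that lie on an interface form a mesh of it. -/
  trace_partitions : ∀ g, Partitions
    (fun f : {f : Cell (G.hi g) × Fin (G.dim (G.hi g) + 1) //
        openFacet (simplex f.1) f.2 ⊆ G.Ω (G.lo g) ∧ normal (simplex f.1) f.2 = G.nu g} =>
      closedFacet (simplex f.1.1) f.1.2)
    (fun f => openFacet (simplex f.1.1) f.1.2) (G.Ω (G.lo g))
  Mortar : G.Interface → Type
  [fintypeMortar : ∀ g, Fintype (Mortar g)]
  mortarSimplex : ∀ {g}, Mortar g → Affine.Simplex ℝ (E n) (G.dim (G.lo g))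
  mortar_partitions : ∀ g, Partitions (fun m : Mortar g => (mortarSimplex m).closedInterior)
    (fun m => openCell (mortarSimplex m)) (G.Ω (G.lo g))

attribute [instance] Mesh.fintypeCell Mesh.fintypeMortar

namespace Mesh

variable {n : ℕ} {G : Geometry n} (M : Mesh G)

/-- The facet opposite to the vertex `k` of the element `c` lies on the interface `g`. -/
def OnInterface (g : G.Interface) {s : G.Sub} (c : M.Cell s) (k : Fin (G.dim s + 1)) : Prop :=
  G.hi g = s ∧ openFacet (M.simplex c) k ⊆ G.Ω (G.lo g) ∧ normal (M.simplex c) k = G.nu g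

/-- Elementwise data `(a, b)` of piecewise Raviart–Thomas fields. -/
abbrev Field := ∀ s, M.Cell s → E n × ℝ

/-- The flux space `V_h`: elementwise lowest-order Raviart–Thomas fields (zero on points) whose
normal components are continuous across the facets inside each subdomain and vanish on the
Neumann boundary. -/
def V : Submodule ℝ M.Field where
  carrier := {v |
    (∀ s (c : M.Cell s), (v s c).1 ∈ (G.plane s).direction ∧ (G.dim s = 0 → (v s c).2 = 0)) ∧
    (∀ s (c c' : M.Cell s) (k k' : Fin (G.dim s + 1)), c ≠ c' →
      openFacet (M.simplex c) k = openFacet (M.simplex c') k' →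
      openFacet (M.simplex c) k ⊆ G.Ω s →
      normalTrace (M.simplex c) k (v s c) + normalTrace (M.simplex c') k' (v s c') = 0) ∧
    (∀ s (c : M.Cell s) (k : Fin (G.dim s + 1)), openFacet (M.simplex c) k ⊆ G.neumann →
      normalTrace (M.simplex c) k (v s c) = 0)}
  add_mem' := by
    rintro u v ⟨hu1, hu2, hu3⟩ ⟨hv1, hv2, hv3⟩
    refine ⟨fun s c => ⟨Submodule.add_mem _ (hu1 s c).1 (hv1 s c).1, fun h => ?_⟩,
      fun s c c' k k' h1 h2 h3 => ?_, fun s c k h => ?_⟩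
    · simp [(hu1 s c).2 h, (hv1 s c).2 h]
    · have h4 := hu2 s c c' k k' h1 h2 h3
      have h5 := hv2 s c c' k k' h1 h2 h3
      simp only [Pi.add_apply, normalTrace_add]
      linarith
    · simp only [Pi.add_apply, normalTrace_add, hu3 s c k h, hv3 s c k h, add_zero]
  zero_mem' := by
    have h0 : ∀ s (c : M.Cell s) (k : Fin (G.dim s + 1)),
        normalTrace (M.simplex c) k (0 : E n × ℝ) = 0 := by
      intro s c k
      simp [normalTrace, rtEval]
    refine ⟨fun s c => ⟨Submodule.zero_mem _, fun _ => rfl⟩, fun s c c' k k' _ _ _ => ?_,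
      fun s c k _ => ?_⟩
    · simp only [Pi.zero_apply, h0, add_zero]
    · simp only [Pi.zero_apply, h0]
  smul_mem' := by
    rintro r v ⟨hv1, hv2, hv3⟩
    refine ⟨fun s c => ⟨Submodule.smul_mem _ r (hv1 s c).1, fun h => ?_⟩,
      fun s c c' k k' h1 h2 h3 => ?_, fun s c k h => ?_⟩
    · simp [(hv1 s c).2 h]
    · simp only [Pi.smul_apply, normalTrace_smul]
      rw [← mul_add, hv2 s c c' k k' h1 h2 h3, mul_zero]
    · simp only [Pi.smul_apply, normalTrace_smul, hv3 s c k h, mul_zero]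

/-- The subspace `V_{0h}` of fluxes with zero normal component on all interfaces. -/
def V0 : Submodule ℝ M.Field where
  carrier := {v | v ∈ M.V ∧ ∀ g s (c : M.Cell s) (k : Fin (G.dim s + 1)), M.OnInterface g c k →
    normalTrace (M.simplex c) k (v s c) = 0}
  add_mem' := by
    rintro u v ⟨hu, hu'⟩ ⟨hv, hv'⟩
    refine ⟨Submodule.add_mem _ hu hv, fun g s c k h => ?_⟩
    simp only [Pi.add_apply, normalTrace_add, hu' g s c k h, hv' g s c k h, add_zero]
  zero_mem' := ⟨Submodule.zero_mem _, fun g s c k _ => by simp [normalTrace, rtEval]⟩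
  smul_mem' := by
    rintro r v ⟨hv, hv'⟩
    refine ⟨Submodule.smul_mem _ r hv, fun g s c k h => ?_⟩
    simp only [Pi.smul_apply, normalTrace_smul, hv' g s c k h, mul_zero]

/-- The mortar space `Λ_h` of piecewise constants on the mortar meshes. -/
abbrev Λ := ∀ g, M.Mortar g → ℝ

/-- The pressure space `Q_h` of piecewise constants on the subdomain meshes. -/
abbrev Q := ∀ s, M.Cell s → ℝ

/-- The space `W_h = V_{0h} × Λ_h` of all fluxes. -/
abbrev W := M.V0 × M.Λ

/-- `R` is a discrete extension operator: on every interface the normal component of `R μ` is the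
`L²` projection of `μ` to the piecewise constants on the trace mesh (its mean value over each
facet), and on the outer boundary the normal component of `R μ` vanishes (on the Neumann part
this is part of `R μ ∈ V_h`). -/
def IsExtension (R : M.Λ →ₗ[ℝ] M.V) : Prop :=
  (∀ μ g s (c : M.Cell s) (k : Fin (G.dim s + 1)), M.OnInterface g c k →
    vol (G.dim (G.lo g)) (closedFacet (M.simplex c) k) *
        normalTrace (M.simplex c) k ((R μ : M.Field) s c) =
      ∑ m : M.Mortar g, μ g m * vol (G.dim (G.lo g))
        (closedFacet (M.simplex c) k ∩ (M.mortarSimplex m).closedInterior)) ∧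
  (∀ μ s (c : M.Cell s) (k : Fin (G.dim s + 1)), openFacet (M.simplex c) k ⊆ G.dirichlet →
    normalTrace (M.simplex c) k ((R μ : M.Field) s c) = 0)

/-- Shape regularity with constant `σ`: each element of positive dimension contains a ball of its
plane whose radius is at least the `σ`-th part of the diameter of the element. -/
def ShapeRegular (σ : ℝ) : Prop :=
  ∀ s (c : M.Cell s), G.dim s ≠ 0 → ∃ x ∈ G.plane s, ∃ r : ℝ, 0 < r ∧
    Metric.closedBall x r ∩ G.plane s ⊆ (M.simplex c).closedInterior ∧
    Metric.diam (M.simplex c).closedInterior ≤ σ * r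

end Mesh

/-! ### Physical parameters -/

/-- The permeability `K` (a symmetric positive definite tensor on the tangent space of each
subdomain, constant on the subdomain; it is extended to `ℝⁿ`, and the extension is irrelevant),
the distances `γ`, constant on each interface, and the normal permeability `Kν`. -/
structure Parameters {n : ℕ} (G : Geometry n) where
  K : G.Sub → (E n ≃ₗ[ℝ] E n)
  K_tangent : ∀ s, ∀ v ∈ (G.plane s).direction, K s v ∈ (G.plane s).direction
  K_symm : ∀ s u v, ⟪K s u, v⟫_ℝ = ⟪u, K s v⟫_ℝ
  K_pos : ∀ s v, v ≠ 0 → 0 < ⟪K s v, v⟫_ℝ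
  γ : G.Interface → ℝ
  γ_pos : ∀ g, 0 < γ g
  Kν : G.Interface → E n → ℝ
  Kν_measurable : ∀ g, Measurable (Kν g)
  Kν_bounds : ∀ g, ∃ m M : ℝ, 0 < m ∧ ∀ x ∈ G.Ω (G.lo g), m ≤ Kν g x ∧ Kν g x ≤ M

/-- On the tangent space of each subdomain, the ratio of any two eigenvalues of `K` is at most
`θ`. -/
def Parameters.AnisotropyBound {n : ℕ} {G : Geometry n} (P : Parameters G) (θ : ℝ) : Prop :=
  ∀ s, ∀ u ∈ (G.plane s).direction, ∀ v ∈ (G.plane s).direction, ‖u‖ = 1 → ‖v‖ = 1 →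
    ⟪P.K s u, u⟫_ℝ ≤ θ * ⟪P.K s v, v⟫_ℝ

/-! ### The discrete problem -/

/-- All data of the mixed finite element discretization of the mixed-dimensional flow problem. -/
structure Discretization (n : ℕ) where
  G : Geometry n
  M : Mesh G
  P : Parameters G
  R : M.Λ →ₗ[ℝ] M.V
  isExtension : M.IsExtension R

/-- The inverse of a linear bijection (and `0` if the map is not bijective). -/
def inv {X Y : Type*} [AddCommGroup X] [Module ℝ X] [AddCommGroup Y] [Module ℝ Y]
    (T : X →ₗ[ℝ] Y) : Y →ₗ[ℝ] X :=
  open Classical in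
  if h : Function.Bijective T then (LinearEquiv.ofBijective T h).symm.toLinearMap else 0

/-- The operator norm `sup_{x ≠ 0} N (T x) / N x` of `T` with respect to a norm `N`. -/
def opNorm {X : Type*} [AddCommGroup X] [Module ℝ X] (N : X → ℝ) (T : X →ₗ[ℝ] X) : ℝ≥0∞ :=
  ⨆ x : {x : X // x ≠ 0}, ENNReal.ofReal (N (T x) / N x)

/-- The condition number `‖T‖ ‖T⁻¹‖` of a linear bijection `T` with respect to a norm `N`. -/
def condNumber {X : Type*} [AddCommGroup X] [Module ℝ X] (N : X → ℝ) (T : X →ₗ[ℝ] X) : ℝ≥0∞ :=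
  opNorm N T * opNorm N (inv T)

/-- A symmetric positive definite operator from the dual of `X` to `X`. -/
def IsSPD {X : Type*} [AddCommGroup X] [Module ℝ X] (H : Module.Dual ℝ X →ₗ[ℝ] X) : Prop :=
  (∀ f f' : Module.Dual ℝ X, f (H f') = f' (H f)) ∧ ∀ f : Module.Dual ℝ X, f ≠ 0 → 0 < f (H f)

/-- The operators `H` and `S` satisfy `c₁ (H f, f) ≤ (S f, f) ≤ c₂ (H f, f)`. -/
def SpectrallyEquivalent {X : Type*} [AddCommGroup X] [Module ℝ X]
    (H S : Module.Dual ℝ X →ₗ[ℝ] X) (c₁ c₂ : ℝ) : Prop :=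
  ∀ f : Module.Dual ℝ X, c₁ * f (H f) ≤ f (S f) ∧ f (S f) ≤ c₂ * f (H f)

namespace Discretization

variable {n : ℕ} (D : Discretization n)

/-- The flux space `W_h`. -/
abbrev W := D.M.W

/-- The pressure space `Q_h`. -/
abbrev Q := D.M.Q

/-- The total flux `v₀ + R μ` of `r = (v₀, μ) ∈ W_h`. -/
def flux : D.W →ₗ[ℝ] D.M.Field :=
  D.M.V0.subtype ∘ₗ LinearMap.fst ℝ D.M.V0 D.M.Λ +
    D.M.V.subtype ∘ₗ D.R ∘ₗ LinearMap.snd ℝ D.M.V0 D.M.Λ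

/-- The `L²` product `(γ Kν⁻¹ λ, μ)` over all interfaces. -/
def mortarProduct (l m : D.M.Λ) : ℝ :=
  ∑ g, ∑ τ : D.M.Mortar g,
    (∫ x in (D.M.mortarSimplex τ).closedInterior, D.P.γ g * (D.P.Kν g x)⁻¹
      ∂(Measure.euclideanHausdorffMeasure (D.G.dim (D.G.lo g)))) * (l g τ * m g τ)

/-- The operator `A : W_h → W_h'`, given by the bilinear form
`a(w, r) = (K⁻¹ (u₀ + R λ), v₀ + R μ)_Ω + (γ Kν⁻¹ λ, μ)_Γ`. -/
def A : D.W →ₗ[ℝ] Module.Dual ℝ D.W :=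
  LinearMap.mk₂ ℝ
    (fun w r => (∑ s, ∑ c : D.M.Cell s,
        cellProduct (D.M.simplex c) (D.P.K s) (D.flux w s c) (D.flux r s c)) +
      D.mortarProduct w.2 r.2)
    (by
      intro w w' r
      simp only [mortarProduct, map_add, Pi.add_apply, cellProduct_add_left, Prod.snd_add, add_mul,
        mul_add, Finset.sum_add_distrib]
      ring)
    (by
      intro t w r
      simp only [mortarProduct, map_smul, Pi.smul_apply, cellProduct_smul_left, Prod.smul_snd,
        smul_eq_mul, mul_add, Finset.mul_sum]
      congr 1
      exact Finset.sum_congr rfl fun _ _ => Finset.sum_congr rfl fun _ _ => by ring)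
    (by
      intro w r r'
      simp only [mortarProduct, map_add, Pi.add_apply, cellProduct_add_right, Prod.snd_add, mul_add,
        Finset.sum_add_distrib]
      ring)
    (by
      intro t w r
      simp only [mortarProduct, map_smul, Pi.smul_apply, cellProduct_smul_right, Prod.smul_snd,
        smul_eq_mul, mul_add, Finset.mul_sum]
      congr 1
      exact Finset.sum_congr rfl fun _ _ => Finset.sum_congr rfl fun _ _ => by ring)

/-- The operator `D_A : W_h → W_h'`, given by the bilinear form `a^D(w, r)`, in which on each
element only the diagonal of the local mass matrix of the Raviart–Thomas basis is kept. -/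
def DA : D.W →ₗ[ℝ] Module.Dual ℝ D.W :=
  LinearMap.mk₂ ℝ
    (fun w r => (∑ s, ∑ c : D.M.Cell s, ∑ k : Fin (D.G.dim s + 1),
        normalTrace (D.M.simplex c) k (D.flux w s c) *
          normalTrace (D.M.simplex c) k (D.flux r s c) *
          cellProduct (D.M.simplex c) (D.P.K s)
            (rtBasis (D.M.simplex c) k) (rtBasis (D.M.simplex c) k)) +
      D.mortarProduct w.2 r.2)
    (by
      intro w w' r
      simp only [mortarProduct, map_add, Pi.add_apply, normalTrace_add, Prod.snd_add, add_mul,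
        mul_add, Finset.sum_add_distrib]
      ring)
    (by
      intro t w r
      simp only [mortarProduct, map_smul, Pi.smul_apply, normalTrace_smul, Prod.smul_snd,
        smul_eq_mul, mul_add, Finset.mul_sum]
      congr 1
      · exact Finset.sum_congr rfl fun _ _ => Finset.sum_congr rfl fun _ _ =>
          Finset.sum_congr rfl fun _ _ => by ring
      · exact Finset.sum_congr rfl fun _ _ => Finset.sum_congr rfl fun _ _ => by ring)
    (by
      intro w r r'
      simp only [mortarProduct, map_add, Pi.add_apply, normalTrace_add, Prod.snd_add, add_mul,
        mul_add, Finset.sum_add_distrib]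
      ring)
    (by
      intro t w r
      simp only [mortarProduct, map_smul, Pi.smul_apply, normalTrace_smul, Prod.smul_snd,
        smul_eq_mul, mul_add, Finset.mul_sum]
      congr 1
      · exact Finset.sum_congr rfl fun _ _ => Finset.sum_congr rfl fun _ _ =>
          Finset.sum_congr rfl fun _ _ => by ring
      · exact Finset.sum_congr rfl fun _ _ => Finset.sum_congr rfl fun _ _ => by ring)

/-- The operator `B : W_h → Q_h'`, given by the bilinear form
`b(r, q) = -(q, ∇·(v₀ + R μ) + ⟦μ⟧)_Ω`. The jump `⟦μ⟧` on a subdomain is minus the sum of `μ`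
over the interfaces whose lower-dimensional side it is; the `L²` product of two functions that are
constant on the elements of two meshes is computed over the intersections of the elements. -/
def B : D.W →ₗ[ℝ] Module.Dual ℝ D.Q :=
  LinearMap.mk₂ ℝ
    (fun r q => -((∑ s, ∑ c : D.M.Cell s, q s c * rtDiv (D.G.dim s) (D.flux r s c) *
          vol (D.G.dim s) (D.M.simplex c).closedInterior) +
        -(∑ g, ∑ c : D.M.Cell (D.G.lo g), ∑ τ : D.M.Mortar g, q (D.G.lo g) c * r.2 g τ *
          vol (D.G.dim (D.G.lo g))
            ((D.M.simplex c).closedInterior ∩ (D.M.mortarSimplex τ).closedInterior))))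
    (by
      intro r r' q
      simp only [rtDiv, map_add, Pi.add_apply, Prod.snd_add, add_mul, mul_add,
        Finset.sum_add_distrib]
      ring)
    (by
      intro t r q
      simp only [rtDiv, map_smul, Pi.smul_apply, Prod.smul_snd, smul_eq_mul, mul_neg, mul_add,
        Finset.mul_sum]
      congr 2
      · exact Finset.sum_congr rfl fun _ _ => Finset.sum_congr rfl fun _ _ => by ring
      · congr 1
        exact Finset.sum_congr rfl fun _ _ => Finset.sum_congr rfl fun _ _ =>
          Finset.sum_congr rfl fun _ _ => by ring)
    (by
      intro r q q'
      simp only [Pi.add_apply, add_mul, Finset.sum_add_distrib]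
      ring)
    (by
      intro t r q
      simp only [Pi.smul_apply, smul_eq_mul, mul_neg, mul_add, Finset.mul_sum]
      congr 2
      · exact Finset.sum_congr rfl fun _ _ => Finset.sum_congr rfl fun _ _ => by ring
      · congr 1
        exact Finset.sum_congr rfl fun _ _ => Finset.sum_congr rfl fun _ _ =>
          Finset.sum_congr rfl fun _ _ => by ring)

/-- The transpose `Bᵀ : Q_h → W_h'`. -/
def BT : D.Q →ₗ[ℝ] Module.Dual ℝ D.W := D.B.flip

/-- The block operator `𝒜 = (A, Bᵀ; -B, 0)` of the discrete saddle point problem. -/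
def saddle : D.W × D.Q →ₗ[ℝ] Module.Dual ℝ D.W × Module.Dual ℝ D.Q :=
  LinearMap.prod (LinearMap.coprod D.A D.BT) (-(D.B ∘ₗ LinearMap.fst ℝ D.W D.Q))

/-- The operator `B D_A⁻¹ Bᵀ : Q_h → Q_h'`. -/
def schur : D.Q →ₗ[ℝ] Module.Dual ℝ D.Q := D.B ∘ₗ inv D.DA ∘ₗ D.BT

/-- The discrete gradient `D_h : Q_h → W_h`, given by `a^D(D_h q, r) = b(r, q)`. -/
def grad : D.Q →ₗ[ℝ] D.W := inv D.DA ∘ₗ D.BT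

/-- The weighted norm `|||(r, q)|||² = a(r, r) + a^D(D_h q, D_h q)`. -/
def tripleNorm (x : D.W × D.Q) : ℝ :=
  Real.sqrt (D.A x.1 x.1 + D.DA (D.grad x.2) (D.grad x.2))

/-- The bilinear form `ℒ(w, p; r, q) = a(w, r) + a^D(D_h p, r) + a^D(D_h q, w)`. -/
def form (x y : D.W × D.Q) : ℝ :=
  D.A x.1 y.1 + D.DA (D.grad x.2) y.1 + D.DA (D.grad y.2) x.1

/-- Continuity with constant `α` and inf-sup condition with constant `β` of the form `ℒ` with
respect to the weighted norm. -/
def WellPosed (α β : ℝ) : Prop :=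
  (∀ x y, |D.form x y| ≤ α * D.tripleNorm x * D.tripleNorm y) ∧
  ∀ y, y ≠ 0 → β ≤ ⨆ x : {x : D.W × D.Q // x ≠ 0},
    D.form x y / (D.tripleNorm x * D.tripleNorm y)

/-- The block diagonal operator `diag(H_w, H_p) : W_h' × Q_h' → W_h × Q_h`. -/
def blockDiag (Hw : Module.Dual ℝ D.W →ₗ[ℝ] D.W) (Hp : Module.Dual ℝ D.Q →ₗ[ℝ] D.Q) :
    Module.Dual ℝ D.W × Module.Dual ℝ D.Q →ₗ[ℝ] D.W × D.Q :=
  LinearMap.prodMap Hw Hp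

/-- The norm `‖x‖² = ⟨M⁻¹ x, x⟩` on `W_h × Q_h` induced by a preconditioner `M`. -/
def precondNorm (M : Module.Dual ℝ D.W × Module.Dual ℝ D.Q →ₗ[ℝ] D.W × D.Q) (x : D.W × D.Q) : ℝ :=
  Real.sqrt ((inv M x).1 x.1 + (inv M x).2 x.2)

end Discretization

end MixedDim

end

/-!
The transpose of `B` is injective: if `b(r, q) = 0` for all `r`, then testing with the field whose
flux is concentrated on a facet shared by two elements shows that `q` has the same value on both.
Faces of codimension two do not disconnect, so `q` is constant on each subdomain. The extensions of
the mortar indicators carry the value from one subdomain to the next, and a facet in the Dirichlet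
part shows that it is zero. Hence the Schur complement of the positive definite form `a^D` is
positive definite.

On a simplex, `a^D` is the diagonal part of the mass matrix of the local Raviart–Thomas basis. By
the Cauchy–Schwarz inequality `a ≤ (n + 1) a^D`, and on shape regular meshes `a^D ≤ C a`, because
the mean square of a Raviart–Thomas field over an inner ball controls its normal components. This
gives continuity of `ℒ`, and the inf-sup condition follows with the test pair
`(v + δ D_h q, -q)`, `δ = 1 / (n + 1)`.

Well-posedness says that the dual energy norm of `𝒜 x` lies between `β |||x|||` and `α |||x|||`; the
spectral equivalences compare the dual energy norm with the norm of the preconditioner.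
-/

noncomputable section

namespace MixedDim

/-! ### Barycentric coordinates -/

section Barycentric

variable {n d : ℕ} (T : Affine.Simplex ℝ (E n) d)

theorem foot_eq_altitudeFoot [NeZero d] (k : Fin (d + 1)) : foot T k = T.altitudeFoot k := by
  simp [foot, NeZero.ne d]

theorem height_pos [NeZero d] (k : Fin (d + 1)) : 0 < height T k := by
  rw [height, foot_eq_altitudeFoot]
  exact T.height_pos k

theorem normal_eq_zero (hd : d = 0) (k : Fin (d + 1)) : normal T k = 0 := by
  simp [normal, height, foot, hd]

theorem norm_normal [NeZero d] (k : Fin (d + 1)) : ‖normal T k‖ = 1 := by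
  have h := height_pos T k
  rw [normal, norm_smul, norm_inv, Real.norm_of_nonneg h.le, ← dist_eq_norm, dist_comm,
    ← height, inv_mul_cancel₀ h.ne']

theorem inner_normal_foot_sub_point [NeZero d] (k j : Fin (d + 1)) :
    ⟪normal T k, foot T k - T.points j⟫_ℝ = if k = j then height T k else 0 := by
  have h := height_pos T k
  rw [normal, real_inner_smul_left]
  split_ifs with hkj
  · subst hkj
    rw [real_inner_self_eq_norm_sq, ← dist_eq_norm, dist_comm, ← height]
    field_simp
  · have horth := T.inner_vsub_altitudeFoot_vsub_altitudeFoot_eq_zero hkj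
    simp only [vsub_eq_sub] at horth
    rw [foot_eq_altitudeFoot, real_inner_comm, ← neg_sub (T.points j), ← neg_sub (T.points k),
      inner_neg_neg, horth, mul_zero]

/-- The barycentric coordinate of the vertex `k`, extended from the plane of the simplex to an
affine function on `ℝⁿ` that is constant in the orthogonal directions. Since `0⁻¹ = 0`, it is the
constant one for `d = 0`. -/
def baryCoord (k : Fin (d + 1)) : E n →ᵃ[ℝ] ℝ where
  toFun x := 1 - (height T k)⁻¹ * ⟪normal T k, x - T.points k⟫_ℝ
  linear := -((height T k)⁻¹ • innerₛₗ ℝ (normal T k))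
  map_vadd' x v := by
    simp only [vadd_eq_add, add_sub_assoc, inner_add_right, LinearMap.neg_apply,
      LinearMap.smul_apply, innerₛₗ_apply_apply, smul_eq_mul]
    ring

theorem baryCoord_apply (k : Fin (d + 1)) (x : E n) :
    baryCoord T k x = 1 - (height T k)⁻¹ * ⟪normal T k, x - T.points k⟫_ℝ := rfl

theorem baryCoord_eq_inner_foot_sub [NeZero d] (k : Fin (d + 1)) (x : E n) :
    baryCoord T k x = (height T k)⁻¹ * ⟪normal T k, foot T k - x⟫_ℝ := by
  have hfoot := inner_normal_foot_sub_point T k k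
  rw [if_pos rfl] at hfoot
  rw [baryCoord_apply, ← sub_sub_sub_cancel_right (foot T k) x (T.points k),
    inner_sub_right _ (foot T k - T.points k), hfoot, mul_sub, inv_mul_cancel₀ (height_pos T k).ne']

theorem continuous_baryCoord (k : Fin (d + 1)) : Continuous (baryCoord T k) :=
  (baryCoord T k).continuous_of_finiteDimensional

theorem baryCoord_point (k j : Fin (d + 1)) :
    baryCoord T k (T.points j) = if k = j then 1 else 0 := by
  split_ifs with hkj
  · simp [baryCoord_apply, hkj]
  · have : NeZero d := ⟨by omega⟩
    rw [baryCoord_eq_inner_foot_sub, inner_normal_foot_sub_point, if_neg hkj, mul_zero]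

theorem baryCoord_affineCombination (k : Fin (d + 1)) {w : Fin (d + 1) → ℝ}
    (hw : ∑ i, w i = 1) :
    baryCoord T k (Finset.univ.affineCombination ℝ T.points w) = w k := by
  rw [Finset.map_affineCombination _ _ _ hw,
    Finset.affineCombination_eq_linear_combination _ _ _ hw]
  simp [baryCoord_point]

variable {x : E n}

theorem sum_baryCoord (hx : x ∈ affineSpan ℝ (range T.points)) : ∑ i, baryCoord T i x = 1 := by
  obtain ⟨w, hw, rfl⟩ := eq_affineCombination_of_mem_affineSpan_of_fintype hx
  simpa only [baryCoord_affineCombination T _ hw] using hw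

theorem affineCombination_baryCoord (hx : x ∈ affineSpan ℝ (range T.points)) :
    Finset.univ.affineCombination ℝ T.points (fun i => baryCoord T i x) = x := by
  obtain ⟨w, hw, rfl⟩ := eq_affineCombination_of_mem_affineSpan_of_fintype hx
  simp only [baryCoord_affineCombination T _ hw]

theorem sum_baryCoord_smul_point (hx : x ∈ affineSpan ℝ (range T.points)) :
    ∑ i, baryCoord T i x • T.points i = x := by
  rw [← Finset.affineCombination_eq_linear_combination _ _ _ (sum_baryCoord T hx),
    affineCombination_baryCoord T hx]

theorem affineMap_eq_sum_baryCoord (f : E n →ᵃ[ℝ] ℝ) (hx : x ∈ affineSpan ℝ (range T.points)) :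
    f x = ∑ i, baryCoord T i x * f (T.points i) := by
  have hsum := sum_baryCoord T hx
  conv_lhs => rw [← affineCombination_baryCoord T hx, Finset.map_affineCombination _ _ _ hsum,
    Finset.affineCombination_eq_linear_combination _ _ _ hsum]
  rfl

theorem mem_openCell_iff :
    x ∈ openCell T ↔ x ∈ affineSpan ℝ (range T.points) ∧ ∀ k, 0 < baryCoord T k x := by
  constructor
  · rintro ⟨w, hw, hpos, rfl⟩
    simp only [baryCoord_affineCombination T _ hw]
    exact ⟨affineCombination_mem_affineSpan hw _, hpos⟩
  · rintro ⟨hspan, hpos⟩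
    exact ⟨_, sum_baryCoord T hspan, hpos, affineCombination_baryCoord T hspan⟩

theorem mem_openFacet_iff {k : Fin (d + 1)} :
    x ∈ openFacet T k ↔ x ∈ affineSpan ℝ (range T.points) ∧ baryCoord T k x = 0 ∧
      ∀ i, i ≠ k → 0 < baryCoord T i x := by
  constructor
  · rintro ⟨w, hw, hk, hpos, rfl⟩
    simp only [baryCoord_affineCombination T _ hw]
    exact ⟨affineCombination_mem_affineSpan hw _, hk, hpos⟩
  · rintro ⟨hspan, hk, hpos⟩
    exact ⟨_, sum_baryCoord T hspan, hk, hpos, affineCombination_baryCoord T hspan⟩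

theorem convex_setOf_baryCoord (A : Set (Fin (d + 1))) :
    Convex ℝ {x | x ∈ affineSpan ℝ (range T.points) ∧
      (∀ i, 0 ≤ baryCoord T i x) ∧ ∀ i ∉ A, baryCoord T i x = 0} := by
  rintro x ⟨hx, hx0, hxA⟩ y ⟨hy, hy0, hyA⟩ a b ha hb hab
  refine ⟨(affineSpan ℝ (range T.points)).convex hx hy ha hb hab, fun i => ?_, fun i hi => ?_⟩
  · rw [Convex.combo_affine_apply hab]
    exact add_nonneg (mul_nonneg ha (hx0 i)) (mul_nonneg hb (hy0 i))
  · rw [Convex.combo_affine_apply hab, hxA i hi, hyA i hi, smul_zero, smul_zero, add_zero]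

theorem mem_convexHull_image_iff {A : Set (Fin (d + 1))} :
    x ∈ convexHull ℝ (T.points '' A) ↔ x ∈ affineSpan ℝ (range T.points) ∧
      (∀ i, 0 ≤ baryCoord T i x) ∧ ∀ i ∉ A, baryCoord T i x = 0 := by
  classical
  constructor
  · refine fun hx => convexHull_min ?_ (convex_setOf_baryCoord T A) hx
    rintro _ ⟨j, hj, rfl⟩
    refine ⟨mem_affineSpan ℝ (mem_range_self j), fun i => ?_, fun i hi => ?_⟩
    · rw [baryCoord_point]
      split_ifs <;> norm_num
    · rw [baryCoord_point, if_neg fun hij : i = j => hi (hij ▸ hj)]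
  · rintro ⟨hspan, hnonneg, hzero⟩
    have hsupport {i} (hi : i ∉ Finset.univ.filter (· ∈ A)) : baryCoord T i x = 0 :=
      hzero i (by simpa using hi)
    rw [← sum_baryCoord_smul_point T hspan, ← Finset.sum_subset (Finset.subset_univ _)
      fun i _ hi => by rw [hsupport hi, zero_smul]]
    refine (convex_convexHull ℝ _).sum_mem (fun i _ => hnonneg i) ?_ fun i hi =>
      subset_convexHull ℝ _ ⟨i, by simpa using hi, rfl⟩
    rw [Finset.sum_subset (Finset.subset_univ _) fun i _ hi => hsupport hi, sum_baryCoord T hspan]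

theorem mem_closedInterior_iff :
    x ∈ T.closedInterior ↔ x ∈ affineSpan ℝ (range T.points) ∧ ∀ k, 0 ≤ baryCoord T k x := by
  rw [← T.convexHull_eq_closedInterior, ← image_univ, mem_convexHull_image_iff]
  simp

theorem mem_closedFacet_iff {k : Fin (d + 1)} :
    x ∈ closedFacet T k ↔ x ∈ affineSpan ℝ (range T.points) ∧ (∀ i, 0 ≤ baryCoord T i x) ∧
      baryCoord T k x = 0 := by
  rw [closedFacet, mem_convexHull_image_iff]
  simp

theorem closedFacet_subset_closedInterior (k : Fin (d + 1)) :
    closedFacet T k ⊆ T.closedInterior := by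
  rw [closedFacet, ← T.convexHull_eq_closedInterior]
  exact convexHull_mono (image_subset_range _ _)

/-- The points of the convex hull of `V` that lie in the hull of no `V \ {v}`. For an affinely
independent set this is the relative interior of the hull; written without coordinates, it shows
that open simplices and open facets depend only on the set of their vertices. -/
def hullInterior (V : Set (E n)) : Set (E n) :=
  {x | x ∈ convexHull ℝ V ∧ ∀ v ∈ V, x ∉ convexHull ℝ (V \ {v})}

theorem hullInterior_subset_convexHull (V : Set (E n)) : hullInterior V ⊆ convexHull ℝ V :=
  fun _ hx => hx.1

theorem mem_hullInterior_image_iff {A : Set (Fin (d + 1))} :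
    x ∈ hullInterior (T.points '' A) ↔ x ∈ affineSpan ℝ (range T.points) ∧
      (∀ i ∈ A, 0 < baryCoord T i x) ∧ ∀ i ∉ A, baryCoord T i x = 0 := by
  have himage i : T.points '' A \ {T.points i} = T.points '' (A \ {i}) := by
    rw [image_sdiff T.independent.injective, image_singleton]
  simp only [hullInterior, mem_ofPred_eq, forall_mem_image, himage, mem_convexHull_image_iff]
  constructor
  · rintro ⟨⟨hspan, hnonneg, hzero⟩, hface⟩
    refine ⟨hspan, fun i hi => (hnonneg i).lt_of_ne' fun h0 => ?_, hzero⟩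
    refine hface hi ⟨hspan, hnonneg, fun j hj => ?_⟩
    by_cases hjA : j ∈ A
    · rwa [show j = i from by_contra fun hne => hj ⟨hjA, hne⟩]
    · exact hzero j hjA
  · rintro ⟨hspan, hpos, hzero⟩
    refine ⟨⟨hspan, fun i => ?_, hzero⟩, fun i hi hface => ?_⟩
    · by_cases hi : i ∈ A
      exacts [(hpos i hi).le, (hzero i hi).ge]
    · exact (hpos i hi).ne' (hface.2.2 i fun hmem => hmem.2 rfl)

theorem hullInterior_image_nonempty {A : Set (Fin (d + 1))} (hA : A.Nonempty) :
    (hullInterior (T.points '' A)).Nonempty := by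
  classical
  have hA' : A.toFinset.Nonempty := toFinset_nonempty.2 hA
  have hw := A.toFinset.sum_centroidWeightsIndicator_eq_one_of_nonempty ℝ hA'
  refine ⟨Finset.univ.affineCombination ℝ T.points (A.toFinset.centroidWeightsIndicator ℝ), ?_⟩
  rw [mem_hullInterior_image_iff]
  simp only [baryCoord_affineCombination T _ hw]
  refine ⟨affineCombination_mem_affineSpan hw T.points, fun i hi => ?_, fun i hi => ?_⟩
  · rw [Finset.centroidWeightsIndicator_def, indicator_of_mem (mem_toFinset.2 hi),
      Finset.centroidWeights_apply]
    exact inv_pos.2 (Nat.cast_pos.2 hA'.card_pos)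
  · rw [Finset.centroidWeightsIndicator_def, indicator_of_notMem (by simpa using hi)]

theorem convexHull_image_eq_closure_hullInterior {A : Set (Fin (d + 1))} (hA : A.Nonempty) :
    convexHull ℝ (T.points '' A) = closure (hullInterior (T.points '' A)) := by
  refine Subset.antisymm (fun x hx => ?_) (closure_minimal (hullInterior_subset_convexHull _)
    ((T.points '' A).toFinite.isCompact_convexHull ℝ).isClosed)
  obtain ⟨z, hz⟩ := hullInterior_image_nonempty T hA
  obtain ⟨hxspan, hxnonneg, hxzero⟩ := (mem_convexHull_image_iff T).1 hx
  obtain ⟨hzspan, hzpos, hzzero⟩ := (mem_hullInterior_image_iff T).1 hz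
  have hcont : Continuous fun t : ℝ => (AffineMap.lineMap x z t : E n) :=
    AffineMap.lineMap_continuous
  have hlim : Filter.Tendsto (fun t : ℝ => (AffineMap.lineMap x z t : E n)) (𝓝[>] 0) (𝓝 x) := by
    simpa using (hcont.tendsto 0).mono_left nhdsWithin_le_nhds
  refine mem_closure_of_tendsto hlim ?_
  filter_upwards [Ioo_mem_nhdsGT (zero_lt_one' ℝ)] with t ⟨ht0, ht1⟩
  rw [mem_hullInterior_image_iff]
  simp only [AffineMap.apply_lineMap, AffineMap.lineMap_apply_ring]
  refine ⟨AffineMap.lineMap_mem _ hxspan hzspan, fun i hi => ?_, fun i hi => ?_⟩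
  · have := mul_nonneg (sub_nonneg.2 ht1.le) (hxnonneg i)
    have := mul_pos ht0 (hzpos i hi)
    linarith
  · rw [hxzero i hi, hzzero i hi, mul_zero, mul_zero, add_zero]

theorem openCell_eq_hullInterior : openCell T = hullInterior (range T.points) := by
  ext x
  rw [← image_univ, mem_hullInterior_image_iff, mem_openCell_iff]
  simp

theorem openFacet_eq_hullInterior (k : Fin (d + 1)) :
    openFacet T k = hullInterior (T.points '' {k}ᶜ) := by
  ext x
  rw [mem_hullInterior_image_iff, mem_openFacet_iff]
  simp only [mem_compl_iff, mem_singleton_iff, not_not, forall_eq]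
  tauto

theorem openCell_nonempty : (openCell T).Nonempty := by
  rw [openCell_eq_hullInterior, ← image_univ]
  exact hullInterior_image_nonempty T univ_nonempty

theorem openFacet_nonempty [NeZero d] (k : Fin (d + 1)) : (openFacet T k).Nonempty := by
  rw [openFacet_eq_hullInterior]
  exact hullInterior_image_nonempty T (nonempty_compl_of_nontrivial k)

theorem closedInterior_eq_closure_openCell : T.closedInterior = closure (openCell T) := by
  rw [openCell_eq_hullInterior, ← T.convexHull_eq_closedInterior, ← image_univ]
  exact convexHull_image_eq_closure_hullInterior T univ_nonempty

theorem closedFacet_eq_closure_openFacet [NeZero d] (k : Fin (d + 1)) :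
    closedFacet T k = closure (openFacet T k) := by
  rw [openFacet_eq_hullInterior]
  exact convexHull_image_eq_closure_hullInterior T (nonempty_compl_of_nontrivial k)

theorem openCell_subset_closedInterior : openCell T ⊆ T.closedInterior := by
  rw [openCell_eq_hullInterior, ← T.convexHull_eq_closedInterior]
  exact hullInterior_subset_convexHull _

theorem openFacet_subset_closedFacet (k : Fin (d + 1)) : openFacet T k ⊆ closedFacet T k := by
  rw [openFacet_eq_hullInterior]
  exact hullInterior_subset_convexHull _

theorem openFacet_injective [NeZero d] : Function.Injective (openFacet T) := by
  intro k l hkl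
  obtain ⟨x, hx⟩ := openFacet_nonempty T k
  have hxk := ((mem_openFacet_iff T).1 hx).2.1
  have hxl := ((mem_openFacet_iff T).1 (hkl ▸ hx)).2.2
  by_contra hne
  exact (hxl k hne).ne' hxk

theorem finrank_direction_affineSpan :
    Module.finrank ℝ (affineSpan ℝ (range T.points)).direction = d := by
  rw [direction_affineSpan]
  exact T.independent.finrank_vectorSpan (by simp)

theorem affineSpan_eq_of_openCell_subset {P : AffineSubspace ℝ (E n)}
    (hP : Module.finrank ℝ P.direction = d) (h : openCell T ⊆ P) :
    affineSpan ℝ (range T.points) = P := by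
  have hclosed : IsClosed (P : Set (E n)) := AffineSubspace.closed_of_finiteDimensional P
  have hle : affineSpan ℝ (range T.points) ≤ P := by
    rw [affineSpan_le]
    rintro _ ⟨j, rfl⟩
    refine hclosed.closure_subset_iff.2 h ?_
    rw [← closedInterior_eq_closure_openCell]
    exact T.point_mem_closedInterior j
  refine AffineSubspace.eq_of_direction_eq_of_nonempty_of_le ?_
    ⟨T.points 0, mem_affineSpan ℝ (mem_range_self 0)⟩ hle
  refine Submodule.eq_of_le_of_finrank_eq (AffineSubspace.direction_le hle) ?_
  rw [hP, finrank_direction_affineSpan]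

end Barycentric

/-! ### The Hausdorff measure on a plane -/

section PlaneMeasure

variable {F : Type*} [NormedAddCommGroup F] [InnerProductSpace ℝ F] [FiniteDimensional ℝ F]
  {d : ℕ} {P : AffineSubspace ℝ F}

theorem finrank_vectorSpan_zeros_lt (f : F →ᵃ[ℝ] ℝ) (hf : ∃ x ∈ P, f x ≠ 0)
    (hzero : ∃ y ∈ P, f y = 0) :
    Module.finrank ℝ (vectorSpan ℝ ((P : Set F) ∩ {z | f z = 0})) <
      Module.finrank ℝ P.direction := by
  obtain ⟨x, hx, hfx⟩ := hf
  obtain ⟨y, hy, hfy⟩ := hzero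
  have hker : vectorSpan ℝ ((P : Set F) ∩ {z | f z = 0}) ≤ LinearMap.ker f.linear := by
    rw [vectorSpan_def, Submodule.span_le]
    rintro _ ⟨a, ⟨-, ha⟩, b, ⟨-, hb⟩, rfl⟩
    simp only [SetLike.mem_coe, LinearMap.mem_ker, AffineMap.linearMap_vsub]
    rw [show f a = 0 from ha, show f b = 0 from hb, vsub_self]
  refine Submodule.finrank_lt_finrank_of_lt
    ((vectorSpan_mono ℝ inter_subset_left).lt_of_ne fun heq => hfx ?_)
  have hxy : x -ᵥ y ∈ LinearMap.ker f.linear :=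
    hker (heq ▸ AffineSubspace.vsub_mem_direction hx hy)
  rwa [LinearMap.mem_ker, AffineMap.linearMap_vsub, hfy, vsub_eq_sub, sub_zero] at hxy

section Measure

variable [MeasurableSpace F] [BorelSpace F]

theorem measure_convex_eq_zero {s : Set F} (hs : Convex ℝ s)
    (h : Module.finrank ℝ (vectorSpan ℝ s) < d) : μHE[d] s = 0 := by
  rcases s.eq_empty_or_nonempty with rfl | hne
  · exact measure_empty
  have hdim : dimH s < (d : NNReal) := by
    rw [Real.Convex.dimH_eq_finrank_vectorSpan hs hne]
    exact_mod_cast h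
  have hzero := hausdorffMeasure_of_dimH_lt hdim
  rw [NNReal.coe_natCast] at hzero
  rw [Measure.euclideanHausdorffMeasure_def, Measure.smul_apply, hzero, smul_zero]

theorem measure_singleton_eq_zero (hd : d ≠ 0) (x : F) : μHE[d] {x} = 0 :=
  measure_convex_eq_zero (convex_singleton x) (by
    rw [vectorSpan_singleton, finrank_bot]
    exact Nat.pos_of_ne_zero hd)

theorem measure_plane_eq_zero (h : Module.finrank ℝ P.direction < d) : μHE[d] (P : Set F) = 0 :=
  measure_convex_eq_zero P.convex h

theorem measure_zeros_eq_zero (hP : Module.finrank ℝ P.direction = d) (f : F →ᵃ[ℝ] ℝ)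
    (hf : ∃ x ∈ P, f x ≠ 0) : μHE[d] ((P : Set F) ∩ {z | f z = 0}) = 0 := by
  rcases ((P : Set F) ∩ {z | f z = 0}).eq_empty_or_nonempty with hempty | hzero
  · rw [hempty, measure_empty]
  · exact measure_convex_eq_zero (P.convex.inter ((convex_singleton (0 : ℝ)).affine_preimage f))
      (hP ▸ finrank_vectorSpan_zeros_lt f hf hzero)

theorem measure_inter_closedBall (hP : Module.finrank ℝ P.direction = d) {x : F} (hx : x ∈ P)
    (r : ℝ) : μHE[d] ((P : Set F) ∩ Metric.closedBall x r) =
      volume (Metric.closedBall (0 : E d) r) := by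
  subst hP
  let e := (stdOrthonormalBasis ℝ P.direction).repr.symm
  let f : E _ →ₗᵢ[ℝ] F := P.direction.subtypeₗᵢ.comp e.toLinearIsometry
  have hiso : Isometry fun v => f v + x := (isometry_add_right x).comp f.isometry
  have himage : (fun v => f v + x) '' Metric.closedBall 0 r =
      (P : Set F) ∩ Metric.closedBall x r := by
    ext y
    constructor
    · rintro ⟨v, hv, rfl⟩
      refine ⟨AffineSubspace.vadd_mem_of_mem_direction (e v).2 hx, ?_⟩
      rw [mem_closedBall_iff_norm, add_sub_cancel_right, f.norm_map]
      exact mem_closedBall_zero_iff.1 hv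
    · rintro ⟨hy, hyr⟩
      refine ⟨e.symm ⟨y -ᵥ x, AffineSubspace.vsub_mem_direction hy hx⟩, ?_, by simp [f]⟩
      simpa [dist_eq_norm] using hyr
  rw [← himage, hiso.euclideanHausdorffMeasure_image,
    EuclideanSpace.euclideanHausdorffMeasure_eq_volume]

theorem measure_lt_top_of_isBounded (hP : Module.finrank ℝ P.direction = d) {s : Set F}
    (hs : Bornology.IsBounded s) (hsP : s ⊆ P) : μHE[d] s < ∞ := by
  rcases s.eq_empty_or_nonempty with rfl | ⟨x, hx⟩
  · simp
  · obtain ⟨r, hr⟩ := hs.subset_closedBall x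
    refine (measure_mono (subset_inter hsP hr)).trans_lt ?_
    rw [measure_inter_closedBall hP (hsP hx)]
    exact measure_closedBall_lt_top

theorem measure_pos_of_isOpen (hP : Module.finrank ℝ P.direction = d) {U : Set F}
    (hU : IsOpen U) (hPU : ((P : Set F) ∩ U).Nonempty) : 0 < μHE[d] ((P : Set F) ∩ U) := by
  obtain ⟨x, hx, hxU⟩ := hPU
  obtain ⟨r, hr, hrU⟩ := Metric.nhds_basis_closedBall.mem_iff.1 (hU.mem_nhds hxU)
  refine lt_of_lt_of_le ?_ (measure_mono (inter_subset_inter_right _ hrU))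
  rw [measure_inter_closedBall hP hx]
  exact Metric.measure_closedBall_pos _ _ hr

end Measure

theorem exists_mem_forall_ne_zero {U : Set F} (hU : IsOpen U) (hPU : ((P : Set F) ∩ U).Nonempty)
    {ι : Type*} [Finite ι] (f : ι → F →ᵃ[ℝ] ℝ) (hf : ∀ i, ∃ y ∈ P, f i y ≠ 0) :
    ∃ z ∈ (P : Set F) ∩ U, ∀ i, f i z ≠ 0 := by
  borelize F
  by_contra! hcover
  have hsub : (P : Set F) ∩ U ⊆ ⋃ i, (P : Set F) ∩ {z | f i z = 0} := fun z hz =>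
    have ⟨i, hi⟩ := hcover z hz
    mem_iUnion.2 ⟨i, hz.1, hi⟩
  exact (measure_pos_of_isOpen rfl hU hPU).ne' (measure_mono_null hsub
    (measure_iUnion_null fun i => measure_zeros_eq_zero rfl (f i) (hf i)))

end PlaneMeasure

/-! ### Volumes of simplices and facets -/

section SimplexVolume

variable {n d e : ℕ} (T : Affine.Simplex ℝ (E n) d) {A : Set (Fin (d + 1))}

theorem point_mem_affineSpan (k : Fin (d + 1)) : T.points k ∈ affineSpan ℝ (range T.points) :=
  mem_affineSpan ℝ (mem_range_self k)

theorem mem_affineSpan_image_iff {x : E n} :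
    x ∈ affineSpan ℝ (T.points '' A) ↔
      x ∈ affineSpan ℝ (range T.points) ∧ ∀ i ∉ A, baryCoord T i x = 0 := by
  constructor
  · refine fun hx => ⟨affineSpan_mono ℝ (image_subset_range _ _) hx, fun i hi => ?_⟩
    have hle : affineSpan ℝ (T.points '' A) ≤
        (affineSpan ℝ {(0 : ℝ)}).comap (baryCoord T i) := by
      rw [affineSpan_le]
      rintro _ ⟨j, hj, rfl⟩
      simp [baryCoord_point, (ne_of_mem_of_not_mem hj hi).symm]
    simpa using hle hx
  · rintro ⟨hx, hA⟩
    rw [← affineCombination_baryCoord T hx]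
    exact affineCombination_mem_affineSpan_image (sum_baryCoord T hx) (fun i _ hi => hA i hi) _

theorem hullInterior_image_eq_inter : hullInterior (T.points '' A) =
    (affineSpan ℝ (T.points '' A) : Set (E n)) ∩ {x | ∀ i ∈ A, 0 < baryCoord T i x} := by
  ext x
  simp only [mem_hullInterior_image_iff, mem_inter_iff, SetLike.mem_coe, mem_affineSpan_image_iff,
    mem_ofPred_eq]
  tauto

theorem isOpen_setOf_baryCoord_pos : IsOpen {x | ∀ i ∈ A, 0 < baryCoord T i x} := by
  simp only [ofPred_forall]
  exact A.toFinite.isOpen_biInter fun i _ => isOpen_lt continuous_const (continuous_baryCoord T i)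

section Image

variable (hA : Module.finrank ℝ (affineSpan ℝ (T.points '' A)).direction = e)
include hA

theorem measure_hullInterior_image_pos (hne : A.Nonempty) :
    0 < μHE[e] (hullInterior (T.points '' A)) := by
  have hnonempty := hullInterior_image_nonempty T hne
  rw [hullInterior_image_eq_inter] at hnonempty ⊢
  exact measure_pos_of_isOpen hA (isOpen_setOf_baryCoord_pos T) hnonempty

theorem measure_convexHull_image_lt_top : μHE[e] (convexHull ℝ (T.points '' A)) < ∞ :=
  measure_lt_top_of_isBounded hA ((T.points '' A).toFinite.isCompact_convexHull ℝ).isBounded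
    (convexHull_subset_affineSpan _)

theorem measure_convexHull_image_sdiff_hullInterior :
    μHE[e] (convexHull ℝ (T.points '' A) \ hullInterior (T.points '' A)) = 0 := by
  have hsub : convexHull ℝ (T.points '' A) \ hullInterior (T.points '' A) ⊆
      ⋃ i : A, (affineSpan ℝ (T.points '' A) : Set (E n)) ∩ {x | baryCoord T i x = 0} := by
    rintro x ⟨hx, hx'⟩
    have hspan := convexHull_subset_affineSpan _ hx
    rw [hullInterior_image_eq_inter] at hx'
    simp only [mem_inter_iff, hspan, true_and, mem_ofPred_eq, not_forall,
      not_lt] at hx'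
    obtain ⟨i, hi, hle⟩ := hx'
    exact mem_iUnion.2 ⟨⟨i, hi⟩, hspan,
      hle.antisymm (((mem_convexHull_image_iff T).1 hx).2.1 i)⟩
  refine measure_mono_null hsub (measure_iUnion_null fun i => ?_)
  exact measure_zeros_eq_zero hA (baryCoord T i)
    ⟨T.points i, mem_affineSpan ℝ (mem_image_of_mem _ i.2), by simp [baryCoord_point]⟩

end Image

theorem finrank_direction_affineSpan_image_univ :
    Module.finrank ℝ (affineSpan ℝ (T.points '' univ)).direction = d := by
  rw [image_univ, finrank_direction_affineSpan]

theorem measure_openCell_pos : 0 < μHE[d] (openCell T) := by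
  rw [openCell_eq_hullInterior, ← image_univ]
  exact measure_hullInterior_image_pos T (finrank_direction_affineSpan_image_univ T) univ_nonempty

theorem vol_closedInterior_pos : 0 < vol d T.closedInterior :=
  ENNReal.toReal_pos
    ((measure_openCell_pos T).trans_le (measure_mono (openCell_subset_closedInterior T))).ne'
    (measure_closedInterior_lt_top T).ne

theorem measure_closedInterior_sdiff_openCell : μHE[d] (T.closedInterior \ openCell T) = 0 := by
  rw [openCell_eq_hullInterior, ← T.convexHull_eq_closedInterior, ← image_univ]
  exact measure_convexHull_image_sdiff_hullInterior T (finrank_direction_affineSpan_image_univ T)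

theorem closedInterior_ae_eq_openCell : T.closedInterior =ᵐ[μHE[d]] openCell T :=
  ae_eq_set.2 ⟨measure_closedInterior_sdiff_openCell T, by
    rw [sdiff_eq_empty.2 (openCell_subset_closedInterior T), measure_empty]⟩

theorem measurableSet_openCell : MeasurableSet (openCell T) := by
  rw [openCell_eq_hullInterior, ← image_univ, hullInterior_image_eq_inter]
  exact (AffineSubspace.closed_of_finiteDimensional _).measurableSet.inter
    (isOpen_setOf_baryCoord_pos T).measurableSet

theorem setIntegral_closedInterior_pos {f : E n → ℝ} {C : ℝ} (hf : Measurable f)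
    (hpos : ∀ x ∈ openCell T, 0 < f x) (hle : ∀ x ∈ openCell T, f x ≤ C) :
    0 < ∫ x in T.closedInterior, f x ∂μHE[d] := by
  have hmem : ∀ᵐ x ∂μHE[d].restrict (openCell T), x ∈ openCell T :=
    ae_restrict_mem (measurableSet_openCell T)
  have hlt : μHE[d] (openCell T) < ∞ :=
    (measure_mono (openCell_subset_closedInterior T)).trans_lt (measure_closedInterior_lt_top T)
  have hint : IntegrableOn f (openCell T) μHE[d] :=
    Measure.integrableOn_of_bounded hlt.ne hf.aestronglyMeasurable <| hmem.mono fun x hx => by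
      rw [Real.norm_of_nonneg (hpos x hx).le]
      exact hle x hx
  rw [setIntegral_congr_set (closedInterior_ae_eq_openCell T),
    setIntegral_pos_iff_support_of_nonneg_ae (hmem.mono fun x hx => (hpos x hx).le) hint,
    inter_eq_right.2 (show openCell T ⊆ Function.support f from fun x hx => (hpos x hx).ne')]
  exact measure_openCell_pos T

/-- The affine plane spanned by the facet opposite to the vertex `k`. -/
def facetPlane (k : Fin (d + 1)) : AffineSubspace ℝ (E n) := affineSpan ℝ (T.points '' {k}ᶜ)

variable (hd : d = e + 1) (k : Fin (d + 1))
include hd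

theorem finrank_direction_facetPlane : Module.finrank ℝ (facetPlane T k).direction = e := by
  subst hd
  rw [facetPlane, ← Affine.Simplex.range_faceOpposite_points]
  exact finrank_direction_affineSpan (T.faceOpposite k)

theorem measure_openFacet_pos : 0 < μHE[e] (openFacet T k) := by
  rw [openFacet_eq_hullInterior]
  have : NeZero d := ⟨by omega⟩
  exact measure_hullInterior_image_pos T (finrank_direction_facetPlane T hd k)
    (nonempty_compl_of_nontrivial k)

theorem measure_closedFacet_lt_top : μHE[e] (closedFacet T k) < ∞ :=
  measure_convexHull_image_lt_top T (finrank_direction_facetPlane T hd k)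

theorem vol_closedFacet_pos : 0 < vol e (closedFacet T k) :=
  ENNReal.toReal_pos ((measure_openFacet_pos T hd k).trans_le
    (measure_mono (openFacet_subset_closedFacet T k))).ne' (measure_closedFacet_lt_top T hd k).ne

theorem measure_closedFacet_sdiff_openFacet :
    μHE[e] (closedFacet T k \ openFacet T k) = 0 := by
  rw [openFacet_eq_hullInterior]
  exact measure_convexHull_image_sdiff_hullInterior T (finrank_direction_facetPlane T hd k)

end SimplexVolume

/-! ### Lowest-order Raviart–Thomas fields on a simplex -/

section RaviartThomas

variable {n d : ℕ} (T : Affine.Simplex ℝ (E n) d)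

theorem normalTrace_eq_inner_of_baryCoord_eq_zero [NeZero d] {k : Fin (d + 1)} {x : E n}
    (hx : baryCoord T k x = 0) (v : E n × ℝ) :
    normalTrace T k v = ⟪rtEval T v x, normal T k⟫_ℝ := by
  rw [baryCoord_eq_inner_foot_sub, mul_eq_zero, or_iff_right (inv_ne_zero (height_pos T k).ne'),
    real_inner_comm] at hx
  have hfoot : rtEval T v (foot T k) = rtEval T v x + v.2 • (foot T k - x) := by
    simp only [rtEval, smul_sub]
    abel
  rw [normalTrace, hfoot, inner_add_left, real_inner_smul_left, hx, mul_zero, add_zero]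

theorem normalTrace_eq_zero_of_dim_eq_zero (hd : d = 0) (k : Fin (d + 1)) (v : E n × ℝ) :
    normalTrace T k v = 0 := by
  rw [normalTrace, normal_eq_zero T hd, inner_zero_right]

theorem normalTrace_sub (k : Fin (d + 1)) (u v : E n × ℝ) :
    normalTrace T k (u - v) = normalTrace T k u - normalTrace T k v :=
  map_sub (AddMonoidHom.mk' _ (normalTrace_add T k)) u v

theorem normalTrace_sum {ι : Type*} (s : Finset ι) (k : Fin (d + 1)) (f : ι → E n × ℝ) :
    normalTrace T k (∑ i ∈ s, f i) = ∑ i ∈ s, normalTrace T k (f i) :=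
  map_sum (AddMonoidHom.mk' _ (normalTrace_add T k)) f s

theorem rtEval_rtBasis (k : Fin (d + 1)) (x : E n) :
    rtEval T (rtBasis T k) x = (height T k)⁻¹ • (x - T.points k) := by
  rw [rtEval, rtBasis, ← smul_add, sub_add_sub_cancel']

theorem normalTrace_rtBasis [NeZero d] (j k : Fin (d + 1)) :
    normalTrace T j (rtBasis T k) = if j = k then 1 else 0 := by
  rw [normalTrace, rtEval_rtBasis, real_inner_smul_left, real_inner_comm,
    inner_normal_foot_sub_point]
  split_ifs with h
  · rw [h, inv_mul_cancel₀ (height_pos T k).ne']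
  · rw [mul_zero]

theorem rtBasis_fst_mem_direction (k : Fin (d + 1)) :
    (rtBasis T k).1 ∈ (affineSpan ℝ (range T.points)).direction :=
  Submodule.smul_mem _ _ (AffineSubspace.vsub_mem_direction (point_mem_affineSpan T 0)
    (point_mem_affineSpan T k))

theorem normal_mem_direction (k : Fin (d + 1)) :
    normal T k ∈ (affineSpan ℝ (range T.points)).direction := by
  rcases eq_or_ne d 0 with hd | hd
  · rw [normal_eq_zero T hd]
    exact Submodule.zero_mem _
  · have : NeZero d := ⟨hd⟩
    rw [normal, foot_eq_altitudeFoot]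
    exact Submodule.smul_mem _ _ (AffineSubspace.vsub_mem_direction
      (T.altitudeFoot_mem_affineSpan k) (point_mem_affineSpan T k))

theorem rtEval_mem_direction {v : E n × ℝ}
    (hv : v.1 ∈ (affineSpan ℝ (range T.points)).direction) {x : E n}
    (hx : x ∈ affineSpan ℝ (range T.points)) :
    rtEval T v x ∈ (affineSpan ℝ (range T.points)).direction :=
  Submodule.add_mem _ hv (Submodule.smul_mem _ _
    (AffineSubspace.vsub_mem_direction hx (point_mem_affineSpan T 0)))

theorem eq_zero_of_inner_normal_eq_zero (j : Fin (d + 1)) {w : E n}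
    (hw : w ∈ (affineSpan ℝ (range T.points)).direction)
    (h : ∀ k ≠ j, ⟪w, normal T k⟫_ℝ = 0) : w = 0 := by
  have hj := point_mem_affineSpan T j
  have hwj : w +ᵥ T.points j ∈ affineSpan ℝ (range T.points) :=
    AffineSubspace.vadd_mem_of_mem_direction hw hj
  have hne : ∀ k ≠ j, baryCoord T k (w +ᵥ T.points j) = baryCoord T k (T.points j) := by
    intro k hk
    rw [vadd_eq_add, baryCoord_apply, baryCoord_apply, add_sub_assoc, inner_add_right,
      real_inner_comm, h k hk, zero_add]
  have hall : ∀ k, baryCoord T k (w +ᵥ T.points j) = baryCoord T k (T.points j) := by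
    intro k
    rcases eq_or_ne k j with rfl | hk
    · have hsum := (sum_baryCoord T hwj).trans (sum_baryCoord T hj).symm
      rw [← Finset.add_sum_erase _ _ (Finset.mem_univ k),
        ← Finset.add_sum_erase _ _ (Finset.mem_univ k),
        Finset.sum_congr rfl fun i hi => hne i (Finset.ne_of_mem_erase hi)] at hsum
      exact add_right_cancel hsum
    · exact hne k hk
  have hpoint : w +ᵥ T.points j = T.points j := by
    rw [← sum_baryCoord_smul_point T hwj, ← sum_baryCoord_smul_point T hj]
    simp only [hall, sum_baryCoord_smul_point T hj]
  rwa [vadd_eq_add, add_eq_right] at hpoint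

theorem eq_zero_of_normalTrace_eq_zero [NeZero d] {v : E n × ℝ}
    (hv : v.1 ∈ (affineSpan ℝ (range T.points)).direction) (h : ∀ k, normalTrace T k v = 0) :
    v = 0 := by
  have hpoint : ∀ j, rtEval T v (T.points j) = 0 := fun j =>
    eq_zero_of_inner_normal_eq_zero T j (rtEval_mem_direction T hv (point_mem_affineSpan T j))
      fun k hk => by
        rw [← normalTrace_eq_inner_of_baryCoord_eq_zero T (by rw [baryCoord_point, if_neg hk]),
          h k]
  have hfst : v.1 = 0 := by simpa [rtEval] using hpoint 0
  have hne : Fin.last d ≠ 0 := fun hlast => NeZero.ne d (congrArg Fin.val hlast)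
  have hlast := hpoint (Fin.last d)
  rw [rtEval, hfst, zero_add, smul_eq_zero, sub_eq_zero] at hlast
  exact Prod.ext hfst (hlast.resolve_right fun h => hne (T.independent.injective h))

theorem eq_sum_normalTrace_smul_rtBasis [NeZero d] {v : E n × ℝ}
    (hv : v.1 ∈ (affineSpan ℝ (range T.points)).direction) :
    v = ∑ k, normalTrace T k v • rtBasis T k := by
  rw [← sub_eq_zero]
  refine eq_zero_of_normalTrace_eq_zero T ?_ fun k => ?_
  · rw [Prod.fst_sub, Prod.fst_sum]
    exact Submodule.sub_mem _ hv (Submodule.sum_mem _ fun k _ =>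
      Submodule.smul_mem _ _ (rtBasis_fst_mem_direction T k))
  · simp [normalTrace_sub, normalTrace_sum, normalTrace_smul, normalTrace_rtBasis]

end RaviartThomas

/-! ### The inverse of a positive definite tensor -/

section Tensor

variable {F : Type*} [NormedAddCommGroup F] [InnerProductSpace ℝ F] {κ : F ≃ₗ[ℝ] F}

theorem inner_symm_comm (hs : ∀ u v, ⟪κ u, v⟫_ℝ = ⟪u, κ v⟫_ℝ) (u v : F) :
    ⟪κ.symm u, v⟫_ℝ = ⟪κ.symm v, u⟫_ℝ := by
  have h := hs (κ.symm u) (κ.symm v)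
  rw [κ.apply_symm_apply, κ.apply_symm_apply] at h
  rw [← h, real_inner_comm]

theorem inner_symm_self_pos (hp : ∀ v, v ≠ 0 → 0 < ⟪κ v, v⟫_ℝ) {u : F} (hu : u ≠ 0) :
    0 < ⟪κ.symm u, u⟫_ℝ := by
  have h := hp (κ.symm u) (by simpa using hu)
  rwa [κ.apply_symm_apply, real_inner_comm] at h

theorem inner_symm_self_nonneg (hp : ∀ v, v ≠ 0 → 0 < ⟪κ v, v⟫_ℝ) (u : F) :
    0 ≤ ⟪κ.symm u, u⟫_ℝ := by
  rcases eq_or_ne u 0 with rfl | hu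
  · simp
  · exact (inner_symm_self_pos hp hu).le

theorem inner_map_sq_le (hs : ∀ u v, ⟪κ u, v⟫_ℝ = ⟪u, κ v⟫_ℝ)
    (hp : ∀ v, v ≠ 0 → 0 < ⟪κ v, v⟫_ℝ) (u v : F) :
    ⟪κ u, v⟫_ℝ ^ 2 ≤ ⟪κ u, u⟫_ℝ * ⟪κ v, v⟫_ℝ :=
  LinearMap.BilinForm.apply_sq_le_of_symm (innerₗ F ∘ₗ κ.toLinearMap)
    (fun x => by simpa [hs] using inner_symm_self_nonneg hp (κ x))
    ⟨fun x y => (hs x y).trans (real_inner_comm (κ y) x)⟩ u v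

variable {V : Submodule ℝ F}

theorem symm_mem_of_forall_map_mem [FiniteDimensional ℝ F] (hV : ∀ v ∈ V, κ v ∈ V) {u : F}
    (hu : u ∈ V) : κ.symm u ∈ V := by
  have hmap : V.map κ.toLinearMap = V :=
    Submodule.eq_of_le_of_finrank_eq (Submodule.map_le_iff_le_comap.2 hV)
      (LinearEquiv.finrank_map_eq κ V)
  rw [← hmap] at hu
  obtain ⟨v, hv, rfl⟩ := hu
  simpa using hv

theorem norm_sq_mul_inner_le {θ : ℝ}
    (h : ∀ u ∈ V, ∀ v ∈ V, ‖u‖ = 1 → ‖v‖ = 1 → ⟪κ u, u⟫_ℝ ≤ θ * ⟪κ v, v⟫_ℝ) {u v : F}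
    (hu : u ∈ V) (hv : v ∈ V) : ‖v‖ ^ 2 * ⟪κ u, u⟫_ℝ ≤ θ * (‖u‖ ^ 2 * ⟪κ v, v⟫_ℝ) := by
  rcases eq_or_ne u 0 with rfl | hu0
  · simp
  rcases eq_or_ne v 0 with rfl | hv0
  · simp
  have hunit := h (‖u‖⁻¹ • u) (V.smul_mem _ hu) (‖v‖⁻¹ • v) (V.smul_mem _ hv)
    (norm_smul_inv_norm hu0) (norm_smul_inv_norm hv0)
  simp only [map_smul, real_inner_smul_left, real_inner_smul_right] at hunit
  calc ‖v‖ ^ 2 * ⟪κ u, u⟫_ℝ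
      = ‖u‖ ^ 2 * ‖v‖ ^ 2 * (‖u‖⁻¹ * (‖u‖⁻¹ * ⟪κ u, u⟫_ℝ)) := by field_simp
    _ ≤ ‖u‖ ^ 2 * ‖v‖ ^ 2 * (θ * (‖v‖⁻¹ * (‖v‖⁻¹ * ⟪κ v, v⟫_ℝ))) := by gcongr
    _ = θ * (‖u‖ ^ 2 * ⟪κ v, v⟫_ℝ) := by field_simp

theorem mul_inner_symm_self_le [FiniteDimensional ℝ F] (hV : ∀ v ∈ V, κ v ∈ V) {c : ℝ}
    (hc : 0 ≤ c) (h : ∀ w ∈ V, c * ‖w‖ ^ 2 ≤ ⟪κ w, w⟫_ℝ) {u : F} (hu : u ∈ V) :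
    c * ⟪κ.symm u, u⟫_ℝ ≤ ‖u‖ ^ 2 := by
  have hw := h _ (symm_mem_of_forall_map_mem hV hu)
  rw [κ.apply_symm_apply] at hw
  have hnorm : c * ‖κ.symm u‖ ≤ ‖u‖ := by
    rcases (norm_nonneg (κ.symm u)).eq_or_lt with h0 | hpos
    · simp [← h0]
    · refine le_of_mul_le_mul_right ?_ hpos
      calc c * ‖κ.symm u‖ * ‖κ.symm u‖ = c * ‖κ.symm u‖ ^ 2 := by ring
        _ ≤ ‖u‖ * ‖κ.symm u‖ := hw.trans (real_inner_le_norm _ _)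
  calc c * ⟪κ.symm u, u⟫_ℝ ≤ c * (‖κ.symm u‖ * ‖u‖) := by gcongr; exact real_inner_le_norm _ _
    _ = c * ‖κ.symm u‖ * ‖u‖ := by ring
    _ ≤ ‖u‖ * ‖u‖ := by gcongr
    _ = ‖u‖ ^ 2 := by ring

theorem norm_sq_le_mul_inner_symm_self (hs : ∀ u v, ⟪κ u, v⟫_ℝ = ⟪u, κ v⟫_ℝ)
    (hp : ∀ v, v ≠ 0 → 0 < ⟪κ v, v⟫_ℝ) {C : ℝ} {u : F} (h : ⟪κ u, u⟫_ℝ ≤ C * ‖u‖ ^ 2) :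
    ‖u‖ ^ 2 ≤ C * ⟪κ.symm u, u⟫_ℝ := by
  rcases eq_or_ne u 0 with rfl | hu
  · simp
  have hnorm : 0 < ‖u‖ ^ 2 := by have := norm_pos_iff.2 hu; positivity
  have hcs := inner_map_sq_le hs hp (κ.symm u) u
  rw [κ.apply_symm_apply, real_inner_self_eq_norm_sq, real_inner_comm] at hcs
  refine le_of_mul_le_mul_right ?_ hnorm
  calc ‖u‖ ^ 2 * ‖u‖ ^ 2 = (‖u‖ ^ 2) ^ 2 := by ring
    _ ≤ ⟪κ.symm u, u⟫_ℝ * ⟪κ u, u⟫_ℝ := hcs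
    _ ≤ ⟪κ.symm u, u⟫_ℝ * (C * ‖u‖ ^ 2) :=
      mul_le_mul_of_nonneg_left h (inner_symm_self_nonneg hp u)
    _ = C * ⟪κ.symm u, u⟫_ℝ * ‖u‖ ^ 2 := by ring

end Tensor

/-! ### The mass matrix of a simplex -/

theorem bilinForm_sum_self_le {X ι : Type*} [AddCommGroup X] [Module ℝ X] [Fintype ι]
    (β : LinearMap.BilinForm ℝ X) (hβ : ∀ x, 0 ≤ β x x) (x : ι → X) :
    β (∑ i, x i) (∑ i, x i) ≤ Fintype.card ι * ∑ i, β (x i) (x i) := by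
  have hpair : ∀ i j, β (x i) (x j) + β (x j) (x i) ≤ β (x i) (x i) + β (x j) (x j) := by
    intro i j
    have := hβ (x i - x j)
    simp only [map_sub, LinearMap.sub_apply] at this
    linarith
  have hsum := Finset.sum_le_sum fun i (_ : i ∈ Finset.univ) =>
    Finset.sum_le_sum fun j (_ : j ∈ Finset.univ) => hpair i j
  have hexpand : ∑ i, ∑ j, β (x j) (x i) = β (∑ i, x i) (∑ i, x i) := by
    simp only [map_sum, LinearMap.sum_apply]
  simp only [Finset.sum_add_distrib, Finset.sum_comm (f := fun i j => β (x i) (x j)), hexpand,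
    Finset.sum_const, Finset.card_univ, nsmul_eq_mul, ← Finset.mul_sum] at hsum
  linarith

section CellProduct

variable {n d : ℕ} (T : Affine.Simplex ℝ (E n) d) {κ κ' : E n ≃ₗ[ℝ] E n}

theorem cellProduct_comm (hs : ∀ u v, ⟪κ u, v⟫_ℝ = ⟪u, κ v⟫_ℝ) (u v : E n × ℝ) :
    cellProduct T κ u v = cellProduct T κ v u := by
  simp only [cellProduct, inner_symm_comm hs (rtEval T u _)]

theorem cellProduct_self_nonneg (hp : ∀ v, v ≠ 0 → 0 < ⟪κ v, v⟫_ℝ) (v : E n × ℝ) :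
    0 ≤ cellProduct T κ v v :=
  integral_nonneg fun _ => inner_symm_self_nonneg hp _

theorem cellProduct_refl_self (v : E n × ℝ) :
    cellProduct T (.refl ℝ (E n)) v v = ∫ x in T.closedInterior, ‖rtEval T v x‖ ^ 2 ∂μHE[d] :=
  integral_congr_ae (ae_of_all _ fun _ => real_inner_self_eq_norm_sq _)

theorem integrableOn_norm_rtEval_sq (v : E n × ℝ) :
    IntegrableOn (fun x => ‖rtEval T v x‖ ^ 2) T.closedInterior μHE[d] := by
  simpa only [real_inner_self_eq_norm_sq, LinearEquiv.refl_symm, LinearEquiv.refl_apply]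
    using cellProduct_integrable T (.refl ℝ (E n)) v v

theorem rtEval_eq_smul_sub {v : E n × ℝ} (hv : v.2 ≠ 0) (x : E n) :
    rtEval T v x = v.2 • (x - (T.points 0 - v.2⁻¹ • v.1)) := by
  rw [rtEval, sub_sub_eq_add_sub, add_sub_right_comm, smul_add, smul_smul, mul_inv_cancel₀ hv,
    one_smul, add_comm]

theorem eq_of_rtEval_eq_zero {v : E n × ℝ} (hv : v ≠ 0) {x : E n} (hx : rtEval T v x = 0) :
    x = T.points 0 - v.2⁻¹ • v.1 := by
  rcases eq_or_ne v.2 0 with h2 | h2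
  · rw [rtEval, h2, zero_smul, add_zero] at hx
    exact absurd (Prod.ext hx h2) hv
  · rw [rtEval_eq_smul_sub T h2] at hx
    exact sub_eq_zero.1 ((smul_eq_zero.1 hx).resolve_left h2)

theorem cellProduct_self_pos (hd : d ≠ 0) (hp : ∀ v, v ≠ 0 → 0 < ⟪κ v, v⟫_ℝ) {v : E n × ℝ}
    (hv : v ≠ 0) : 0 < cellProduct T κ v v := by
  rw [cellProduct, setIntegral_pos_iff_support_of_nonneg_ae
    (ae_of_all _ fun _ => inner_symm_self_nonneg hp _) (cellProduct_integrable T κ v v)]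
  have hsub : openCell T \ {T.points 0 - v.2⁻¹ • v.1} ⊆
      (Function.support fun x => ⟪κ.symm (rtEval T v x), rtEval T v x⟫_ℝ) ∩ T.closedInterior :=
    fun x hx => ⟨(inner_symm_self_pos hp fun h => hx.2 (eq_of_rtEval_eq_zero T hv h)).ne',
      openCell_subset_closedInterior T hx.1⟩
  refine lt_of_lt_of_le ?_ (measure_mono hsub)
  rw [measure_sdiff_null (measure_singleton_eq_zero hd _)]
  exact measure_openCell_pos T

theorem mul_cellProduct_self_le {a b : ℝ} {v : E n × ℝ}
    (hv : v.1 ∈ (affineSpan ℝ (range T.points)).direction)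
    (h : ∀ u ∈ (affineSpan ℝ (range T.points)).direction,
      a * ⟪κ.symm u, u⟫_ℝ ≤ b * ⟪κ'.symm u, u⟫_ℝ) :
    a * cellProduct T κ v v ≤ b * cellProduct T κ' v v := by
  rw [cellProduct, cellProduct, ← integral_const_mul, ← integral_const_mul]
  exact setIntegral_mono_on ((cellProduct_integrable T κ v v).const_mul _)
    ((cellProduct_integrable T κ' v v).const_mul _) T.isClosed_closedInterior.measurableSet
    fun x hx => h _ (rtEval_mem_direction T hv (T.closedInterior_subset_affineSpan hx))

/-- The weighted `L²` product of Raviart–Thomas fields on a simplex, as a bilinear form. -/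
def cellForm (κ : E n ≃ₗ[ℝ] E n) : LinearMap.BilinForm ℝ (E n × ℝ) :=
  LinearMap.mk₂ ℝ (cellProduct T κ) (cellProduct_add_left T κ) (cellProduct_smul_left T κ)
    (cellProduct_add_right T κ) (cellProduct_smul_right T κ)

/-- The diagonal of the mass matrix in the local Raviart–Thomas basis: the contribution of a simplex
to `a^D`. -/
def diagonalProduct (κ : E n ≃ₗ[ℝ] E n) (u v : E n × ℝ) : ℝ :=
  ∑ k, normalTrace T k u * normalTrace T k v * cellProduct T κ (rtBasis T k) (rtBasis T k)

theorem diagonalProduct_comm (u v : E n × ℝ) :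
    diagonalProduct T κ u v = diagonalProduct T κ v u := by
  simp only [diagonalProduct, mul_comm (normalTrace T _ u)]

theorem cellProduct_self_le_diagonalProduct [NeZero d] (hp : ∀ v, v ≠ 0 → 0 < ⟪κ v, v⟫_ℝ)
    {v : E n × ℝ} (hv : v.1 ∈ (affineSpan ℝ (range T.points)).direction) :
    cellProduct T κ v v ≤ (d + 1) * diagonalProduct T κ v v := by
  have h := bilinForm_sum_self_le (cellForm T κ) (cellProduct_self_nonneg T hp)
    fun k => normalTrace T k v • rtBasis T k
  rw [← eq_sum_normalTrace_smul_rtBasis T hv] at h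
  simp only [Fintype.card_fin, map_smul, LinearMap.smul_apply, smul_eq_mul, ← mul_assoc,
    Nat.cast_add, Nat.cast_one] at h
  exact h

end CellProduct

/-! ### The mass matrix of a shape regular simplex -/

section ShapeRegularSimplex

variable {n d : ℕ} {T : Affine.Simplex ℝ (E n) d} {x : E n} {r σ : ℝ}

theorem vol_inter_closedBall {P : AffineSubspace ℝ (E n)} (hP : Module.finrank ℝ P.direction = d)
    (hx : x ∈ P) (hr : 0 ≤ r) :
    vol d ((P : Set (E n)) ∩ Metric.closedBall x r) =
      r ^ d * volume.real (Metric.closedBall (0 : E d) 1) := by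
  rw [vol, Measure.real, measure_inter_closedBall hP hx, ← Measure.real,
    Measure.addHaar_real_closedBall' _ _ hr, finrank_euclideanSpace_fin]

theorem measure_inter_closedBall_ne_top {P : AffineSubspace ℝ (E n)}
    (hP : Module.finrank ℝ P.direction = d) :
    μHE[d] ((P : Set (E n)) ∩ Metric.closedBall x r) ≠ ∞ :=
  (measure_lt_top_of_isBounded hP (Metric.isBounded_closedBall.subset inter_subset_right)
    inter_subset_left).ne

theorem half_le_vol_inter_closedBall_sdiff [NeZero d] {P : AffineSubspace ℝ (E n)}
    (hP : Module.finrank ℝ P.direction = d) {c : E n} (hx : x ∈ P) (hc : c ∈ P) (hr : 0 ≤ r) :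
    r ^ d * volume.real (Metric.closedBall (0 : E d) 1) / 2 ≤
      vol d (((P : Set (E n)) ∩ Metric.closedBall x r) \
        ((P : Set (E n)) ∩ Metric.closedBall c (r / 4))) := by
  have hsub := le_measureReal_sdiff (μ := (μHE[d] : Measure (E n)))
    (s₁ := (P : Set (E n)) ∩ Metric.closedBall x r)
    (measure_inter_closedBall_ne_top hP (x := c) (r := r / 4))
  refine le_trans ?_ hsub
  have hquarter : (1 / 4 : ℝ) ^ d ≤ 1 / 4 :=
    pow_le_of_le_one (by norm_num) (by norm_num) (NeZero.ne d)
  rw [← vol, ← vol, vol_inter_closedBall hP hx hr, vol_inter_closedBall hP hc (by positivity),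
    div_eq_mul_one_div r 4, mul_pow]
  have hball : 0 ≤ r ^ d * volume.real (Metric.closedBall (0 : E d) 1) := by positivity
  nlinarith

/-- The simplex `T` is shape regular with constant `σ`, as witnessed by the ball of its plane
with center `x` and radius `r`. -/
structure HasInnerBall (T : Affine.Simplex ℝ (E n) d) (x : E n) (r σ : ℝ) : Prop where
  center_mem : x ∈ affineSpan ℝ (range T.points)
  radius_pos : 0 < r
  ball_subset : Metric.closedBall x r ∩ affineSpan ℝ (range T.points) ⊆ T.closedInterior
  diam_le : Metric.diam T.closedInterior ≤ σ * r

theorem dist_le_diam_closedInterior {y z : E n} (hy : y ∈ T.closedInterior)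
    (hz : z ∈ T.closedInterior) : dist y z ≤ Metric.diam T.closedInterior :=
  Metric.dist_le_diam_of_mem T.isCompact_closedInterior.isBounded hy hz

namespace HasInnerBall

variable (h : HasInnerBall T x r σ)
include h

theorem dist_le {y z : E n} (hy : y ∈ T.closedInterior) (hz : z ∈ T.closedInterior) :
    dist y z ≤ σ * r := (dist_le_diam_closedInterior hy hz).trans h.diam_le

theorem center_mem_closedInterior : x ∈ T.closedInterior :=
  h.ball_subset ⟨Metric.mem_closedBall_self h.radius_pos.le, h.center_mem⟩

theorem sub_radius_smul_normal_mem [NeZero d] (k : Fin (d + 1)) :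
    x - r • normal T k ∈ T.closedInterior := by
  refine h.ball_subset ⟨?_, ?_⟩
  · rw [mem_closedBall_iff_norm, sub_sub_cancel_left, norm_neg, norm_smul, norm_normal,
      mul_one, Real.norm_of_nonneg h.radius_pos.le]
  · rw [sub_eq_neg_add]
    exact AffineSubspace.vadd_mem_of_mem_direction (Submodule.neg_mem _
      (Submodule.smul_mem _ _ (normal_mem_direction T k))) h.center_mem

theorem radius_le_height [NeZero d] (k : Fin (d + 1)) : r ≤ height T k := by
  have hmem := h.sub_radius_smul_normal_mem k
  have hle : baryCoord T k (x - r • normal T k) ≤ 1 := by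
    rw [← sum_baryCoord T (T.closedInterior_subset_affineSpan hmem)]
    exact Finset.single_le_sum (f := fun i => baryCoord T i _)
      (fun i _ => ((mem_closedInterior_iff T).1 hmem).2 i) (Finset.mem_univ k)
  have hnonneg := ((mem_closedInterior_iff T).1 h.center_mem_closedInterior).2 k
  have hshift : baryCoord T k (x - r • normal T k) = baryCoord T k x + (height T k)⁻¹ * r := by
    rw [baryCoord_apply, baryCoord_apply, sub_right_comm, inner_sub_right _ (x - _),
      real_inner_smul_right, real_inner_self_eq_norm_sq, norm_normal]
    ring
  rw [← mul_one (height T k), ← inv_mul_le_iff₀ (height_pos T k)]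
  linarith

theorem one_le [NeZero d] : 1 ≤ σ := by
  have hdist := h.dist_le h.center_mem_closedInterior (h.sub_radius_smul_normal_mem 0)
  rw [dist_eq_norm, sub_sub_cancel, norm_smul, norm_normal, mul_one,
    Real.norm_of_nonneg h.radius_pos.le] at hdist
  exact le_of_mul_le_mul_right (by rwa [one_mul]) h.radius_pos

theorem vol_closedInterior_le [NeZero d] : vol d T.closedInterior ≤
    σ ^ d * (r ^ d * volume.real (Metric.closedBall (0 : E d) 1)) := by
  have hσr : 0 ≤ σ * r := mul_nonneg (zero_le_one.trans h.one_le) h.radius_pos.le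
  have hspan := finrank_direction_affineSpan T
  rw [← mul_assoc, ← mul_pow, ← vol_inter_closedBall hspan h.center_mem hσr]
  exact measureReal_mono (fun y hy => ⟨T.closedInterior_subset_affineSpan hy,
    h.dist_le hy h.center_mem_closedInterior⟩) (measure_inter_closedBall_ne_top hspan)

theorem cellProduct_rtBasis_le [NeZero d] (k : Fin (d + 1)) :
    cellProduct T (.refl ℝ (E n)) (rtBasis T k) (rtBasis T k) ≤
      σ ^ (d + 2) * (r ^ d * volume.real (Metric.closedBall (0 : E d) 1)) := by
  have hheight := height_pos T k
  have hσ := zero_le_one.trans h.one_le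
  have hbound : ∀ z ∈ T.closedInterior, ‖rtEval T (rtBasis T k) z‖ ^ 2 ≤ σ ^ 2 := by
    intro z hz
    refine pow_le_pow_left₀ (norm_nonneg _) ?_ 2
    rw [rtEval_rtBasis, norm_smul, norm_inv, Real.norm_of_nonneg hheight.le, ← dist_eq_norm,
      inv_mul_le_iff₀ hheight, mul_comm]
    exact (h.dist_le hz (T.point_mem_closedInterior k)).trans
      (mul_le_mul_of_nonneg_left (h.radius_le_height k) hσ)
  have hint := setIntegral_mono_on (integrableOn_norm_rtEval_sq T (rtBasis T k))
    (integrableOn_const (measure_closedInterior_lt_top T).ne)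
    T.isClosed_closedInterior.measurableSet hbound
  rw [setIntegral_const, smul_eq_mul, ← cellProduct_refl_self] at hint
  calc cellProduct T (.refl ℝ (E n)) (rtBasis T k) (rtBasis T k)
      ≤ vol d T.closedInterior * σ ^ 2 := hint
    _ ≤ σ ^ d * (r ^ d * volume.real (Metric.closedBall (0 : E d) 1)) * σ ^ 2 := by
      gcongr
      exact h.vol_closedInterior_le
    _ = _ := by ring

end HasInnerBall

theorem norm_rtEval_le_mul {v : E n × ℝ} {s : ℝ} (hs : 0 ≤ s) {y z : E n}
    (hyz : dist y z ≤ s * dist z (T.points 0 - v.2⁻¹ • v.1)) :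
    ‖rtEval T v y‖ ≤ (1 + s) * ‖rtEval T v z‖ := by
  rcases eq_or_ne v.2 0 with h2 | h2
  · simp only [rtEval, h2, zero_smul, add_zero]
    nlinarith [norm_nonneg v.1]
  · rw [rtEval_eq_smul_sub T h2, rtEval_eq_smul_sub T h2, norm_smul, norm_smul, ← dist_eq_norm,
      ← dist_eq_norm, mul_left_comm]
    gcongr
    linarith [dist_triangle y z (T.points 0 - v.2⁻¹ • v.1)]

namespace HasInnerBall

variable (h : HasInnerBall T x r σ)
include h

-- A field `z ↦ b (z - c)` may vanish at `c`, so the mean square is bounded from below on the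
-- inner ball without a small ball around `c`.
theorem norm_rtEval_sq_mul_le [NeZero d] {v : E n × ℝ}
    (hv : v.1 ∈ (affineSpan ℝ (range T.points)).direction) {y : E n} (hy : y ∈ T.closedInterior) :
    ‖rtEval T v y‖ ^ 2 * (r ^ d * volume.real (Metric.closedBall (0 : E d) 1)) ≤
      2 * (1 + 4 * σ) ^ 2 * cellProduct T (.refl ℝ (E n)) v v := by
  set P := affineSpan ℝ (range T.points)
  set c := T.points 0 - v.2⁻¹ • v.1 with hc
  set S := ((P : Set (E n)) ∩ Metric.closedBall x r) \
    ((P : Set (E n)) ∩ Metric.closedBall c (r / 4))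
  have hσ := h.one_le
  have hcP : c ∈ P := by
    rw [hc, sub_eq_neg_add]
    exact AffineSubspace.vadd_mem_of_mem_direction
      (P.direction.neg_mem (P.direction.smul_mem _ hv)) (point_mem_affineSpan T 0)
  have hST : S ⊆ T.closedInterior := fun z hz => h.ball_subset hz.1.symm
  have hSm : MeasurableSet S :=
    have hP : IsClosed (P : Set (E n)) := AffineSubspace.closed_of_finiteDimensional P
    (hP.inter Metric.isClosed_closedBall).measurableSet.diff
      (hP.inter Metric.isClosed_closedBall).measurableSet
  have hpointwise : ∀ z ∈ S, ‖rtEval T v y‖ ^ 2 ≤ ((1 + 4 * σ) * ‖rtEval T v z‖) ^ 2 := by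
    intro z hz
    have hfar : r / 4 < dist z c := not_le.1 fun hle => hz.2 ⟨hz.1.1, hle⟩
    refine pow_le_pow_left₀ (norm_nonneg _) (norm_rtEval_le_mul (by positivity) ?_) 2
    nlinarith [h.dist_le hy (hST hz)]
  have hint : IntegrableOn (fun z => (1 + 4 * σ) ^ 2 * ‖rtEval T v z‖ ^ 2) T.closedInterior
      μHE[d] := (integrableOn_norm_rtEval_sq T v).const_mul _
  have hintegral : ‖rtEval T v y‖ ^ 2 * vol d S ≤
      (1 + 4 * σ) ^ 2 * cellProduct T (.refl ℝ (E n)) v v := by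
    rw [cellProduct_refl_self, ← integral_const_mul]
    refine (setIntegral_ge_of_const_le_real hSm
      ((measure_mono hST).trans_lt (measure_closedInterior_lt_top T)).ne
      (fun z hz => (hpointwise z hz).trans_eq (mul_pow _ _ 2)) (hint.mono_set hST)).trans
      (setIntegral_mono_set hint (ae_of_all _ fun z => by positivity) (ae_of_all _ hST))
  have hvol := half_le_vol_inter_closedBall_sdiff (finrank_direction_affineSpan T)
    h.center_mem hcP h.radius_pos.le
  have := mul_le_mul_of_nonneg_left hvol (sq_nonneg ‖rtEval T v y‖)
  linarith

theorem normalTrace_sq_mul_cellProduct_rtBasis_le [NeZero d] {v : E n × ℝ}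
    (hv : v.1 ∈ (affineSpan ℝ (range T.points)).direction) (k : Fin (d + 1)) :
    normalTrace T k v ^ 2 * cellProduct T (.refl ℝ (E n)) (rtBasis T k) (rtBasis T k) ≤
      2 * σ ^ (d + 2) * (1 + 4 * σ) ^ 2 * cellProduct T (.refl ℝ (E n)) v v := by
  have hσ := zero_le_one.trans h.one_le
  obtain ⟨y, hy⟩ := openFacet_nonempty T k
  have hyT := closedFacet_subset_closedInterior T k (openFacet_subset_closedFacet T k hy)
  have hsq : normalTrace T k v ^ 2 ≤ ‖rtEval T v y‖ ^ 2 := by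
    rw [normalTrace_eq_inner_of_baryCoord_eq_zero T ((mem_openFacet_iff T).1 hy).2.1]
    refine sq_le_sq.2 ((abs_real_inner_le_norm _ _).trans_eq ?_)
    rw [norm_normal, mul_one, abs_norm]
  have hbasis := h.cellProduct_rtBasis_le k
  have hbasis_nonneg : 0 ≤ cellProduct T (.refl ℝ (E n)) (rtBasis T k) (rtBasis T k) :=
    cellProduct_refl_self T (rtBasis T k) ▸ integral_nonneg fun _ => sq_nonneg _
  have hfield := h.norm_rtEval_sq_mul_le hv hyT
  generalize cellProduct T (.refl ℝ (E n)) (rtBasis T k) (rtBasis T k) = a at *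
  generalize cellProduct T (.refl ℝ (E n)) v v = b at *
  generalize r ^ d * volume.real (Metric.closedBall (0 : E d) 1) = V at *
  calc normalTrace T k v ^ 2 * a ≤ ‖rtEval T v y‖ ^ 2 * (σ ^ (d + 2) * V) :=
        mul_le_mul hsq hbasis hbasis_nonneg (sq_nonneg _)
    _ = σ ^ (d + 2) * (‖rtEval T v y‖ ^ 2 * V) := mul_left_comm _ _ _
    _ ≤ σ ^ (d + 2) * (2 * (1 + 4 * σ) ^ 2 * b) := by gcongr
    _ = 2 * σ ^ (d + 2) * (1 + 4 * σ) ^ 2 * b := by ring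

variable {κ : E n ≃ₗ[ℝ] E n} {θ : ℝ}

theorem normalTrace_sq_mul_cellProduct_rtBasis_le_of_anisotropy [NeZero d]
    (hV : ∀ v ∈ (affineSpan ℝ (range T.points)).direction,
      κ v ∈ (affineSpan ℝ (range T.points)).direction)
    (hs : ∀ u v, ⟪κ u, v⟫_ℝ = ⟪u, κ v⟫_ℝ) (hp : ∀ v, v ≠ 0 → 0 < ⟪κ v, v⟫_ℝ)
    (hani : ∀ u ∈ (affineSpan ℝ (range T.points)).direction,
      ∀ v ∈ (affineSpan ℝ (range T.points)).direction, ‖u‖ = 1 → ‖v‖ = 1 →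
        ⟪κ u, u⟫_ℝ ≤ θ * ⟪κ v, v⟫_ℝ) {v : E n × ℝ}
    (hv : v.1 ∈ (affineSpan ℝ (range T.points)).direction) (k : Fin (d + 1)) :
    normalTrace T k v ^ 2 * cellProduct T κ (rtBasis T k) (rtBasis T k) ≤
      2 * θ ^ 2 * σ ^ (d + 2) * (1 + 4 * σ) ^ 2 * cellProduct T κ v v := by
  -- The tensor is compared with the multiple `m` of the identity, one of its Rayleigh quotients.
  set e := normal T 0
  set m := ⟪κ e, e⟫_ℝ
  have he : ‖e‖ = 1 := norm_normal T 0
  have heV := normal_mem_direction T 0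
  have hm : 0 < m := hp e (norm_ne_zero_iff.1 (by rw [he]; exact one_ne_zero))
  have hθ : 0 < θ := pos_of_mul_pos_left (hm.trans_le (hani e heV e heV he he)) hm.le
  have hσ := zero_le_one.trans h.one_le
  have hlower : m / θ * cellProduct T κ (rtBasis T k) (rtBasis T k) ≤
      1 * cellProduct T (.refl ℝ (E n)) (rtBasis T k) (rtBasis T k) := by
    refine mul_cellProduct_self_le T (rtBasis_fst_mem_direction T k) fun u hu => ?_
    rw [LinearEquiv.refl_symm, LinearEquiv.refl_apply, one_mul, real_inner_self_eq_norm_sq]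
    refine mul_inner_symm_self_le hV (by positivity) (fun w hw => ?_) hu
    have := norm_sq_mul_inner_le hani heV hw
    rw [he, one_pow, one_mul] at this
    rwa [div_mul_eq_mul_div, div_le_iff₀' hθ, mul_comm m]
  have hupper : 1 * cellProduct T (.refl ℝ (E n)) v v ≤ θ * m * cellProduct T κ v v := by
    refine mul_cellProduct_self_le T hv fun u hu => ?_
    rw [LinearEquiv.refl_symm, LinearEquiv.refl_apply, one_mul, real_inner_self_eq_norm_sq]
    refine norm_sq_le_mul_inner_symm_self hs hp ?_
    have := norm_sq_mul_inner_le hani hu heV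
    rw [he, one_pow, one_mul] at this
    linarith
  rw [one_mul] at hlower hupper
  refine le_of_mul_le_mul_left ?_ (div_pos hm hθ)
  calc m / θ * (normalTrace T k v ^ 2 * cellProduct T κ (rtBasis T k) (rtBasis T k))
      = normalTrace T k v ^ 2 * (m / θ * cellProduct T κ (rtBasis T k) (rtBasis T k)) := by ring
    _ ≤ 2 * σ ^ (d + 2) * (1 + 4 * σ) ^ 2 * cellProduct T (.refl ℝ (E n)) v v :=
        (mul_le_mul_of_nonneg_left hlower (sq_nonneg _)).trans
          (h.normalTrace_sq_mul_cellProduct_rtBasis_le hv k)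
    _ ≤ 2 * σ ^ (d + 2) * (1 + 4 * σ) ^ 2 * (θ * m * cellProduct T κ v v) := by gcongr
    _ = _ := by field_simp

theorem diagonalProduct_self_le [NeZero d]
    (hV : ∀ v ∈ (affineSpan ℝ (range T.points)).direction,
      κ v ∈ (affineSpan ℝ (range T.points)).direction)
    (hs : ∀ u v, ⟪κ u, v⟫_ℝ = ⟪u, κ v⟫_ℝ) (hp : ∀ v, v ≠ 0 → 0 < ⟪κ v, v⟫_ℝ)
    (hani : ∀ u ∈ (affineSpan ℝ (range T.points)).direction,
      ∀ v ∈ (affineSpan ℝ (range T.points)).direction, ‖u‖ = 1 → ‖v‖ = 1 →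
        ⟪κ u, u⟫_ℝ ≤ θ * ⟪κ v, v⟫_ℝ) {v : E n × ℝ}
    (hv : v.1 ∈ (affineSpan ℝ (range T.points)).direction) :
    diagonalProduct T κ v v ≤
      (d + 1) * (2 * θ ^ 2 * σ ^ (d + 2) * (1 + 4 * σ) ^ 2) * cellProduct T κ v v := by
  calc diagonalProduct T κ v v
      ≤ ∑ _k : Fin (d + 1), 2 * θ ^ 2 * σ ^ (d + 2) * (1 + 4 * σ) ^ 2 * cellProduct T κ v v :=
        Finset.sum_le_sum fun k _ => by
          simpa only [pow_two (normalTrace T k v)] using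
            h.normalTrace_sq_mul_cellProduct_rtBasis_le_of_anisotropy hV hs hp hani hv k
    _ = _ := by
        rw [Finset.sum_const, Finset.card_univ, Fintype.card_fin, nsmul_eq_mul, Nat.cast_succ]
        ring

end HasInnerBall

end ShapeRegularSimplex

/-! ### Simplices with a common facet -/

section CommonFacet

variable {n d : ℕ} {T T' : Affine.Simplex ℝ (E n) d} {k k' : Fin (d + 1)}

theorem baryCoord_eq_mul_of_openFacet_eq [NeZero d] (h : openFacet T k = openFacet T' k')
    {x : E n} (hx : x ∈ affineSpan ℝ (range T.points)) :
    baryCoord T' k' x = baryCoord T k x * baryCoord T' k' (T.points k) := by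
  rw [affineMap_eq_sum_baryCoord T _ hx]
  refine Finset.sum_eq_single k (fun i _ hi => ?_) (by simp)
  have hmem : T.points i ∈ closedFacet T k := subset_convexHull ℝ _ (mem_image_of_mem _ hi)
  rw [closedFacet_eq_closure_openFacet T, h, ← closedFacet_eq_closure_openFacet T',
    mem_closedFacet_iff] at hmem
  rw [hmem.2.2, mul_zero]

theorem eventually_lineMap_mem_openCell {p q : E n} (hp : p ∈ openFacet T k)
    (hq : q ∈ affineSpan ℝ (range T.points)) (hqk : 0 < baryCoord T k q) :
    ∀ᶠ t in 𝓝[>] (0 : ℝ), AffineMap.lineMap p q t ∈ openCell T := by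
  obtain ⟨hpT, hpk, hpos⟩ := (mem_openFacet_iff T).1 hp
  have hbary : ∀ i, ∀ᶠ t in 𝓝[>] (0 : ℝ), 0 < baryCoord T i (AffineMap.lineMap p q t) := by
    intro i
    rcases eq_or_ne i k with rfl | hi
    · filter_upwards [self_mem_nhdsWithin] with t ht
      rw [AffineMap.apply_lineMap, AffineMap.lineMap_apply_ring, hpk, mul_zero, zero_add]
      exact mul_pos ht hqk
    · have hcont : Continuous fun t : ℝ => baryCoord T i (AffineMap.lineMap p q t) :=
        (continuous_baryCoord T i).comp AffineMap.lineMap_continuous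
      refine nhdsWithin_le_nhds (hcont.continuousAt.eventually_const_lt ?_)
      simpa only [AffineMap.lineMap_apply_zero] using hpos i hi
  filter_upwards [Filter.eventually_all.2 hbary] with t ht
  exact (mem_openCell_iff T).2 ⟨AffineMap.lineMap_mem _ hpT hq, ht⟩

theorem baryCoord_point_neg_of_openFacet_eq [NeZero d]
    (hspan : affineSpan ℝ (range T.points) = affineSpan ℝ (range T'.points))
    (h : openFacet T k = openFacet T' k') (hdisj : Disjoint (openCell T) (openCell T')) :
    baryCoord T' k' (T.points k) < 0 := by
  have hne : baryCoord T' k' (T.points k) ≠ 0 := by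
    intro hzero
    have hone := baryCoord_eq_mul_of_openFacet_eq h (hspan ▸ point_mem_affineSpan T' k')
    rw [hzero, mul_zero, baryCoord_point, if_pos rfl] at hone
    exact one_ne_zero hone
  by_contra! hnonneg
  obtain ⟨p, hp⟩ := openFacet_nonempty T k
  have hT := eventually_lineMap_mem_openCell hp (point_mem_affineSpan T k)
    (by rw [baryCoord_point, if_pos rfl]; exact one_pos)
  have hT' := eventually_lineMap_mem_openCell (h ▸ hp) (hspan ▸ point_mem_affineSpan T k)
    (hnonneg.lt_of_ne' hne)
  obtain ⟨t, ht, ht'⟩ := (hT.and hT').exists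
  exact Set.disjoint_left.1 hdisj ht ht'

theorem exists_mem_openFacet_of_mem_convexHull_inter {x : E n}
    (hx : x ∈ convexHull ℝ (range T.points ∩ range T'.points))
    (hgen : ∀ i j, i ≠ j → baryCoord T i x = 0 → baryCoord T j x ≠ 0)
    (hne : range T.points ≠ range T'.points) :
    ∃ k, range T.points ∩ range T'.points = T.points '' {k}ᶜ ∧ x ∈ openFacet T k := by
  set A : Set (Fin (d + 1)) := T.points ⁻¹' range T'.points with hA
  rw [← image_preimage_eq_range_inter, ← hA] at hx ⊢
  obtain ⟨hxT, hnonneg, hzero⟩ := (mem_convexHull_image_iff T).1 hx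
  obtain ⟨k, hk⟩ : ∃ k, k ∉ A := by
    by_contra! hall
    refine hne (Set.eq_of_subset_of_ncard_le (range_subset_iff.2 hall) ?_ (finite_range _))
    rw [← image_univ, ← image_univ, ncard_image_of_injective _ T.independent.injective,
      ncard_image_of_injective _ T'.independent.injective]
  have hAk : A = {k}ᶜ := by
    ext i
    refine ⟨fun hi => ne_of_mem_of_not_mem hi hk, fun hi => ?_⟩
    by_contra hiA
    exact hgen i k hi (hzero i hiA) (hzero k hk)
  refine ⟨k, by rw [hAk], (mem_openFacet_iff T).2 ⟨hxT, hzero k hk, fun i hi => ?_⟩⟩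
  exact (hnonneg i).lt_of_ne' (hgen k i hi.symm (hzero k hk))

end CommonFacet

/-! ### Generic segments -/

theorem exists_segment_forall_ne_zero {F : Type*} [NormedAddCommGroup F] [InnerProductSpace ℝ F]
    [FiniteDimensional ℝ F] {P : AffineSubspace ℝ F} {U V : Set F} (hU : IsOpen U)
    (hPU : ((P : Set F) ∩ U).Nonempty) (hV : IsOpen V) (hPV : ((P : Set F) ∩ V).Nonempty)
    {ι : Type*} [Finite ι] (f g : ι → F →ᵃ[ℝ] ℝ) (hf : ∀ i, ∃ x ∈ P, f i x ≠ 0)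
    (hfg : ∀ i, ∃ x ∈ P, f i x = 0 ∧ g i x ≠ 0) :
    ∃ y ∈ (P : Set F) ∩ U, ∃ z ∈ (P : Set F) ∩ V, ∀ i, ∀ t : ℝ,
      f i (AffineMap.lineMap y z t) = 0 → g i (AffineMap.lineMap y z t) ≠ 0 := by
  obtain ⟨y, hy, hfy⟩ := exists_mem_forall_ne_zero hU hPU f hf
  obtain ⟨z, hz, hfgz⟩ := exists_mem_forall_ne_zero hV hPV (fun i => f i y • g i - g i y • f i)
    fun i => by
      obtain ⟨x, hx, hfx, hgx⟩ := hfg i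
      exact ⟨x, hx, by simp [hfx, hgx, hfy i]⟩
  refine ⟨y, hy, z, hz, fun i t hft hgt => ?_⟩
  simp only [AffineMap.coe_sub, AffineMap.coe_smul, Pi.sub_apply, Pi.smul_apply,
    smul_eq_mul] at hfgz
  rw [AffineMap.apply_lineMap, AffineMap.lineMap_apply_ring] at hft hgt
  have hdet : t * (f i y * g i z - g i y * f i z) = 0 := by
    linear_combination f i y * hgt - g i y * hft
  rw [(mul_eq_zero.1 hdet).resolve_right (hfgz i), sub_zero, one_mul, zero_mul, add_zero] at hft
  exact hfy i hft

/-! ### Facets of a mesh -/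

namespace Geometry

variable {n : ℕ} (G : Geometry n)

theorem Ω_subset_plane (s : G.Sub) : G.Ω s ⊆ G.plane s := by
  obtain ⟨U, -, hΩ⟩ := G.relOpen s
  exact hΩ ▸ inter_subset_right

theorem disjoint_Ω_dirichlet (s : G.Sub) : Disjoint (G.Ω s) G.dirichlet :=
  Set.disjoint_left.2 fun _ hx h => (G.boundary_eq.le (Or.inl h)).2 (mem_iUnion_of_mem s hx)

theorem disjoint_Ω_neumann (s : G.Sub) : Disjoint (G.Ω s) G.neumann :=
  Set.disjoint_left.2 fun _ hx h => (G.boundary_eq.le (Or.inr h)).2 (mem_iUnion_of_mem s hx)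

theorem dim_le (s : G.Sub) : G.dim s ≤ n := by
  rw [← G.finrank_plane s]
  exact (Submodule.finrank_le _).trans_eq finrank_euclideanSpace_fin

theorem dim_hi_ne_zero (g : G.Interface) : G.dim (G.hi g) ≠ 0 := by
  rw [G.dim_hi g]
  exact Nat.succ_ne_zero _

theorem disjoint_Ω_hi_lo (g : G.Interface) : Disjoint (G.Ω (G.hi g)) (G.Ω (G.lo g)) := by
  refine G.disjoint fun h => ?_
  have hdim := G.dim_hi g
  rw [h] at hdim
  omega

end Geometry

namespace Mesh

variable {n : ℕ} {G : Geometry n} (M : Mesh G) {s : G.Sub}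

/-- The facets of the elements of a subdomain mesh: `(c, k)` stands for the facet of the element `c`
opposite to its vertex `k`, so a facet inside the subdomain is represented twice. -/
abbrev Facet (s : G.Sub) := M.Cell s × Fin (G.dim s + 1)

theorem openCell_subset (c : M.Cell s) : openCell (M.simplex c) ⊆ G.Ω s :=
  (M.partitions s).2.1 c

theorem disjoint_openCell {c c' : M.Cell s} (h : c ≠ c') :
    Disjoint (openCell (M.simplex c)) (openCell (M.simplex c')) :=
  (M.partitions s).2.2 h

theorem affineSpan_eq_plane (c : M.Cell s) :
    affineSpan ℝ (range (M.simplex c).points) = G.plane s :=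
  affineSpan_eq_of_openCell_subset _ (G.finrank_plane s)
    ((M.openCell_subset c).trans (G.Ω_subset_plane s))

theorem point_mem_plane (c : M.Cell s) (k : Fin (G.dim s + 1)) :
    (M.simplex c).points k ∈ G.plane s :=
  M.affineSpan_eq_plane c ▸ point_mem_affineSpan _ k

theorem openFacet_subset_of_mem (c : M.Cell s) {k : Fin (G.dim s + 1)} {x : E n}
    (hx : x ∈ openFacet (M.simplex c) k) (hxs : x ∈ G.Ω s) :
    openFacet (M.simplex c) k ⊆ G.Ω s := by
  rcases M.resolved s c k with h | ⟨g, hg, h, -⟩ | h | h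
  · exact h
  · exact (Set.disjoint_left.1 (hg ▸ G.disjoint_Ω_hi_lo g) hxs (h hx)).elim
  · exact (Set.disjoint_left.1 (G.disjoint_Ω_dirichlet s) hxs (h hx)).elim
  · exact (Set.disjoint_left.1 (G.disjoint_Ω_neumann s) hxs (h hx)).elim

/-- Two different elements of a subdomain are adjacent if they share a facet that lies inside the
subdomain. -/
def Adjacent (c c' : M.Cell s) : Prop :=
  c ≠ c' ∧ ∃ k k', openFacet (M.simplex c) k = openFacet (M.simplex c') k' ∧
    openFacet (M.simplex c) k ⊆ G.Ω s

theorem adjacent_of_mem {c c' : M.Cell s} (hcc : c ≠ c') {x : E n}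
    (hx : x ∈ (M.simplex c).closedInterior) (hx' : x ∈ (M.simplex c').closedInterior)
    (hxs : x ∈ G.Ω s)
    (hgen : ∀ (e : M.Cell s) i j, i ≠ j → baryCoord (M.simplex e) i x = 0 →
      baryCoord (M.simplex e) j x ≠ 0) : M.Adjacent c c' := by
  have hconf := M.conforming s c c' ⟨⟨hx, hx'⟩, hxs⟩
  have hne : range (M.simplex c).points ≠ range (M.simplex c').points := by
    intro h
    have hcell : openCell (M.simplex c) = openCell (M.simplex c') := by
      rw [openCell_eq_hullInterior, openCell_eq_hullInterior, h]
    obtain ⟨y, hy⟩ := openCell_nonempty (M.simplex c)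
    exact Set.disjoint_left.1 (M.disjoint_openCell hcc) hy (hcell ▸ hy)
  obtain ⟨k, hk, hxk⟩ := exists_mem_openFacet_of_mem_convexHull_inter hconf (hgen c) hne
  rw [inter_comm] at hconf
  obtain ⟨k', hk', -⟩ := exists_mem_openFacet_of_mem_convexHull_inter hconf (hgen c') hne.symm
  refine ⟨hcc, k, k', ?_, M.openFacet_subset_of_mem c hxk hxs⟩
  rw [openFacet_eq_hullInterior, openFacet_eq_hullInterior, ← hk, ← hk', inter_comm]

theorem Ω_subset_iUnion_closedInterior (s : G.Sub) :
    G.Ω s ⊆ ⋃ c : M.Cell s, (M.simplex c).closedInterior :=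
  (M.partitions s).1 ▸ subset_closure

theorem exists_mem_closedInterior_inter {C : Set (E n)} (hC : IsPreconnected C)
    (hCΩ : C ⊆ G.Ω s) (I : Set (M.Cell s)) {c c' : M.Cell s} (hc : c ∈ I)
    (hCc : (C ∩ (M.simplex c).closedInterior).Nonempty) (hc' : c' ∉ I)
    (hCc' : (C ∩ (M.simplex c').closedInterior).Nonempty) :
    ∃ x ∈ C, ∃ e ∈ I, x ∈ (M.simplex e).closedInterior ∧
      ∃ e' ∉ I, x ∈ (M.simplex e').closedInterior := by
  have hclosed : ∀ J : Set (M.Cell s), IsClosed (⋃ e ∈ J, (M.simplex e).closedInterior) :=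
    fun J => J.toFinite.isClosed_biUnion fun e _ => (M.simplex e).isClosed_closedInterior
  have hcover : C ⊆
      (⋃ e ∈ I, (M.simplex e).closedInterior) ∪ ⋃ e ∈ Iᶜ, (M.simplex e).closedInterior := by
    rw [← biUnion_union, union_compl_self, biUnion_univ]
    exact hCΩ.trans (M.Ω_subset_iUnion_closedInterior s)
  obtain ⟨x, hxC, hxI, hxJ⟩ := isPreconnected_closed_iff.1 hC _ _ (hclosed I) (hclosed Iᶜ) hcover
    (hCc.mono (inter_subset_inter_right C (subset_biUnion_of_mem hc)))
    (hCc'.mono (inter_subset_inter_right C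
      (subset_biUnion_of_mem (u := fun e => (M.simplex e).closedInterior)
        (show c' ∈ Iᶜ from hc'))))
  obtain ⟨e, heI, he⟩ := mem_iUnion₂.1 hxI
  obtain ⟨e', heJ, he'⟩ := mem_iUnion₂.1 hxJ
  exact ⟨x, hxC, e, heI, he, e', heJ, he'⟩

theorem exists_generic_segment {c c' : M.Cell s} {x : E n} (hxs : x ∈ G.Ω s)
    (hx : x ∈ (M.simplex c).closedInterior) (hx' : x ∈ (M.simplex c').closedInterior) :
    ∃ y ∈ openCell (M.simplex c), ∃ z ∈ openCell (M.simplex c'), segment ℝ y z ⊆ G.Ω s ∧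
      ∀ p ∈ segment ℝ y z, ∀ (e : M.Cell s) i j, i ≠ j → baryCoord (M.simplex e) i p = 0 →
        baryCoord (M.simplex e) j p ≠ 0 := by
  obtain ⟨U, hU, hΩ⟩ := G.relOpen s
  obtain ⟨ρ, hρ, hball⟩ := Metric.isOpen_iff.1 hU x (hΩ ▸ hxs).1
  have hopenCell : ∀ e : M.Cell s, openCell (M.simplex e) =
      (G.plane s : Set (E n)) ∩ {z | ∀ k ∈ univ, 0 < baryCoord (M.simplex e) k z} := by
    intro e
    rw [openCell_eq_hullInterior, ← image_univ, hullInterior_image_eq_inter, image_univ,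
      M.affineSpan_eq_plane]
  have hopen : ∀ e : M.Cell s,
      IsOpen (Metric.ball x ρ ∩ {z | ∀ k ∈ univ, 0 < baryCoord (M.simplex e) k z}) := fun e =>
    Metric.isOpen_ball.inter (isOpen_setOf_baryCoord_pos _)
  have hnear : ∀ e : M.Cell s, x ∈ (M.simplex e).closedInterior → ((G.plane s : Set (E n)) ∩
      (Metric.ball x ρ ∩ {z | ∀ k ∈ univ, 0 < baryCoord (M.simplex e) k z})).Nonempty := by
    intro e he
    rw [closedInterior_eq_closure_openCell] at he
    rw [inter_left_comm, ← hopenCell]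
    exact mem_closure_iff.1 he _ Metric.isOpen_ball (Metric.mem_ball_self hρ)
  obtain ⟨y, hy, z, hz, hgen⟩ := exists_segment_forall_ne_zero (hopen c) (hnear c hx)
    (hopen c') (hnear c' hx')
    (fun i : M.Cell s × {p : Fin (G.dim s + 1) × Fin (G.dim s + 1) // p.1 ≠ p.2} =>
      baryCoord (M.simplex i.1) i.2.1.1)
    (fun i => baryCoord (M.simplex i.1) i.2.1.2)
    (fun i => ⟨_, M.point_mem_plane i.1 i.2.1.1, by simp [baryCoord_point]⟩)
    (fun i => ⟨_, M.point_mem_plane i.1 i.2.1.2, by simp [baryCoord_point, i.2.2]⟩)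
  refine ⟨y, hopenCell c ▸ ⟨hy.1, hy.2.2⟩, z, hopenCell c' ▸ ⟨hz.1, hz.2.2⟩, fun p hp => ?_,
    fun p hp e i j hij => ?_⟩
  · rw [hΩ]
    exact ⟨hball ((convex_ball x ρ).segment_subset hy.2.1 hz.2.1 hp),
      (G.plane s).convex.segment_subset hy.1 hz.1 hp⟩
  · rw [segment_eq_image_lineMap] at hp
    obtain ⟨t, -, rfl⟩ := hp
    exact hgen (e, ⟨(i, j), hij⟩) t

-- Faces of codimension two do not disconnect: a generic segment joining two elements near a common
-- point of theirs leaves an element only through the relative interior of a facet.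
theorem reflTransGen_adjacent (c c' : M.Cell s) : Relation.ReflTransGen M.Adjacent c c' := by
  by_contra hcc'
  set I : Set (M.Cell s) := {e | Relation.ReflTransGen M.Adjacent c e}
  have hmeet : ∀ e : M.Cell s, (G.Ω s ∩ (M.simplex e).closedInterior).Nonempty := fun e =>
    (openCell_nonempty (M.simplex e)).mono
      (subset_inter (M.openCell_subset e) (openCell_subset_closedInterior _))
  obtain ⟨x, hxs, e, he, hxe, e', he', hxe'⟩ := M.exists_mem_closedInterior_inter
    (G.isConnected s).isPreconnected subset_rfl I Relation.ReflTransGen.refl (hmeet c) hcc'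
    (hmeet c')
  obtain ⟨y, hy, z, hz, hseg, hgen⟩ := M.exists_generic_segment hxs hxe hxe'
  obtain ⟨p, hp, a, ha, hpa, a', ha', hpa'⟩ := M.exists_mem_closedInterior_inter
    (convex_segment y z).isPreconnected hseg I he
    ⟨y, left_mem_segment ℝ y z, openCell_subset_closedInterior _ hy⟩ he'
    ⟨z, right_mem_segment ℝ y z, openCell_subset_closedInterior _ hz⟩
  exact ha' (Relation.ReflTransGen.tail ha (M.adjacent_of_mem (ne_of_mem_of_not_mem ha ha')
    hpa hpa' (hseg hp) (hgen p hp)))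

variable {M} in
theorem Adjacent.dim_ne_zero {c c' : M.Cell s} (h : M.Adjacent c c') : G.dim s ≠ 0 := by
  intro hd
  have hplane : ∀ e : M.Cell s, openCell (M.simplex e) ⊆ G.plane s := fun e =>
    (M.openCell_subset e).trans (G.Ω_subset_plane s)
  have hbot := G.finrank_plane s
  rw [hd, Submodule.finrank_eq_zero] at hbot
  obtain ⟨x, hx⟩ := openCell_nonempty (M.simplex c)
  obtain ⟨y, hy⟩ := openCell_nonempty (M.simplex c')
  have hxy := AffineSubspace.vsub_mem_direction (hplane c hx) (hplane c' hy)
  rw [hbot, Submodule.mem_bot, vsub_eq_zero_iff_eq] at hxy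
  exact Set.disjoint_left.1 (M.disjoint_openCell h.1) hx (hxy ▸ hy)

-- A third element with the same facet would lie on the same side of it as one of the other two.
theorem facet_eq_of_openFacet_eq [NeZero (G.dim s)] {f f' f'' : M.Facet s}
    (hf' : f'.1 ≠ f.1) (hf'' : f''.1 ≠ f.1)
    (h' : openFacet (M.simplex f.1) f.2 = openFacet (M.simplex f'.1) f'.2)
    (h'' : openFacet (M.simplex f.1) f.2 = openFacet (M.simplex f''.1) f''.2) : f' = f'' := by
  have hspan : ∀ a b : M.Cell s, affineSpan ℝ (range (M.simplex a).points) =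
      affineSpan ℝ (range (M.simplex b).points) := fun a b => by simp only [M.affineSpan_eq_plane]
  obtain ⟨c', k'⟩ := f'
  obtain ⟨c'', k''⟩ := f''
  obtain rfl : c' = c'' := by
    by_contra hne
    have hneg' := baryCoord_point_neg_of_openFacet_eq (hspan _ _) h'
      (M.disjoint_openCell hf'.symm)
    have hneg'' := baryCoord_point_neg_of_openFacet_eq (hspan _ _) h''
      (M.disjoint_openCell hf''.symm)
    have hneg := baryCoord_point_neg_of_openFacet_eq (hspan _ _) (h'.symm.trans h'')
      (M.disjoint_openCell hne)
    have hmul := baryCoord_eq_mul_of_openFacet_eq (h'.symm.trans h'')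
      (hspan f.1 c' ▸ point_mem_affineSpan (M.simplex f.1) f.2)
    exact (mul_pos_of_neg_of_neg hneg' hneg).not_gt (hmul ▸ hneg'')
  exact Prod.ext rfl (openFacet_injective _ (h'.symm.trans h''))

end Mesh

variable {n d : ℕ}

section Facets

variable {T : Affine.Simplex ℝ (E n) d} {k : Fin (d + 1)}

theorem not_openFacet_subset_of_disjoint [NeZero d] {s t : Set (E n)} (hst : Disjoint s t)
    (hs : openFacet T k ⊆ s) : ¬ openFacet T k ⊆ t := fun ht =>
  have ⟨_, hx⟩ := openFacet_nonempty T k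
  Set.disjoint_left.1 hst (hs hx) (ht hx)

/-- The `(d - 1)`-dimensional volume of the facet opposite to the vertex `k`, computed from the
volume and the height of the simplex. It is the integral over the simplex of the divergence of
`rtBasis T k`. -/
def facetWeight (T : Affine.Simplex ℝ (E n) d) (k : Fin (d + 1)) : ℝ :=
  rtDiv d (rtBasis T k) * vol d T.closedInterior

theorem facetWeight_nonneg (T : Affine.Simplex ℝ (E n) d) (k : Fin (d + 1)) :
    0 ≤ facetWeight T k :=
  mul_nonneg (mul_nonneg d.cast_nonneg (inv_nonneg.2 dist_nonneg)) measureReal_nonneg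

theorem facetWeight_pos [NeZero d] (T : Affine.Simplex ℝ (E n) d) (k : Fin (d + 1)) :
    0 < facetWeight T k :=
  mul_pos (mul_pos (Nat.cast_pos.2 (NeZero.pos d)) (inv_pos.2 (height_pos T k)))
    (vol_closedInterior_pos T)

theorem vol_le_sum_inter {ι : Type*} [Fintype ι] {s : Set (E n)} {t : ι → Set (E n)}
    (h : s ⊆ ⋃ i, t i) : vol d s ≤ ∑ i, vol d (s ∩ t i) :=
  calc vol d s = vol d (⋃ i, s ∩ t i) := by rw [← inter_iUnion, inter_eq_self_of_subset_left h]
    _ ≤ ∑ i, vol d (s ∩ t i) := measureReal_iUnion_fintype_le _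

end Facets

namespace Mesh

variable {G : Geometry n} (M : Mesh G) {s : G.Sub}

/-- The field whose normal component on each facet `f` is `t s f`. -/
def traceField (t : ∀ s, M.Facet s → ℝ) : M.Field :=
  fun s c => ∑ k, t s (c, k) • rtBasis (M.simplex c) k

theorem normalTrace_traceField [NeZero (G.dim s)] (t : ∀ s, M.Facet s → ℝ) (f : M.Facet s) :
    normalTrace (M.simplex f.1) f.2 (M.traceField t s f.1) = t s f := by
  simp [traceField, normalTrace_sum, normalTrace_smul, normalTrace_rtBasis]

theorem rtDiv_traceField_mul_vol (t : ∀ s, M.Facet s → ℝ) (c : M.Cell s) :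
    rtDiv (G.dim s) (M.traceField t s c) * vol (G.dim s) (M.simplex c).closedInterior =
      ∑ k, t s (c, k) * facetWeight (M.simplex c) k := by
  simp only [traceField, rtDiv, facetWeight, Prod.snd_sum, Prod.smul_snd, smul_eq_mul,
    Finset.mul_sum, Finset.sum_mul]
  exact Finset.sum_congr rfl fun k _ => by ring

theorem traceField_mem_V {t : ∀ s, M.Facet s → ℝ}
    (hcont : ∀ s (f f' : M.Facet s), f.1 ≠ f'.1 →
      openFacet (M.simplex f.1) f.2 = openFacet (M.simplex f'.1) f'.2 →
      openFacet (M.simplex f.1) f.2 ⊆ G.Ω s → t s f + t s f' = 0)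
    (hneumann : ∀ s (f : M.Facet s), t s f ≠ 0 → ¬ openFacet (M.simplex f.1) f.2 ⊆ G.neumann) :
    M.traceField t ∈ M.V := by
  refine ⟨fun s c => ⟨?_, fun hd => ?_⟩, fun s c c' k k' hcc heq hsub => ?_, fun s c k hk => ?_⟩
  · rw [traceField, Prod.fst_sum, ← M.affineSpan_eq_plane c]
    exact Submodule.sum_mem _ fun k _ => Submodule.smul_mem _ _ (rtBasis_fst_mem_direction _ k)
  · rw [traceField, Prod.snd_sum]
    refine Finset.sum_eq_zero fun k _ => ?_
    simp [rtBasis, height, foot, hd]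
  · by_cases hd : G.dim s = 0
    · simp only [normalTrace_eq_zero_of_dim_eq_zero _ hd, add_zero]
    · have : NeZero (G.dim s) := ⟨hd⟩
      rw [M.normalTrace_traceField t (c, k), M.normalTrace_traceField t (c', k')]
      exact hcont s (c, k) (c', k') hcc heq hsub
  · by_cases hd : G.dim s = 0
    · exact normalTrace_eq_zero_of_dim_eq_zero _ hd _ _
    · have : NeZero (G.dim s) := ⟨hd⟩
      rw [M.normalTrace_traceField t (c, k)]
      exact not_not.1 fun h => hneumann s (c, k) h hk

variable {M}

theorem OnInterface.dim_ne_zero {g : G.Interface} {c : M.Cell s} {k : Fin (G.dim s + 1)}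
    (h : M.OnInterface g c k) : G.dim s ≠ 0 :=
  h.1 ▸ G.dim_hi_ne_zero g

theorem OnInterface.not_subset_Ω {g : G.Interface} {c : M.Cell s} {k : Fin (G.dim s + 1)}
    (h : M.OnInterface g c k) : ¬ openFacet (M.simplex c) k ⊆ G.Ω s :=
  have : NeZero (G.dim s) := ⟨h.dim_ne_zero⟩
  not_openFacet_subset_of_disjoint (h.1 ▸ (G.disjoint_Ω_hi_lo g).symm) h.2.1

theorem OnInterface.vol_closedFacet_pos {g : G.Interface} {c : M.Cell s}
    {k : Fin (G.dim s + 1)} (h : M.OnInterface g c k) :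
    0 < vol (G.dim (G.lo g)) (closedFacet (M.simplex c) k) :=
  MixedDim.vol_closedFacet_pos _ (h.1 ▸ G.dim_hi g) k

theorem OnInterface.vol_closedFacet_le_sum_mortar {g : G.Interface} {c : M.Cell s}
    {k : Fin (G.dim s + 1)} (h : M.OnInterface g c k) :
    vol (G.dim (G.lo g)) (closedFacet (M.simplex c) k) ≤ ∑ τ : M.Mortar g,
      vol (G.dim (G.lo g)) (closedFacet (M.simplex c) k ∩ (M.mortarSimplex τ).closedInterior) := by
  have : NeZero (G.dim s) := ⟨h.dim_ne_zero⟩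
  refine vol_le_sum_inter ?_
  rw [(M.mortar_partitions g).1, closedFacet_eq_closure_openFacet]
  exact closure_mono h.2.1

variable (M)

theorem exists_onInterface (g : G.Interface) :
    ∃ f : M.Facet (G.hi g), M.OnInterface g f.1 f.2 := by
  obtain ⟨x, hx⟩ := (G.isConnected (G.lo g)).nonempty
  obtain ⟨⟨f, hf⟩, -⟩ := mem_iUnion.1 ((M.trace_partitions g).1.ge (subset_closure hx))
  exact ⟨f, rfl, hf⟩

theorem vol_closedInterior_le_sum_mortar (g : G.Interface) (c : M.Cell (G.lo g)) :
    vol (G.dim (G.lo g)) (M.simplex c).closedInterior ≤ ∑ τ : M.Mortar g,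
      vol (G.dim (G.lo g)) ((M.simplex c).closedInterior ∩ (M.mortarSimplex τ).closedInterior) := by
  refine vol_le_sum_inter ?_
  rw [(M.mortar_partitions g).1, ← (M.partitions (G.lo g)).1]
  exact subset_iUnion (fun c : M.Cell (G.lo g) => (M.simplex c).closedInterior) c

theorem exists_mem_closedFacet_sdiff_openFacet {c : M.Cell s}
    (hc : ∀ k, ¬ openFacet (M.simplex c) k ⊆ G.dirichlet) {x : E n} (hx : x ∈ G.dirichlet)
    (hxc : x ∈ (M.simplex c).closedInterior) :
    ∃ k, x ∈ closedFacet (M.simplex c) k \ openFacet (M.simplex c) k := by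
  have hnot : x ∉ openCell (M.simplex c) := fun h =>
    Set.disjoint_left.1 (G.disjoint_Ω_dirichlet s) (M.openCell_subset c h) hx
  rw [mem_closedInterior_iff] at hxc
  simp only [mem_openCell_iff, hxc.1, true_and, not_forall, not_lt] at hnot
  obtain ⟨k, hk⟩ := hnot
  refine ⟨k, (mem_closedFacet_iff _).2 ⟨hxc.1, hxc.2, le_antisymm hk (hxc.2 k)⟩, fun hxk => ?_⟩
  rcases M.resolved s c k with h | ⟨g, -, h, -⟩ | h | h
  · exact Set.disjoint_left.1 (G.disjoint_Ω_dirichlet s) (h hxk) hx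
  · exact Set.disjoint_left.1 (G.disjoint_Ω_dirichlet _) (h hxk) hx
  · exact hc k h
  · exact Set.disjoint_left.1 G.boundary_disjoint hx (h hxk)

theorem measure_dirichlet_inter_eq_zero {c : M.Cell s}
    (hc : G.dim s ≠ 0 → ∀ k, ¬ openFacet (M.simplex c) k ⊆ G.dirichlet) :
    μHE[n - 1] (G.dirichlet ∩ (M.simplex c).closedInterior) = 0 := by
  have hle := G.dim_le s
  rcases lt_trichotomy (G.dim s) (n - 1) with hlt | heq | hgt
  · refine measure_mono_null (inter_subset_right.trans
      (M.simplex c).closedInterior_subset_affineSpan) (measure_plane_eq_zero ?_)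
    rwa [finrank_direction_affineSpan]
  · rw [← heq]
    refine measure_mono_null ?_ (measure_closedInterior_sdiff_openCell (M.simplex c))
    exact fun x hx => ⟨hx.2, fun h =>
      Set.disjoint_left.1 (G.disjoint_Ω_dirichlet s) (M.openCell_subset c h) hx.1⟩
  · refine measure_mono_null (t := ⋃ k, closedFacet (M.simplex c) k \ openFacet (M.simplex c) k)
      (fun x hx => mem_iUnion.2 ?_)
      (measure_iUnion_null fun k => measure_closedFacet_sdiff_openFacet _ (by omega) k)
    exact M.exists_mem_closedFacet_sdiff_openFacet (hc (by omega)) hx.1 hx.2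

theorem exists_dirichlet_facet : ∃ s, G.dim s ≠ 0 ∧ ∃ f : M.Facet s,
    openFacet (M.simplex f.1) f.2 ⊆ G.dirichlet := by
  by_contra! hcon
  refine G.dirichlet_pos.ne' (measure_mono_null
    (t := ⋃ s, ⋃ c : M.Cell s, G.dirichlet ∩ (M.simplex c).closedInterior) (fun x hx => ?_)
    (measure_iUnion_null fun s => measure_iUnion_null fun c =>
      M.measure_dirichlet_inter_eq_zero fun hd k => hcon s hd (c, k)))
  have hcl : x ∈ closure (⋃ s, G.Ω s) := (G.boundary_eq.le (Or.inl hx)).1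
  rw [closure_iUnion_of_finite] at hcl
  obtain ⟨s, hs⟩ := mem_iUnion.1 hcl
  rw [← (M.partitions s).1] at hs
  obtain ⟨c, hc⟩ := mem_iUnion.1 hs
  exact mem_iUnion₂.2 ⟨s, c, hx, hc⟩

end Mesh

namespace Discretization

variable {n : ℕ} {D : Discretization n} {q : D.Q} {s : D.G.Sub}

theorem flux_apply (r : D.W) : D.flux r = (r.1 : D.M.Field) + (D.R r.2 : D.M.Field) := rfl

theorem B_apply_of_flux_eq_traceField {r : D.W} {t : ∀ s, D.M.Facet s → ℝ}
    (h : D.flux r = D.M.traceField t) (q : D.Q) :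
    D.B r q = -∑ s, ∑ f : D.M.Facet s, q s f.1 * (t s f * facetWeight (D.M.simplex f.1) f.2) +
      ∑ g, ∑ c : D.M.Cell (D.G.lo g), ∑ τ : D.M.Mortar g, q (D.G.lo g) c * r.2 g τ *
        vol (D.G.dim (D.G.lo g))
          ((D.M.simplex c).closedInterior ∩ (D.M.mortarSimplex τ).closedInterior) := by
  simp only [B, LinearMap.mk₂_apply, h, mul_assoc (q _ _) (rtDiv _ _),
    D.M.rtDiv_traceField_mul_vol, Finset.mul_sum, Fintype.sum_prod_type, neg_add, neg_neg]

theorem sum_trace_eq_zero [NeZero (D.G.dim s)] (hq : ∀ r, D.B r q = 0) (t : D.M.Facet s → ℝ)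
    (hcont : ∀ f f' : D.M.Facet s, f.1 ≠ f'.1 →
      openFacet (D.M.simplex f.1) f.2 = openFacet (D.M.simplex f'.1) f'.2 →
      openFacet (D.M.simplex f.1) f.2 ⊆ D.G.Ω s → t f + t f' = 0)
    (hsupp : ∀ f, t f ≠ 0 → openFacet (D.M.simplex f.1) f.2 ⊆ D.G.Ω s ∨
      openFacet (D.M.simplex f.1) f.2 ⊆ D.G.dirichlet) :
    ∑ f, q s f.1 * (t f * facetWeight (D.M.simplex f.1) f.2) = 0 := by
  classical
  set t' : ∀ s, D.M.Facet s → ℝ := Pi.single s t with ht'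
  have hself : t' s = t := by rw [ht', Pi.single_eq_same]
  have hne : ∀ s' ≠ s, t' s' = 0 := fun s' h => by rw [ht', Pi.single_eq_of_ne h]
  have hV : D.M.traceField t' ∈ D.M.V := by
    refine D.M.traceField_mem_V (fun s' f f' hff => ?_) fun s' f => ?_
    · obtain rfl | h := eq_or_ne s' s
      · exact hself ▸ hcont f f' hff
      · simp [hne s' h]
    · obtain rfl | h := eq_or_ne s' s
      · rw [hself]
        exact fun hf => (hsupp f hf).elim
          (not_openFacet_subset_of_disjoint (D.G.disjoint_Ω_neumann s'))
          (not_openFacet_subset_of_disjoint D.G.boundary_disjoint)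
      · simp [hne s' h]
  have hV0 : D.M.traceField t' ∈ D.M.V0 := by
    refine ⟨hV, fun g s' c k hg => ?_⟩
    have : NeZero (D.G.dim s') := ⟨hg.dim_ne_zero⟩
    rw [D.M.normalTrace_traceField t' (c, k)]
    obtain rfl | h := eq_or_ne s' s
    · rw [hself]
      by_contra hf
      exact (hsupp (c, k) hf).elim hg.not_subset_Ω
        (not_openFacet_subset_of_disjoint (D.G.disjoint_Ω_dirichlet _) hg.2.1)
    · simp [hne s' h]
  have hB := hq (⟨_, hV0⟩, 0)
  rw [B_apply_of_flux_eq_traceField (t := t') (by simp [flux_apply]),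
    Finset.sum_eq_single s (fun s' _ h => by simp [hne s' h]) (by simp), hself] at hB
  simpa using hB

-- The test field has flux `1` through the common facet of the two elements.
theorem exists_pos_mul_eq_of_adjacent (hq : ∀ r, D.B r q = 0) {c c' : D.M.Cell s}
    (h : D.M.Adjacent c c') : ∃ a : ℝ, 0 < a ∧ q s c' = a * q s c := by
  classical
  have : NeZero (D.G.dim s) := ⟨h.dim_ne_zero⟩
  obtain ⟨hcc, k, k', hkk, hsub⟩ := h
  have hsum := sum_trace_eq_zero hq (Pi.single (c, k) 1 - Pi.single (c', k') 1)
    (fun f f' hff heq _ => by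
      have hiff : f = (c, k) ↔ f' = (c', k') := by
        constructor
        · rintro rfl
          exact D.M.facet_eq_of_openFacet_eq hff.symm hcc.symm heq hkk
        · rintro rfl
          exact D.M.facet_eq_of_openFacet_eq hff hcc heq.symm hkk.symm
      have hiff' : f = (c', k') ↔ f' = (c, k) := by
        constructor
        · rintro rfl
          exact D.M.facet_eq_of_openFacet_eq hff.symm hcc heq hkk.symm
        · rintro rfl
          exact D.M.facet_eq_of_openFacet_eq hff hcc.symm heq.symm hkk
      simp only [Pi.sub_apply, Pi.single_apply, hiff, hiff']
      ring)
    (fun f hf => by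
      have hmem : f = (c, k) ∨ f = (c', k') := by
        by_contra! hne
        simp [hne.1, hne.2] at hf
      rcases hmem with rfl | rfl
      exacts [Or.inl hsub, Or.inl (hkk ▸ hsub)])
  have hw := facetWeight_pos (D.M.simplex c) k
  have hw' := facetWeight_pos (D.M.simplex c') k'
  refine ⟨_, div_pos hw hw', ?_⟩
  simp only [Pi.sub_apply, Pi.single_apply, sub_mul, ite_mul, one_mul, zero_mul, mul_sub, mul_ite,
    mul_zero, Finset.sum_sub_distrib, Finset.sum_ite_eq', Finset.mem_univ, if_true] at hsum
  field_simp
  linarith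

theorem exists_pos_mul_eq (hq : ∀ r, D.B r q = 0) (c c' : D.M.Cell s) :
    ∃ a : ℝ, 0 < a ∧ q s c' = a * q s c := by
  induction D.M.reflTransGen_adjacent c c' with
  | refl => exact ⟨1, one_pos, (one_mul _).symm⟩
  | tail _ hadj ih =>
    obtain ⟨a, ha, hqa⟩ := ih
    obtain ⟨b, hb, hqb⟩ := exists_pos_mul_eq_of_adjacent hq hadj
    exact ⟨b * a, mul_pos hb ha, by rw [hqb, hqa, mul_assoc]⟩

theorem eq_zero_of_sum_eq_zero (hq : ∀ r, D.B r q = 0) {w : D.M.Cell s → ℝ} (hw : ∀ c, 0 ≤ w c)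
    {c₀ : D.M.Cell s} (hc₀ : 0 < w c₀) (hsum : ∑ c, q s c * w c = 0) : q s = 0 := by
  choose a ha hqa using exists_pos_mul_eq (q := q) hq c₀
  have hfactor : q s c₀ * ∑ c, a c * w c = 0 := by
    rw [← hsum, Finset.mul_sum]
    exact Finset.sum_congr rfl fun c _ => by rw [hqa c]; ring
  have hpos : 0 < ∑ c, a c * w c := Finset.sum_pos' (fun c _ => mul_nonneg (ha c).le (hw c))
    ⟨c₀, Finset.mem_univ _, mul_pos (ha c₀) hc₀⟩
  have hzero := (mul_eq_zero.1 hfactor).resolve_right hpos.ne'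
  exact funext fun c => by rw [hqa c, hzero, mul_zero, Pi.zero_apply]

theorem exists_eq_zero (hq : ∀ r, D.B r q = 0) : ∃ s, q s = 0 := by
  classical
  obtain ⟨s, hd, f₀, hf₀⟩ := D.M.exists_dirichlet_facet
  have : NeZero (D.G.dim s) := ⟨hd⟩
  have hsum := sum_trace_eq_zero hq (Pi.single f₀ 1)
    (fun f f' _ heq hsub => by
      have hnot := not_openFacet_subset_of_disjoint (D.G.disjoint_Ω_dirichlet s).symm hf₀
      have hne : f ≠ f₀ := fun h => hnot (h ▸ hsub)
      have hne' : f' ≠ f₀ := fun h => hnot (h ▸ heq ▸ hsub)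
      simp [hne, hne'])
    (fun f hf => by
      obtain rfl : f = f₀ := by
        by_contra hne
        simp [hne] at hf
      exact Or.inr hf₀)
  have hzero : q s f₀.1 = 0 := by
    simpa [Pi.single_apply, (facetWeight_pos (D.M.simplex f₀.1) f₀.2).ne'] using hsum
  refine ⟨s, funext fun c => ?_⟩
  obtain ⟨a, -, ha⟩ := exists_pos_mul_eq hq f₀.1 c
  rw [ha, hzero, mul_zero, Pi.zero_apply]

open Classical in
/-- The normal component of the extension `R μ` on the facets that lie on an interface, and zero on
all other facets. -/
def interfaceTrace (D : Discretization n) (μ : D.M.Λ) (s : D.G.Sub) (f : D.M.Facet s) : ℝ :=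
  if ∃ g, D.M.OnInterface g f.1 f.2 then
    normalTrace (D.M.simplex f.1) f.2 ((D.R μ : D.M.Field) s f.1) else 0

variable {μ : D.M.Λ}

theorem exists_onInterface_of_interfaceTrace_ne_zero {f : D.M.Facet s}
    (h : interfaceTrace D μ s f ≠ 0) : ∃ g, D.M.OnInterface g f.1 f.2 := by
  by_contra hf
  exact h (if_neg hf)

theorem vol_mul_interfaceTrace {g : D.G.Interface} {f : D.M.Facet s}
    (h : D.M.OnInterface g f.1 f.2) :
    vol (D.G.dim (D.G.lo g)) (closedFacet (D.M.simplex f.1) f.2) * interfaceTrace D μ s f =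
      ∑ τ : D.M.Mortar g, μ g τ * vol (D.G.dim (D.G.lo g))
        (closedFacet (D.M.simplex f.1) f.2 ∩ (D.M.mortarSimplex τ).closedInterior) := by
  rw [interfaceTrace, if_pos ⟨g, h⟩]
  exact D.isExtension.1 μ g s f.1 f.2 h

theorem interfaceTrace_nonneg (hμ : 0 ≤ μ) (f : D.M.Facet s) : 0 ≤ interfaceTrace D μ s f := by
  by_contra! hneg
  obtain ⟨g, hg⟩ := exists_onInterface_of_interfaceTrace_ne_zero hneg.ne
  refine (mul_neg_of_pos_of_neg hg.vol_closedFacet_pos hneg).not_ge ?_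
  rw [vol_mul_interfaceTrace hg]
  exact Finset.sum_nonneg fun τ _ => mul_nonneg (hμ g τ) measureReal_nonneg

theorem interfaceTrace_eq_zero (hμ : ∀ g, D.G.hi g = s → μ g = 0) (f : D.M.Facet s) :
    interfaceTrace D μ s f = 0 := by
  by_contra hne
  obtain ⟨g, hg⟩ := exists_onInterface_of_interfaceTrace_ne_zero hne
  refine mul_ne_zero hg.vol_closedFacet_pos.ne' hne ?_
  simp [vol_mul_interfaceTrace hg, hμ g hg.1]

theorem interfaceTrace_pos {g : D.G.Interface} (hμ : μ g = 1) {f : D.M.Facet s}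
    (hf : D.M.OnInterface g f.1 f.2) : 0 < interfaceTrace D μ s f := by
  refine pos_of_mul_pos_right (hf.vol_closedFacet_pos.trans_le ?_) hf.vol_closedFacet_pos.le
  simpa [vol_mul_interfaceTrace hf, hμ] using hf.vol_closedFacet_le_sum_mortar

theorem traceField_interfaceTrace_mem_V (μ : D.M.Λ) :
    D.M.traceField (interfaceTrace D μ) ∈ D.M.V := by
  refine D.M.traceField_mem_V (fun s f f' _ heq hsub => ?_) fun s f hf hN => ?_
  · have hzero : ∀ e : D.M.Facet s, openFacet (D.M.simplex e.1) e.2 ⊆ D.G.Ω s →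
        interfaceTrace D μ s e = 0 := fun e he => if_neg fun ⟨_, hg⟩ => hg.not_subset_Ω he
    rw [hzero f hsub, hzero f' (heq ▸ hsub), add_zero]
  · obtain ⟨g, hg⟩ := exists_onInterface_of_interfaceTrace_ne_zero hf
    have : NeZero (D.G.dim s) := ⟨hg.dim_ne_zero⟩
    exact not_openFacet_subset_of_disjoint (D.G.disjoint_Ω_neumann _) hg.2.1 hN

theorem exists_flux_eq_traceField_interfaceTrace (μ : D.M.Λ) :
    ∃ r : D.W, r.2 = μ ∧ D.flux r = D.M.traceField (interfaceTrace D μ) := by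
  have hV0 : D.M.traceField (interfaceTrace D μ) - (D.R μ : D.M.Field) ∈ D.M.V0 := by
    refine ⟨D.M.V.sub_mem (traceField_interfaceTrace_mem_V μ) (D.R μ).2, fun g s c k hg => ?_⟩
    have : NeZero (D.G.dim s) := ⟨hg.dim_ne_zero⟩
    rw [Pi.sub_apply, Pi.sub_apply, normalTrace_sub, D.M.normalTrace_traceField _ (c, k),
      interfaceTrace, if_pos ⟨g, hg⟩, sub_self]
  exact ⟨(⟨_, hV0⟩, μ), rfl, by simp [flux_apply]⟩

-- The test function is the extension of the indicator of the interface.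
theorem interface_balance (hq : ∀ r, D.B r q = 0) (g : D.G.Interface) :
    ∃ (w : D.M.Cell (D.G.hi g) → ℝ) (w' : D.M.Cell (D.G.lo g) → ℝ),
      (∀ c, 0 ≤ w c) ∧ (∃ c, 0 < w c) ∧ (∀ c, 0 < w' c) ∧
      ∑ c, q (D.G.hi g) c * w c = ∑ c, q (D.G.lo g) c * w' c := by
  classical
  set μ : D.M.Λ := Pi.single g 1
  have hself : μ g = 1 := Pi.single_eq_same g _
  have hne : ∀ g' ≠ g, μ g' = 0 := fun g' h => Pi.single_eq_of_ne h _
  have hμ0 : 0 ≤ μ := Pi.single_nonneg.2 zero_le_one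
  have : NeZero (D.G.dim (D.G.hi g)) := ⟨D.G.dim_hi_ne_zero g⟩
  obtain ⟨⟨c₀, k₀⟩, hf₀⟩ := D.M.exists_onInterface g
  have hterm : ∀ c k, 0 ≤ interfaceTrace D μ (D.G.hi g) (c, k) * facetWeight (D.M.simplex c) k :=
    fun c k => mul_nonneg (interfaceTrace_nonneg hμ0 _) (facetWeight_nonneg _ k)
  refine ⟨fun c => ∑ k, interfaceTrace D μ _ (c, k) * facetWeight (D.M.simplex c) k,
    fun c => ∑ τ : D.M.Mortar g, vol (D.G.dim (D.G.lo g))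
      ((D.M.simplex c).closedInterior ∩ (D.M.mortarSimplex τ).closedInterior),
    fun c => Finset.sum_nonneg fun k _ => hterm c k,
    ⟨c₀, Finset.sum_pos' (fun k _ => hterm c₀ k) ⟨k₀, Finset.mem_univ _,
      mul_pos (interfaceTrace_pos hself hf₀) (facetWeight_pos _ k₀)⟩⟩,
    fun c => (vol_closedInterior_pos _).trans_le (D.M.vol_closedInterior_le_sum_mortar g c), ?_⟩
  obtain ⟨r, hr, hflux⟩ := exists_flux_eq_traceField_interfaceTrace μ
  have hB := hq r
  have hzero : ∀ s ≠ D.G.hi g, ∀ f, interfaceTrace D μ s f = 0 := fun s hs f =>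
    interfaceTrace_eq_zero (fun g' hg' => hne g' fun h => hs (by rw [← hg', h])) f
  rw [B_apply_of_flux_eq_traceField hflux, hr,
    Finset.sum_eq_single (D.G.hi g) (fun s _ hs => by simp [hzero s hs]) (by simp),
    Finset.sum_eq_single g (fun g' _ hg' => by simp [hne g' hg']) (by simp)] at hB
  simp only [hself, Pi.one_apply, mul_one, Fintype.sum_prod_type, ← Finset.mul_sum] at hB
  linarith

theorem eq_zero_lo_iff_eq_zero_hi (hq : ∀ r, D.B r q = 0) (g : D.G.Interface) :
    q (D.G.lo g) = 0 ↔ q (D.G.hi g) = 0 := by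
  obtain ⟨w, w', hw, ⟨c₀, hc₀⟩, hw', hbal⟩ := interface_balance hq g
  constructor <;> intro h <;> simp only [h, Pi.zero_apply, zero_mul, Finset.sum_const_zero] at hbal
  · exact eq_zero_of_sum_eq_zero hq hw hc₀ hbal
  · exact funext fun c => congrFun
      (eq_zero_of_sum_eq_zero hq (fun c => (hw' c).le) (hw' c) hbal.symm) c

theorem injective_BT (D : Discretization n) : Function.Injective D.BT := by
  refine (injective_iff_map_eq_zero D.BT).2 fun q hBq => ?_
  have hq : ∀ r, D.B r q = 0 := LinearMap.congr_fun hBq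
  obtain ⟨s₀, hs₀⟩ := exists_eq_zero hq
  have hiff : ∀ s t, Relation.EqvGen (fun s t => ∃ g, D.G.lo g = s ∧ D.G.hi g = t) s t →
      (q s = 0 ↔ q t = 0) := by
    intro s t h
    induction h with
    | rel s t h =>
      obtain ⟨g, rfl, rfl⟩ := h
      exact eq_zero_lo_iff_eq_zero_hi hq g
    | refl s => exact Iff.rfl
    | symm s t _ ih => exact ih.symm
    | trans s t u _ _ ih ih' => exact ih.trans ih'
  exact funext fun s => (hiff s₀ s (D.G.connected s₀ s)).1 hs₀

end Discretization

/-! ### Symmetric positive definite operators -/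

section Inverse

variable {X Y : Type*} [AddCommGroup X] [Module ℝ X] [AddCommGroup Y] [Module ℝ Y] {T : X →ₗ[ℝ] Y}

theorem apply_inv (hT : Function.Bijective T) (y : Y) : T (inv T y) = y := by
  rw [inv, dif_pos hT]
  exact (LinearEquiv.ofBijective T hT).apply_symm_apply y

theorem inv_apply (hT : Function.Bijective T) (x : X) : inv T (T x) = x :=
  hT.1 (apply_inv hT _)

end Inverse

section PositiveDefinite

variable {X Y : Type*} [AddCommGroup X] [Module ℝ X] [AddCommGroup Y] [Module ℝ Y]

/-- The operator `S : X → X'` is symmetric positive definite, i.e. `(x, y) ↦ S x y` is an inner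
product on `X`. -/
structure IsPosDefForm (S : X →ₗ[ℝ] Module.Dual ℝ X) : Prop where
  symm : ∀ x y, S x y = S y x
  pos : ∀ x, x ≠ 0 → 0 < S x x

namespace IsPosDefForm

variable {S : X →ₗ[ℝ] Module.Dual ℝ X} {S' : Y →ₗ[ℝ] Module.Dual ℝ Y}

theorem self_nonneg (hS : IsPosDefForm S) (x : X) : 0 ≤ S x x := by
  rcases eq_or_ne x 0 with rfl | hx
  · simp
  · exact (hS.pos x hx).le

theorem sq_le (hS : IsPosDefForm S) (x y : X) : S x y ^ 2 ≤ S x x * S y y :=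
  LinearMap.BilinForm.apply_sq_le_of_symm S hS.self_nonneg ⟨hS.symm⟩ x y

theorem injective (hS : IsPosDefForm S) : Function.Injective S := by
  refine (injective_iff_map_eq_zero S).2 fun x hx => ?_
  by_contra hne
  simpa [hx] using hS.pos x hne

theorem bijective [FiniteDimensional ℝ X] (hS : IsPosDefForm S) : Function.Bijective S :=
  ⟨hS.injective, (LinearMap.injective_iff_surjective_of_finrank_eq_finrank
    Subspace.dual_finrank_eq.symm).1 hS.injective⟩

theorem isSPD_inv [FiniteDimensional ℝ X] (hS : IsPosDefForm S) : IsSPD (inv S) := by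
  refine ⟨fun f f' => ?_, fun f hf => ?_⟩
  · obtain ⟨x, rfl⟩ := hS.bijective.2 f
    obtain ⟨x', rfl⟩ := hS.bijective.2 f'
    rw [inv_apply hS.bijective, inv_apply hS.bijective, hS.symm]
  · obtain ⟨x, rfl⟩ := hS.bijective.2 f
    rw [inv_apply hS.bijective]
    exact hS.pos x fun h => hf (by rw [h, map_zero])

theorem schur_apply [FiniteDimensional ℝ X] (hS : IsPosDefForm S) (b : X →ₗ[ℝ] Module.Dual ℝ Y)
    (q q' : Y) : (b ∘ₗ inv S ∘ₗ b.flip) q q' = S (inv S (b.flip q)) (inv S (b.flip q')) := by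
  rw [hS.symm, apply_inv hS.bijective]
  rfl

theorem schur [FiniteDimensional ℝ X] (hS : IsPosDefForm S) {b : X →ₗ[ℝ] Module.Dual ℝ Y}
    (hb : Function.Injective b.flip) : IsPosDefForm (b ∘ₗ inv S ∘ₗ b.flip) := by
  refine ⟨fun q q' => ?_, fun q hq => ?_⟩
  · rw [hS.schur_apply, hS.schur_apply, hS.symm]
  · rw [hS.schur_apply]
    refine hS.pos _ fun h => hq (hb ?_)
    rw [← apply_inv hS.bijective (b.flip q), h, map_zero, map_zero]

end IsPosDefForm

/-- The operator `diag(S, S') : X × Y → (X × Y)'`. -/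
def prodForm (S : X →ₗ[ℝ] Module.Dual ℝ X) (S' : Y →ₗ[ℝ] Module.Dual ℝ Y) :
    X × Y →ₗ[ℝ] Module.Dual ℝ (X × Y) :=
  (Module.dualProdDualEquivDual ℝ X Y).toLinearMap ∘ₗ S.prodMap S'

theorem prodForm_apply (S : X →ₗ[ℝ] Module.Dual ℝ X) (S' : Y →ₗ[ℝ] Module.Dual ℝ Y)
    (x y : X × Y) : prodForm S S' x y = S x.1 y.1 + S' x.2 y.2 := rfl

theorem IsPosDefForm.prodForm {S : X →ₗ[ℝ] Module.Dual ℝ X} {S' : Y →ₗ[ℝ] Module.Dual ℝ Y}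
    (hS : IsPosDefForm S) (hS' : IsPosDefForm S') : IsPosDefForm (prodForm S S') := by
  refine ⟨fun x y => ?_, fun x hx => ?_⟩
  · rw [prodForm_apply, prodForm_apply, hS.symm, hS'.symm]
  · rw [prodForm_apply]
    rcases eq_or_ne x.1 0 with h1 | h1
    · exact add_pos_of_nonneg_of_pos (hS.self_nonneg _)
        (hS'.pos _ fun h2 => hx (Prod.ext h1 h2))
    · exact add_pos_of_pos_of_nonneg (hS.pos _ h1) (hS'.self_nonneg _)

namespace IsSPD

variable {H : Module.Dual ℝ X →ₗ[ℝ] X}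

theorem isPosDefForm (hH : IsSPD H) : IsPosDefForm (Module.Dual.eval ℝ X ∘ₗ H) :=
  ⟨fun f f' => hH.1 f' f, hH.2⟩

theorem self_nonneg (hH : IsSPD H) (f : Module.Dual ℝ X) : 0 ≤ f (H f) :=
  hH.isPosDefForm.self_nonneg f

theorem sq_le (hH : IsSPD H) (f f' : Module.Dual ℝ X) :
    f (H f') ^ 2 ≤ f (H f) * f' (H f') :=
  hH.1 f' f ▸ hH.isPosDefForm.sq_le f f'

theorem bijective [FiniteDimensional ℝ X] (hH : IsSPD H) : Function.Bijective H :=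
  have hinj : Function.Injective H :=
    Function.Injective.of_comp (f := Module.Dual.eval ℝ X) (g := H) hH.isPosDefForm.injective
  ⟨hinj, (LinearMap.injective_iff_surjective_of_finrank_eq_finrank Subspace.dual_finrank_eq).1 hinj⟩

theorem isPosDefForm_inv [FiniteDimensional ℝ X] (hH : IsSPD H) : IsPosDefForm (inv H) := by
  refine ⟨fun x y => ?_, fun x hx => ?_⟩
  · obtain ⟨f, rfl⟩ := hH.bijective.2 x
    obtain ⟨f', rfl⟩ := hH.bijective.2 y
    rw [inv_apply hH.bijective, inv_apply hH.bijective, hH.1]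
  · obtain ⟨f, rfl⟩ := hH.bijective.2 x
    rw [inv_apply hH.bijective]
    exact hH.2 f fun h => hx (by rw [h, map_zero])

end IsSPD

end PositiveDefinite

section DualNorm

variable {X : Type*} [AddCommGroup X] [Module ℝ X] [FiniteDimensional ℝ X]
  {S : X →ₗ[ℝ] Module.Dual ℝ X}

theorem IsPosDefForm.apply_sq_le_dual (hS : IsPosDefForm S) (f : Module.Dual ℝ X) (y : X) :
    f y ^ 2 ≤ f (inv S f) * S y y := by
  simpa only [inv_apply hS.bijective] using hS.isSPD_inv.sq_le f (S y)

theorem IsPosDefForm.dual_le (hS : IsPosDefForm S) {f : Module.Dual ℝ X} {t : ℝ}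
    (h : ∀ y, f y ≤ t * √(S y y)) : f (inv S f) ≤ t ^ 2 := by
  have hf := h (inv S f)
  have hnonneg := hS.isSPD_inv.self_nonneg f
  rw [apply_inv hS.bijective] at hf
  nlinarith [Real.sq_sqrt hnonneg, sq_nonneg (t - √(f (inv S f)))]

end DualNorm

/-! ### Spectral equivalence and condition numbers -/

section SpectralEquivalence

variable {X : Type*} [AddCommGroup X] [Module ℝ X] {S : X →ₗ[ℝ] Module.Dual ℝ X}
  {H P : Module.Dual ℝ X →ₗ[ℝ] X} {c₁ c₂ c₁' c₂' : ℝ}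

namespace SpectrallyEquivalent

theorem mono (h : SpectrallyEquivalent H P c₁ c₂) (hH : IsSPD H) (h₁ : c₁' ≤ c₁) (h₂ : c₂ ≤ c₂') :
    SpectrallyEquivalent H P c₁' c₂' := fun f =>
  ⟨(mul_le_mul_of_nonneg_right h₁ (hH.self_nonneg f)).trans (h f).1,
    (h f).2.trans (mul_le_mul_of_nonneg_right h₂ (hH.self_nonneg f))⟩

variable [FiniteDimensional ℝ X]

theorem upper_pos [Nontrivial X] (h : SpectrallyEquivalent H P c₁ c₂) (hH : IsSPD H)
    (hc₁ : 0 < c₁) : 0 < c₂ := by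
  obtain ⟨f, hf⟩ := exists_ne (0 : Module.Dual ℝ X)
  have hpos := hH.2 f hf
  exact pos_of_mul_pos_left ((mul_pos hc₁ hpos).trans_le ((h f).1.trans (h f).2)) hpos.le

theorem mul_apply_self_le_inv (h : SpectrallyEquivalent H (inv S) c₁ c₂) (hS : IsPosDefForm S)
    (hH : IsSPD H) (hc₁ : 0 ≤ c₁) (x : X) : c₁ * S x x ≤ inv H x x := by
  rcases eq_or_ne x 0 with rfl | hx
  · simp
  have hlower := (h (S x)).1
  rw [inv_apply hS.bijective] at hlower
  have hCS := hH.sq_le (S x) (inv H x)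
  rw [apply_inv hH.bijective] at hCS
  refine le_of_mul_le_mul_right ?_ (hS.pos x hx)
  calc c₁ * S x x * S x x = c₁ * S x x ^ 2 := by ring
    _ ≤ c₁ * (S x (H (S x)) * inv H x x) := by gcongr
    _ = c₁ * S x (H (S x)) * inv H x x := by ring
    _ ≤ S x x * inv H x x := mul_le_mul_of_nonneg_right hlower (hH.isPosDefForm_inv.self_nonneg x)
    _ = inv H x x * S x x := mul_comm _ _

theorem inv_le_mul_apply_self (h : SpectrallyEquivalent H (inv S) c₁ c₂) (hS : IsPosDefForm S)
    (hH : IsSPD H) (x : X) : inv H x x ≤ c₂ * S x x := by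
  rcases eq_or_ne x 0 with rfl | hx
  · simp
  have hupper := (h (inv H x)).2
  rw [apply_inv hH.bijective] at hupper
  refine le_of_mul_le_mul_right ?_ (hH.isPosDefForm_inv.pos x hx)
  calc inv H x x * inv H x x = inv H x x ^ 2 := by ring
    _ ≤ inv H x (inv S (inv H x)) * S x x := hS.apply_sq_le_dual _ x
    _ ≤ c₂ * inv H x x * S x x := mul_le_mul_of_nonneg_right hupper (hS.self_nonneg x)
    _ = c₂ * S x x * inv H x x := by ring

end SpectrallyEquivalent

theorem opNorm_sqrt_le (hS : IsPosDefForm S) {T : X →ₗ[ℝ] X} {a b : ℝ} (ha : 0 < a) (hb : 0 ≤ b)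
    (h : ∀ x, a ^ 2 * S (T x) (T x) ≤ b ^ 2 * S x x) :
    opNorm (fun x => √(S x x)) T ≤ ENNReal.ofReal (b / a) := by
  refine iSup_le fun x => ENNReal.ofReal_le_ofReal ?_
  rw [div_le_div_iff₀ (Real.sqrt_pos.2 (hS.pos x x.2)) ha, mul_comm]
  simpa only [Real.sqrt_mul (sq_nonneg _), Real.sqrt_sq ha.le, Real.sqrt_sq hb] using
    Real.sqrt_le_sqrt (h x)

theorem condNumber_sqrt_le (hS : IsPosDefForm S) {T : X →ₗ[ℝ] X} (hT : Function.Bijective T)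
    {a b c d : ℝ} (ha : 0 < a) (hb : 0 ≤ b) (hc : 0 ≤ c) (hd : 0 < d)
    (hupper : ∀ x, a ^ 2 * S (T x) (T x) ≤ b ^ 2 * S x x)
    (hlower : ∀ x, d ^ 2 * S x x ≤ c ^ 2 * S (T x) (T x)) :
    condNumber (fun x => √(S x x)) T ≤ ENNReal.ofReal (b * c / (d * a)) := by
  have hinv : ∀ x, d ^ 2 * S (inv T x) (inv T x) ≤ c ^ 2 * S x x := fun x => by
    simpa only [apply_inv hT] using hlower (inv T x)
  refine (mul_le_mul' (opNorm_sqrt_le hS ha hb hupper) (opNorm_sqrt_le hS hd hc hinv)).trans_eq ?_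
  rw [← ENNReal.ofReal_mul (by positivity), div_mul_div_comm, mul_comm a d]

theorem condNumber_eq_zero_of_subsingleton [Subsingleton X] (N : X → ℝ) (T : X →ₗ[ℝ] X) :
    condNumber N T = 0 := by
  have : IsEmpty {x : X // x ≠ 0} := ⟨fun x => x.2 (Subsingleton.elim _ _)⟩
  simp [condNumber, opNorm]

end SpectralEquivalence

section Product

variable {X Y : Type*} [AddCommGroup X] [Module ℝ X] [AddCommGroup Y] [Module ℝ Y]
  {S : X →ₗ[ℝ] Module.Dual ℝ X} {S' : Y →ₗ[ℝ] Module.Dual ℝ Y}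

/-- The operator `diag(H, H') : (X × Y)' → X × Y`. -/
def prodPrecond (H : Module.Dual ℝ X →ₗ[ℝ] X) (H' : Module.Dual ℝ Y →ₗ[ℝ] Y) :
    Module.Dual ℝ (X × Y) →ₗ[ℝ] X × Y :=
  H.prodMap H' ∘ₗ (Module.dualProdDualEquivDual ℝ X Y).symm.toLinearMap

variable (H : Module.Dual ℝ X →ₗ[ℝ] X) (H' : Module.Dual ℝ Y →ₗ[ℝ] Y)

theorem prodPrecond_dualProd (f : Module.Dual ℝ X × Module.Dual ℝ Y) :
    prodPrecond H H' (Module.dualProdDualEquivDual ℝ X Y f) = (H f.1, H' f.2) := by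
  rw [prodPrecond, LinearMap.comp_apply, LinearEquiv.coe_coe, LinearEquiv.symm_apply_apply]
  rfl

theorem dualProd_prodPrecond (f g : Module.Dual ℝ X × Module.Dual ℝ Y) :
    Module.dualProdDualEquivDual ℝ X Y f
      (prodPrecond H H' (Module.dualProdDualEquivDual ℝ X Y g)) =
      f.1 (H g.1) + f.2 (H' g.2) := by
  rw [prodPrecond_dualProd]
  rfl

theorem inv_prodForm [FiniteDimensional ℝ X] [FiniteDimensional ℝ Y] (hS : IsPosDefForm S)
    (hS' : IsPosDefForm S') : inv (prodForm S S') = prodPrecond (inv S) (inv S') := by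
  refine LinearMap.ext fun f => ?_
  obtain ⟨g, rfl⟩ := (Module.dualProdDualEquivDual ℝ X Y).surjective f
  refine (hS.prodForm hS').injective ?_
  rw [apply_inv (hS.prodForm hS').bijective, prodPrecond_dualProd, prodForm, LinearMap.comp_apply,
    LinearMap.prodMap_apply, apply_inv hS.bijective, apply_inv hS'.bijective]
  rfl

variable {H H'}

theorem IsSPD.prodPrecond (hH : IsSPD H) (hH' : IsSPD H') : IsSPD (prodPrecond H H') := by
  have hsurj := (Module.dualProdDualEquivDual ℝ X Y).surjective
  refine ⟨fun f f' => ?_, fun f hf => ?_⟩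
  · obtain ⟨g, rfl⟩ := hsurj f
    obtain ⟨g', rfl⟩ := hsurj f'
    rw [dualProd_prodPrecond, dualProd_prodPrecond, hH.1, hH'.1]
  · obtain ⟨g, rfl⟩ := hsurj f
    rw [dualProd_prodPrecond]
    exact (hH.isPosDefForm.prodForm hH'.isPosDefForm).pos g fun h => hf (by rw [h, map_zero])

theorem SpectrallyEquivalent.prodPrecond {P : Module.Dual ℝ X →ₗ[ℝ] X}
    {P' : Module.Dual ℝ Y →ₗ[ℝ] Y} {c₁ c₂ : ℝ} (h : SpectrallyEquivalent H P c₁ c₂)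
    (h' : SpectrallyEquivalent H' P' c₁ c₂) :
    SpectrallyEquivalent (prodPrecond H H') (prodPrecond P P') c₁ c₂ := fun f => by
  obtain ⟨g, rfl⟩ := (Module.dualProdDualEquivDual ℝ X Y).surjective f
  rw [dualProd_prodPrecond, dualProd_prodPrecond, mul_add, mul_add]
  exact ⟨add_le_add (h g.1).1 (h' g.2).1, add_le_add (h g.1).2 (h' g.2).2⟩

end Product

/-! ### Operator preconditioning -/

section Preconditioning

variable {X : Type*} [AddCommGroup X] [Module ℝ X] [FiniteDimensional ℝ X]
  {S L : X →ₗ[ℝ] Module.Dual ℝ X} {H : Module.Dual ℝ X →ₗ[ℝ] X} {α β c₁ c₂ : ℝ}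

theorem bijective_comp_of_le_dual (hS : IsPosDefForm S) (hH : IsSPD H) (hβ : 0 < β)
    (hlower : ∀ x, β ^ 2 * S x x ≤ L x (inv S (L x))) : Function.Bijective (H ∘ₗ L) := by
  have hinj : Function.Injective L := by
    refine (injective_iff_map_eq_zero L).2 fun x hx => ?_
    by_contra hne
    have hzero := hlower x
    rw [hx, LinearMap.zero_apply] at hzero
    exact hzero.not_gt (mul_pos (pow_pos hβ 2) (hS.pos x hne))
  have hcomp : Function.Injective (H ∘ₗ L) := hH.bijective.1.comp hinj
  exact ⟨hcomp, LinearMap.injective_iff_surjective.1 hcomp⟩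

variable (hS : IsPosDefForm S) (hH : IsSPD H) (hα : 0 ≤ α) (hβ : 0 < β) (hc₁ : 0 < c₁)
  (hHS : SpectrallyEquivalent H (inv S) c₁ c₂)
  (hupper : ∀ x, L x (inv S (L x)) ≤ α ^ 2 * S x x)
  (hlower : ∀ x, β ^ 2 * S x x ≤ L x (inv S (L x)))
include hS hH hα hβ hc₁ hHS hupper hlower

theorem condNumber_energyNorm_le : condNumber (fun x => √(S x x)) (H ∘ₗ L) ≤
    ENNReal.ofReal (α * c₂ / (β * c₁)) := by
  rcases subsingleton_or_nontrivial X with _ | _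
  · exact (condNumber_eq_zero_of_subsingleton _ _).trans_le zero_le
  have hc₂ := hHS.upper_pos hH hc₁
  have hinv : ∀ f, inv H (H f) (H f) = f (H f) := fun f => by rw [inv_apply hH.bijective]
  refine condNumber_sqrt_le hS (bijective_comp_of_le_dual hS hH hβ hlower) hc₁ hα hc₂.le hβ
    (fun x => ?_) fun x => ?_
  · calc c₁ ^ 2 * S (H (L x)) (H (L x)) = c₁ * (c₁ * S (H (L x)) (H (L x))) := by ring
      _ ≤ c₁ * L x (H (L x)) := mul_le_mul_of_nonneg_left
          (hinv (L x) ▸ hHS.mul_apply_self_le_inv hS hH hc₁.le (H (L x))) hc₁.le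
      _ ≤ α ^ 2 * S x x := (hHS (L x)).1.trans (hupper x)
  · calc β ^ 2 * S x x ≤ c₂ * L x (H (L x)) := (hlower x).trans (hHS (L x)).2
      _ ≤ c₂ * (c₂ * S (H (L x)) (H (L x))) := mul_le_mul_of_nonneg_left
          (hinv (L x) ▸ hHS.inv_le_mul_apply_self hS hH (H (L x))) hc₂.le
      _ = c₂ ^ 2 * S (H (L x)) (H (L x)) := by ring

theorem condNumber_precondNorm_le : condNumber (fun x => √(inv H x x)) (H ∘ₗ L) ≤
    ENNReal.ofReal (α * c₂ / (β * c₁)) := by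
  rcases subsingleton_or_nontrivial X with _ | _
  · exact (condNumber_eq_zero_of_subsingleton _ _).trans_le zero_le
  have hc₂ := hHS.upper_pos hH hc₁
  have hinv : ∀ f, inv H (H f) (H f) = f (H f) := fun f => by rw [inv_apply hH.bijective]
  refine condNumber_sqrt_le hH.isPosDefForm_inv (bijective_comp_of_le_dual hS hH hβ hlower)
    hc₁ hα hc₂.le hβ (fun x => ?_) fun x => ?_ <;> rw [LinearMap.comp_apply, hinv]
  · calc c₁ ^ 2 * L x (H (L x)) = c₁ * (c₁ * L x (H (L x))) := by ring
      _ ≤ c₁ * (α ^ 2 * S x x) :=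
          mul_le_mul_of_nonneg_left ((hHS (L x)).1.trans (hupper x)) hc₁.le
      _ = α ^ 2 * (c₁ * S x x) := by ring
      _ ≤ α ^ 2 * inv H x x := mul_le_mul_of_nonneg_left
          (hHS.mul_apply_self_le_inv hS hH hc₁.le x) (sq_nonneg α)
  · calc β ^ 2 * inv H x x ≤ β ^ 2 * (c₂ * S x x) := mul_le_mul_of_nonneg_left
          (hHS.inv_le_mul_apply_self hS hH x) (sq_nonneg β)
      _ = c₂ * (β ^ 2 * S x x) := by ring
      _ ≤ c₂ * (c₂ * L x (H (L x))) :=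
          mul_le_mul_of_nonneg_left ((hlower x).trans (hHS (L x)).2) hc₂.le
      _ = c₂ ^ 2 * L x (H (L x)) := by ring

end Preconditioning

/-! ### The forms `a` and `a^D` -/

namespace Discretization

variable {n : ℕ} (D : Discretization n)

/-- The product `(γ Kν⁻¹ χ, χ)_Γ` for the indicator function `χ` of a mortar element. -/
def mortarWeight (g : D.G.Interface) (τ : D.M.Mortar g) : ℝ :=
  ∫ x in (D.M.mortarSimplex τ).closedInterior, D.P.γ g * (D.P.Kν g x)⁻¹ ∂μHE[D.G.dim (D.G.lo g)]

theorem mortarProduct_eq (l m : D.M.Λ) :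
    D.mortarProduct l m = ∑ g, ∑ τ, D.mortarWeight g τ * (l g τ * m g τ) := rfl

theorem mortarWeight_pos (g : D.G.Interface) (τ : D.M.Mortar g) : 0 < D.mortarWeight g τ := by
  obtain ⟨m, _, hm, hK⟩ := D.P.Kν_bounds g
  have hγ := D.P.γ_pos g
  have hle : ∀ x ∈ openCell (D.M.mortarSimplex τ), m ≤ D.P.Kν g x := fun x hx =>
    (hK x ((D.M.mortar_partitions g).2.1 τ hx)).1
  refine setIntegral_closedInterior_pos _ ((D.P.Kν_measurable g).inv.const_mul (D.P.γ g))
    (C := D.P.γ g * m⁻¹) (fun x hx => ?_) fun x hx => ?_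
  · exact mul_pos hγ (inv_pos.2 (hm.trans_le (hle x hx)))
  · exact mul_le_mul_of_nonneg_left (inv_anti₀ hm (hle x hx)) hγ.le

theorem mortarProduct_comm (l m : D.M.Λ) : D.mortarProduct l m = D.mortarProduct m l := by
  simp only [mortarProduct_eq, mul_comm (l _ _)]

theorem mortarProduct_self_nonneg (l : D.M.Λ) : 0 ≤ D.mortarProduct l l :=
  Finset.sum_nonneg fun g _ => Finset.sum_nonneg fun τ _ =>
    mul_nonneg (D.mortarWeight_pos g τ).le (mul_self_nonneg _)

theorem eq_zero_of_mortarProduct_self_eq_zero {l : D.M.Λ} (h : D.mortarProduct l l = 0) :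
    l = 0 := by
  have hnonneg : ∀ g (τ : D.M.Mortar g), 0 ≤ D.mortarWeight g τ * (l g τ * l g τ) := fun g τ =>
    mul_nonneg (D.mortarWeight_pos g τ).le (mul_self_nonneg _)
  simp only [mortarProduct_eq, Finset.sum_nonneg, hnonneg, implies_true, Finset.mem_univ,
    Finset.sum_eq_zero_iff_of_nonneg, forall_const, mul_eq_zero,
    (D.mortarWeight_pos _ _).ne', false_or, or_self] at h
  exact funext₂ h

/-- The part of `a` over the subdomains. -/
def bulkProduct (u v : D.M.Field) : ℝ :=
  ∑ s, ∑ c : D.M.Cell s, cellProduct (D.M.simplex c) (D.P.K s) (u s c) (v s c)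

/-- The part of `a^D` over the subdomains. -/
def bulkDiagonalProduct (u v : D.M.Field) : ℝ :=
  ∑ s, ∑ c : D.M.Cell s, diagonalProduct (D.M.simplex c) (D.P.K s) (u s c) (v s c)

theorem A_apply (w r : D.W) :
    D.A w r = D.bulkProduct (D.flux w) (D.flux r) + D.mortarProduct w.2 r.2 := rfl

theorem DA_apply (w r : D.W) :
    D.DA w r = D.bulkDiagonalProduct (D.flux w) (D.flux r) + D.mortarProduct w.2 r.2 := rfl

theorem bulkProduct_comm (u v : D.M.Field) : D.bulkProduct u v = D.bulkProduct v u :=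
  Finset.sum_congr rfl fun s _ => Finset.sum_congr rfl fun _ _ =>
    cellProduct_comm _ (D.P.K_symm s) _ _

theorem bulkDiagonalProduct_comm (u v : D.M.Field) :
    D.bulkDiagonalProduct u v = D.bulkDiagonalProduct v u :=
  Finset.sum_congr rfl fun _ _ => Finset.sum_congr rfl fun _ _ => diagonalProduct_comm _ _ _

theorem bulkProduct_self_nonneg (v : D.M.Field) : 0 ≤ D.bulkProduct v v :=
  Finset.sum_nonneg fun s _ => Finset.sum_nonneg fun _ _ =>
    cellProduct_self_nonneg _ (D.P.K_pos s) _

section Flux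

variable {D} {v : D.M.Field} (hv : v ∈ D.M.V)
include hv

theorem fst_mem_direction_of_mem_V {s : D.G.Sub} (c : D.M.Cell s) :
    (v s c).1 ∈ (affineSpan ℝ (range (D.M.simplex c).points)).direction := by
  rw [D.M.affineSpan_eq_plane]
  exact (hv.1 s c).1

theorem eq_zero_of_dim_eq_zero_of_mem_V {s : D.G.Sub} (hs : D.G.dim s = 0) (c : D.M.Cell s) :
    v s c = 0 := by
  have hdir := (hv.1 s c).1
  have hbot := D.G.finrank_plane s
  rw [hs, Submodule.finrank_eq_zero] at hbot
  rw [hbot, Submodule.mem_bot] at hdir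
  exact Prod.ext hdir ((hv.1 s c).2 hs)

theorem eq_zero_of_bulkProduct_self_eq_zero (h : D.bulkProduct v v = 0) : v = 0 := by
  have hnonneg : ∀ s (c : D.M.Cell s),
      0 ≤ cellProduct (D.M.simplex c) (D.P.K s) (v s c) (v s c) := fun s c =>
    cellProduct_self_nonneg _ (D.P.K_pos s) _
  simp only [bulkProduct, Finset.sum_nonneg, hnonneg, implies_true, Finset.mem_univ,
    Finset.sum_eq_zero_iff_of_nonneg, forall_const] at h
  funext s c
  by_contra hne
  refine (cellProduct_self_pos _ (fun hs => hne ?_) (D.P.K_pos s) hne).ne' (h s c)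
  exact eq_zero_of_dim_eq_zero_of_mem_V hv hs c

theorem bulkProduct_self_le : D.bulkProduct v v ≤ (n + 1) * D.bulkDiagonalProduct v v := by
  simp only [bulkProduct, bulkDiagonalProduct, Finset.mul_sum]
  gcongr with s _ c _
  have hdiag : 0 ≤ diagonalProduct (D.M.simplex c) (D.P.K s) (v s c) (v s c) :=
    Finset.sum_nonneg fun k _ =>
      mul_nonneg (mul_self_nonneg _) (cellProduct_self_nonneg _ (D.P.K_pos s) _)
  by_cases hs : D.G.dim s = 0
  · have hzero : cellProduct (D.M.simplex c) (D.P.K s) 0 0 = 0 := (cellForm _ _).map_zero₂ 0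
    rw [eq_zero_of_dim_eq_zero_of_mem_V hv hs c] at hdiag ⊢
    rw [hzero]
    positivity
  · have : NeZero (D.G.dim s) := ⟨hs⟩
    refine (cellProduct_self_le_diagonalProduct _ (D.P.K_pos s)
      (fst_mem_direction_of_mem_V hv c)).trans ?_
    gcongr
    exact D.G.dim_le s

end Flux

theorem flux_mem_V (w : D.W) : D.flux w ∈ D.M.V := D.M.V.add_mem w.1.2.1 (D.R w.2).2

theorem eq_zero_of_flux_eq_zero {w : D.W} (h : D.flux w = 0) (hΛ : w.2 = 0) : w = 0 := by
  rw [flux_apply, hΛ, map_zero, ZeroMemClass.coe_zero, add_zero, ZeroMemClass.coe_eq_zero] at h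
  exact Prod.ext h hΛ

theorem isPosDefForm_A : IsPosDefForm D.A := by
  refine ⟨fun w r => ?_, fun w hw => ?_⟩
  · rw [A_apply, A_apply, bulkProduct_comm, mortarProduct_comm]
  · have hbulk := D.bulkProduct_self_nonneg (D.flux w)
    have hmortar := D.mortarProduct_self_nonneg w.2
    rw [A_apply]
    refine lt_of_le_of_ne (add_nonneg hbulk hmortar) fun h => hw ?_
    obtain ⟨hbulk_zero, hmortar_zero⟩ := (add_eq_zero_iff_of_nonneg hbulk hmortar).1 h.symm
    exact D.eq_zero_of_flux_eq_zero
      (eq_zero_of_bulkProduct_self_eq_zero (D.flux_mem_V w) hbulk_zero)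
      (D.eq_zero_of_mortarProduct_self_eq_zero hmortar_zero)

theorem A_self_le (w : D.W) : D.A w w ≤ (n + 1) * D.DA w w := by
  rw [A_apply, DA_apply, mul_add]
  exact add_le_add (bulkProduct_self_le (D.flux_mem_V w))
    (le_mul_of_one_le_left (D.mortarProduct_self_nonneg w.2) (by simp))

theorem isPosDefForm_DA : IsPosDefForm D.DA := by
  refine ⟨fun w r => ?_, fun w hw => ?_⟩
  · rw [DA_apply, DA_apply, bulkDiagonalProduct_comm, mortarProduct_comm]
  · exact pos_of_mul_pos_right ((D.isPosDefForm_A.pos w hw).trans_le (D.A_self_le w))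
      (by positivity)

/-- The constant in the bound `a^D ≤ C a` on shape regular meshes. -/
def diagonalConstant (n : ℕ) (σ θ : ℝ) : ℝ :=
  max 1 ((n + 1) * (2 * θ ^ 2 * σ ^ (n + 2) * (1 + 4 * σ) ^ 2))

theorem one_le_diagonalConstant (n : ℕ) (σ θ : ℝ) : 1 ≤ diagonalConstant n σ θ := le_max_left _ _

section DiagonalBound

variable {D} {σ θ : ℝ} (hσ : D.M.ShapeRegular σ) (hθ : D.P.AnisotropyBound θ)
include hσ hθ

theorem bulkDiagonalProduct_self_le {v : D.M.Field} (hv : v ∈ D.M.V) :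
    D.bulkDiagonalProduct v v ≤ diagonalConstant n σ θ * D.bulkProduct v v := by
  simp only [bulkProduct, bulkDiagonalProduct, Finset.mul_sum]
  gcongr with s _ c _
  have hnonneg := cellProduct_self_nonneg (D.M.simplex c) (D.P.K_pos s) (v s c)
  by_cases hs : D.G.dim s = 0
  · have hzero : diagonalProduct (D.M.simplex c) (D.P.K s) (v s c) (v s c) = 0 :=
      Finset.sum_eq_zero fun k _ => by
        rw [normalTrace_eq_zero_of_dim_eq_zero _ hs, zero_mul, zero_mul]
    rw [hzero]
    exact mul_nonneg (zero_le_one.trans (one_le_diagonalConstant n σ θ)) hnonneg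
  · have : NeZero (D.G.dim s) := ⟨hs⟩
    have hspan := D.M.affineSpan_eq_plane c
    obtain ⟨x, hx, r, hr, hball, hdiam⟩ := hσ s c hs
    have hinner : HasInnerBall (D.M.simplex c) x r σ :=
      ⟨by rwa [hspan], hr, by rwa [hspan], hdiam⟩
    refine (hinner.diagonalProduct_self_le (by rw [hspan]; exact D.P.K_tangent s) (D.P.K_symm s)
      (D.P.K_pos s) (by rw [hspan]; exact hθ s) (fst_mem_direction_of_mem_V hv c)).trans ?_
    refine mul_le_mul_of_nonneg_right (le_max_of_le_right ?_) hnonneg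
    have hσ₁ := hinner.one_le
    have hdim := D.G.dim_le s
    gcongr

theorem DA_self_le (w : D.W) : D.DA w w ≤ diagonalConstant n σ θ * D.A w w := by
  rw [A_apply, DA_apply, mul_add]
  exact add_le_add
    (bulkDiagonalProduct_self_le hσ hθ (D.flux_mem_V w))
    (le_mul_of_one_le_left (D.mortarProduct_self_nonneg w.2) (one_le_diagonalConstant n σ θ))

end DiagonalBound

end Discretization

/-! ### The inf-sup condition -/

section InfSup

variable {X : Type*} [AddCommGroup X] [Module ℝ X] {a d : X →ₗ[ℝ] Module.Dual ℝ X} {c C : ℝ}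

theorem IsPosDefForm.abs_le (ha : IsPosDefForm a) (w r : X) : |a w r| ≤ √(a w w) * √(a r r) := by
  rw [← Real.sqrt_mul (ha.self_nonneg w)]
  exact Real.abs_le_sqrt (ha.sq_le w r)

theorem abs_add_add_le_energyNorm (ha : IsPosDefForm a) (hd : IsPosDefForm d) (hC : 1 ≤ C)
    (hda : ∀ w, d w w ≤ C * a w w) (w g r h : X) :
    |a w r + d g r + d h w| ≤ (1 + 2 * C) * √(a w w + d g g) * √(a r r + d h h) := by
  have ha_le : ∀ w g, a w w ≤ a w w + d g g := fun w g => le_add_of_nonneg_right (hd.self_nonneg g)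
  have hd_le : ∀ w g, d g g ≤ a w w + d g g := fun w g => le_add_of_nonneg_left (ha.self_nonneg w)
  have hd_le_mul : ∀ w g, √(d w w) ≤ C * √(a w w + d g g) := fun w g =>
    calc √(d w w) ≤ √(C ^ 2 * a w w) := Real.sqrt_le_sqrt ((hda w).trans
          (mul_le_mul_of_nonneg_right (le_self_pow₀ hC two_ne_zero) (ha.self_nonneg w)))
      _ = C * √(a w w) := by rw [Real.sqrt_mul (sq_nonneg C), Real.sqrt_sq (by positivity)]
      _ ≤ C * √(a w w + d g g) := by gcongr; exact ha_le w g
  calc |a w r + d g r + d h w| ≤ |a w r| + |d g r| + |d h w| := abs_add_three _ _ _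
    _ ≤ √(a w w) * √(a r r) + √(d g g) * √(d r r) + √(d h h) * √(d w w) :=
        add_le_add_three (ha.abs_le w r) (hd.abs_le g r) (hd.abs_le h w)
    _ ≤ √(a w w + d g g) * √(a r r + d h h) + √(a w w + d g g) * (C * √(a r r + d h h)) +
          √(a r r + d h h) * (C * √(a w w + d g g)) := by
        gcongr
        exacts [ha_le w g, ha_le r h, hd_le w g, hd_le_mul r h, hd_le r h, hd_le_mul w g]
    _ = (1 + 2 * C) * √(a w w + d g g) * √(a r r + d h h) := by ring

variable (ha : IsPosDefForm a) (hd : IsPosDefForm d) (hc : 1 ≤ c) (had : ∀ w, a w w ≤ c * d w w)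
include ha hd hc had

theorem abs_inv_mul_apply_le (g w : X) : |c⁻¹ * a g w| ≤ (a w w + c⁻¹ * d g g) / 2 := by
  have haw := ha.self_nonneg w
  have hdg := hd.self_nonneg g
  refine abs_le_of_sq_le_sq ?_ (by positivity)
  calc (c⁻¹ * a g w) ^ 2 = c⁻¹ ^ 2 * a g w ^ 2 := mul_pow _ _ _
    _ ≤ c⁻¹ ^ 2 * (c * d g g * a w w) := by
        gcongr
        exact (ha.sq_le g w).trans (mul_le_mul_of_nonneg_right (had g) haw)
    _ = a w w * (c⁻¹ * d g g) := by field_simp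
    _ ≤ ((a w w + c⁻¹ * d g g) / 2) ^ 2 := by nlinarith [sq_nonneg (a w w - c⁻¹ * d g g)]

theorem le_apply_add_inv_smul (w g : X) :
    (2 * c)⁻¹ * (a w w + d g g) ≤ a (w + c⁻¹ • g) w + c⁻¹ * d g g := by
  have haw : c⁻¹ * a w w ≤ a w w :=
    mul_le_of_le_one_left (ha.self_nonneg w) (inv_le_one_of_one_le₀ hc)
  have hcross := (abs_le.1 (abs_inv_mul_apply_le ha hd hc had g w)).1
  simp only [map_add, map_smul, LinearMap.add_apply, LinearMap.smul_apply, smul_eq_mul, mul_inv]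
  linarith

theorem energy_add_inv_smul_le (w g : X) :
    a (w + c⁻¹ • g) (w + c⁻¹ • g) + d g g ≤ 4 * (a w w + d g g) := by
  have hc_pos : 0 < c := by positivity
  have hdg := hd.self_nonneg g
  have hdg_le : c⁻¹ * d g g ≤ d g g := mul_le_of_le_one_left hdg (inv_le_one_of_one_le₀ hc)
  have hag : c⁻¹ * (c⁻¹ * a g g) ≤ c⁻¹ * d g g := by
    gcongr
    exact (inv_mul_le_iff₀ hc_pos).2 (had g)
  have hcross := (abs_le.1 (abs_inv_mul_apply_le ha hd hc had g w)).2
  have haw := ha.self_nonneg w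
  simp only [map_add, map_smul, LinearMap.add_apply, LinearMap.smul_apply, smul_eq_mul,
    ha.symm w g]
  linarith

end InfSup

/-! ### Well-posedness and preconditioning of the discrete problem -/

namespace Discretization

variable {n : ℕ} (D : Discretization n)

theorem isPosDefForm_schur : IsPosDefForm D.schur :=
  D.isPosDefForm_DA.schur D.injective_BT

/-- The inner product `a(w, r) + a^D(D_h p, D_h q)` of the weighted norm. -/
def energy : D.W × D.Q →ₗ[ℝ] Module.Dual ℝ (D.W × D.Q) := prodForm D.A D.schur

theorem isPosDefForm_energy : IsPosDefForm D.energy :=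
  D.isPosDefForm_A.prodForm D.isPosDefForm_schur

theorem energy_apply (x y : D.W × D.Q) :
    D.energy x y = D.A x.1 y.1 + D.DA (D.grad x.2) (D.grad y.2) :=
  congrArg (D.A x.1 y.1 + ·) (D.isPosDefForm_DA.schur_apply D.B x.2 y.2)

theorem tripleNorm_eq_sqrt_energy (x : D.W × D.Q) : D.tripleNorm x = √(D.energy x x) := by
  rw [energy_apply, tripleNorm]

theorem tripleNorm_sq (x : D.W × D.Q) : D.tripleNorm x ^ 2 = D.energy x x := by
  rw [tripleNorm_eq_sqrt_energy, Real.sq_sqrt (D.isPosDefForm_energy.self_nonneg x)]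

theorem tripleNorm_pos {x : D.W × D.Q} (hx : x ≠ 0) : 0 < D.tripleNorm x := by
  rw [tripleNorm_eq_sqrt_energy]
  exact Real.sqrt_pos.2 (D.isPosDefForm_energy.pos x hx)

theorem form_comm (x y : D.W × D.Q) : D.form x y = D.form y x := by
  rw [form, form, D.isPosDefForm_A.symm, add_right_comm]

theorem exists_form_ge {y : D.W × D.Q} (hy : y ≠ 0) : ∃ x : D.W × D.Q, x ≠ 0 ∧
    1 / (4 * (n + 1)) * (D.tripleNorm x * D.tripleNorm y) ≤ D.form x y := by
  have hc : (1 : ℝ) ≤ n + 1 := by simp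
  set g := D.grad y.2 with hg
  -- Subtracting the pressure part kills `a^D(D_h q, r)`, adding a multiple of `D_h q` controls it.
  set x : D.W × D.Q := (y.1 + (n + 1 : ℝ)⁻¹ • g, -y.2) with hx
  have hform : D.form x y = D.A (y.1 + (n + 1 : ℝ)⁻¹ • g) y.1 + (n + 1 : ℝ)⁻¹ * D.DA g g := by
    simp only [form, hx, ← hg, map_neg, LinearMap.neg_apply, map_add (D.DA g), map_smul (D.DA g),
      smul_eq_mul]
    ring
  have hnorm : D.tripleNorm x ≤ 2 * D.tripleNorm y := by
    rw [tripleNorm, tripleNorm, ← Real.sqrt_sq zero_le_two, ← Real.sqrt_mul (sq_nonneg 2)]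
    refine Real.sqrt_le_sqrt ?_
    simp only [hx, map_neg, LinearMap.neg_apply, neg_neg, ← hg]
    exact (energy_add_inv_smul_le D.isPosDefForm_A D.isPosDefForm_DA hc D.A_self_le y.1 g).trans_eq
      (by norm_num)
  refine ⟨x, fun h => hy ?_, ?_⟩
  · have hq : y.2 = 0 := neg_eq_zero.1 (congrArg Prod.snd h)
    exact Prod.ext (by simpa [hx, hg, hq] using congrArg Prod.fst h) hq
  · calc 1 / (4 * (n + 1)) * (D.tripleNorm x * D.tripleNorm y)
        ≤ 1 / (4 * (n + 1)) * (2 * D.tripleNorm y * D.tripleNorm y) := by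
          gcongr
          exact (D.tripleNorm_pos hy).le
      _ = (2 * (n + 1 : ℝ))⁻¹ * D.tripleNorm y ^ 2 := by field_simp; ring
      _ = (2 * (n + 1 : ℝ))⁻¹ * (D.A y.1 y.1 + D.DA g g) := by
          rw [tripleNorm_sq, energy_apply]
      _ ≤ D.form x y := hform ▸
          le_apply_add_inv_smul D.isPosDefForm_A D.isPosDefForm_DA hc D.A_self_le y.1 g

theorem wellPosed_of_le {C : ℝ} (hC : 1 ≤ C) (h : ∀ w, D.DA w w ≤ C * D.A w w) :
    D.WellPosed (1 + 2 * C) (1 / (4 * (n + 1))) := by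
  have hcont : ∀ x y, |D.form x y| ≤ (1 + 2 * C) * D.tripleNorm x * D.tripleNorm y := fun x y =>
    abs_add_add_le_energyNorm D.isPosDefForm_A D.isPosDefForm_DA hC h x.1 (D.grad x.2) y.1
      (D.grad y.2)
  refine ⟨hcont, fun y hy => ?_⟩
  obtain ⟨x, hx, hxy⟩ := D.exists_form_ge hy
  have hy_pos := D.tripleNorm_pos hy
  refine le_ciSup_of_le ⟨1 + 2 * C, ?_⟩ ⟨x, hx⟩
    ((le_div_iff₀ (mul_pos (D.tripleNorm_pos hx) hy_pos)).2 hxy)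
  rintro _ ⟨z, rfl⟩
  refine (div_le_iff₀ (mul_pos (D.tripleNorm_pos z.2) hy_pos)).2 ?_
  exact (le_abs_self _).trans ((hcont z y).trans_eq (mul_assoc _ _ _))

/-- The operator of the saddle point problem, as an operator into the dual of `W_h × Q_h`. -/
def saddleForm : D.W × D.Q →ₗ[ℝ] Module.Dual ℝ (D.W × D.Q) :=
  (Module.dualProdDualEquivDual ℝ D.W D.Q).toLinearMap ∘ₗ D.saddle

theorem form_eq_saddleForm (x y : D.W × D.Q) : D.form x y = D.saddleForm x (y.1, -y.2) := by
  have hgrad : ∀ q, D.DA (D.grad q) = D.BT q := fun q => apply_inv D.isPosDefForm_DA.bijective _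
  have hsaddle : D.saddleForm x (y.1, -y.2) =
      D.A x.1 y.1 + D.BT x.2 y.1 + -D.B x.1 (-y.2) := rfl
  rw [form, hgrad, hgrad, hsaddle, map_neg, neg_neg]
  rfl

theorem tripleNorm_neg_snd (y : D.W × D.Q) : D.tripleNorm (y.1, -y.2) = D.tripleNorm y := by
  simp only [tripleNorm, map_neg, LinearMap.neg_apply, neg_neg]

variable {D}

theorem WellPosed.saddleForm_dual_le {α β : ℝ} (h : D.WellPosed α β) (x : D.W × D.Q) :
    D.saddleForm x (inv D.energy (D.saddleForm x)) ≤ α ^ 2 * D.energy x x := by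
  rw [← Real.sq_sqrt (D.isPosDefForm_energy.self_nonneg x), ← mul_pow]
  refine D.isPosDefForm_energy.dual_le fun y => ?_
  have hxy := (le_abs_self _).trans (h.1 x (y.1, -y.2))
  rwa [form_eq_saddleForm, tripleNorm_neg_snd, neg_neg, tripleNorm_eq_sqrt_energy,
    tripleNorm_eq_sqrt_energy] at hxy

theorem WellPosed.le_saddleForm_dual {α β : ℝ} (h : D.WellPosed α β) (hβ : 0 < β)
    (x : D.W × D.Q) :
    β ^ 2 * D.energy x x ≤ D.saddleForm x (inv D.energy (D.saddleForm x)) := by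
  rcases eq_or_ne x 0 with rfl | hx
  · simp
  have hx_pos := D.tripleNorm_pos hx
  have : Nonempty {x : D.W × D.Q // x ≠ 0} := ⟨⟨x, hx⟩⟩
  set s := D.saddleForm x (inv D.energy (D.saddleForm x))
  have hform : ∀ y, D.form y x ≤ √s * D.tripleNorm y := fun y => by
    rw [form_comm, form_eq_saddleForm, ← D.tripleNorm_neg_snd y, tripleNorm_eq_sqrt_energy,
      ← Real.sqrt_mul (D.isPosDefForm_energy.isSPD_inv.self_nonneg _)]
    exact Real.le_sqrt_of_sq_le (D.isPosDefForm_energy.apply_sq_le_dual _ _)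
  have hβ_le : β ≤ √s / D.tripleNorm x := (h.2 x hx).trans <| ciSup_le fun y => by
    rw [← div_div]
    exact div_le_div_of_nonneg_right ((div_le_iff₀ (D.tripleNorm_pos y.2)).2 (hform y)) hx_pos.le
  rw [le_div_iff₀ hx_pos, tripleNorm_eq_sqrt_energy] at hβ_le
  calc β ^ 2 * D.energy x x = (β * √(D.energy x x)) ^ 2 := by
        rw [mul_pow, Real.sq_sqrt (D.isPosDefForm_energy.self_nonneg x)]
    _ ≤ √s ^ 2 := by gcongr
    _ = s := Real.sq_sqrt (D.isPosDefForm_energy.isSPD_inv.self_nonneg _)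

variable {Hw : Module.Dual ℝ D.W →ₗ[ℝ] D.W} {Hp : Module.Dual ℝ D.Q →ₗ[ℝ] D.Q}

theorem bijective_blockDiag (hHw : IsSPD Hw) (hHp : IsSPD Hp) :
    Function.Bijective (D.blockDiag Hw Hp) :=
  hHw.bijective.prodMap hHp.bijective

theorem prodPrecond_comp_saddleForm :
    prodPrecond Hw Hp ∘ₗ D.saddleForm = D.blockDiag Hw Hp ∘ₗ D.saddle :=
  LinearMap.ext fun x => prodPrecond_dualProd Hw Hp (D.saddle x)

theorem precondNorm_eq_sqrt_inv (hHw : IsSPD Hw) (hHp : IsSPD Hp) (x : D.W × D.Q) :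
    D.precondNorm (D.blockDiag Hw Hp) x = √(inv (prodPrecond Hw Hp) x x) := by
  obtain ⟨f, rfl⟩ := (bijective_blockDiag hHw hHp).2 x
  have hdual : prodPrecond Hw Hp (Module.dualProdDualEquivDual ℝ D.W D.Q f) =
      D.blockDiag Hw Hp f := prodPrecond_dualProd Hw Hp f
  rw [precondNorm, inv_apply (bijective_blockDiag hHw hHp), ← hdual,
    inv_apply (hHw.prodPrecond hHp).bijective]
  rfl

theorem WellPosed.condNumber_le {α β c₁ c₂ : ℝ} (h : D.WellPosed α β) (hα : 0 ≤ α) (hβ : 0 < β)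
    (hHw : IsSPD Hw) (hHp : IsSPD Hp) (hc₁ : 0 < c₁)
    (hw : SpectrallyEquivalent Hw (inv D.A) c₁ c₂)
    (hp : SpectrallyEquivalent Hp (inv D.schur) c₁ c₂) :
    Function.Bijective (D.blockDiag Hw Hp ∘ₗ D.saddle) ∧
      condNumber D.tripleNorm (D.blockDiag Hw Hp ∘ₗ D.saddle) ≤
        ENNReal.ofReal (α * c₂ / (β * c₁)) ∧
      condNumber (D.precondNorm (D.blockDiag Hw Hp)) (D.blockDiag Hw Hp ∘ₗ D.saddle) ≤
        ENNReal.ofReal (α * c₂ / (β * c₁)) := by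
  have hH := hHw.prodPrecond hHp
  have hequiv : SpectrallyEquivalent (prodPrecond Hw Hp) (inv D.energy) c₁ c₂ := by
    rw [energy, inv_prodForm D.isPosDefForm_A D.isPosDefForm_schur]
    exact hw.prodPrecond hp
  rw [← prodPrecond_comp_saddleForm, funext D.tripleNorm_eq_sqrt_energy,
    funext (precondNorm_eq_sqrt_inv hHw hHp)]
  exact ⟨bijective_comp_of_le_dual D.isPosDefForm_energy hH hβ (h.le_saddleForm_dual hβ),
    condNumber_energyNorm_le D.isPosDefForm_energy hH hα hβ hc₁ hequiv h.saddleForm_dual_le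
      (h.le_saddleForm_dual hβ),
    condNumber_precondNorm_le D.isPosDefForm_energy hH hα hβ hc₁ hequiv h.saddleForm_dual_le
      (h.le_saddleForm_dual hβ)⟩

end Discretization

end MixedDim

end

theorem mainTheorem5_general (n : ℕ) :
    (∀ D : MixedDim.Discretization n,
      Function.Bijective D.A ∧ Function.Bijective D.DA ∧ Function.Bijective D.schur) ∧
    (∀ σ θ : ℝ, ∃ α β : ℝ, 0 < α ∧ 0 < β ∧
      ∀ D : MixedDim.Discretization n, D.M.ShapeRegular σ → D.P.AnisotropyBound θ →
        D.WellPosed α β) ∧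
    (∀ (D : MixedDim.Discretization n) (α β : ℝ), 0 < α → 0 < β → D.WellPosed α β →
      ∀ (Hw : Module.Dual ℝ D.W →ₗ[ℝ] D.W) (Hp : Module.Dual ℝ D.Q →ₗ[ℝ] D.Q)
        (c₁w c₂w c₁p c₂p : ℝ),
        MixedDim.IsSPD Hw → MixedDim.IsSPD Hp →
        0 < c₁w → 0 < c₁p →
        MixedDim.SpectrallyEquivalent Hw (MixedDim.inv D.A) c₁w c₂w →
        MixedDim.SpectrallyEquivalent Hp (MixedDim.inv D.schur) c₁p c₂p →
        Function.Bijective (D.blockDiag Hw Hp) ∧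
        Function.Bijective (D.blockDiag Hw Hp ∘ₗ D.saddle) ∧
        MixedDim.condNumber D.tripleNorm (D.blockDiag Hw Hp ∘ₗ D.saddle) ≤
          ENNReal.ofReal (α * max c₂w c₂p / (β * min c₁w c₁p)) ∧
        MixedDim.condNumber (D.precondNorm (D.blockDiag Hw Hp))
            (D.blockDiag Hw Hp ∘ₗ D.saddle) ≤
          ENNReal.ofReal (α * max c₂w c₂p / (β * min c₁w c₁p))) := by
  refine ⟨fun D => ⟨D.isPosDefForm_A.bijective, D.isPosDefForm_DA.bijective,
    D.isPosDefForm_schur.bijective⟩, fun σ θ => ?_, ?_⟩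
  · have hC := MixedDim.Discretization.one_le_diagonalConstant n σ θ
    exact ⟨1 + 2 * MixedDim.Discretization.diagonalConstant n σ θ, 1 / (4 * (n + 1)), by linarith,
      by positivity, fun D hσ hθ => D.wellPosed_of_le hC (D.DA_self_le hσ hθ)⟩
  · intro D α β hα hβ hwp Hw Hp c₁w c₂w c₁p c₂p hHw hHp hc₁w hc₁p hw hp
    exact ⟨MixedDim.Discretization.bijective_blockDiag hHw hHp,
      hwp.condNumber_le hα.le hβ hHw hHp (lt_min hc₁w hc₁p)
        (hw.mono hHw (min_le_left _ _) (le_max_left _ _))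
        (hp.mono hHp (min_le_right _ _) (le_max_right _ _))⟩

theorem mainTheorem5 (n : ℕ) (hn : n = 2 ∨ n = 3) :
    (∀ D : MixedDim.Discretization n,
      Function.Bijective D.A ∧ Function.Bijective D.DA ∧ Function.Bijective D.schur) ∧
    (∀ σ θ : ℝ, ∃ α β : ℝ, 0 < α ∧ 0 < β ∧
      ∀ D : MixedDim.Discretization n, D.M.ShapeRegular σ → D.P.AnisotropyBound θ →
        D.WellPosed α β) ∧
    (∀ (D : MixedDim.Discretization n) (α β : ℝ), 0 < α → 0 < β → D.WellPosed α β →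
      ∀ (Hw : Module.Dual ℝ D.W →ₗ[ℝ] D.W) (Hp : Module.Dual ℝ D.Q →ₗ[ℝ] D.Q)
        (c₁w c₂w c₁p c₂p : ℝ),
        MixedDim.IsSPD Hw → MixedDim.IsSPD Hp →
        0 < c₁w → 0 < c₁p →
        MixedDim.SpectrallyEquivalent Hw (MixedDim.inv D.A) c₁w c₂w →
        MixedDim.SpectrallyEquivalent Hp (MixedDim.inv D.schur) c₁p c₂p →
        Function.Bijective (D.blockDiag Hw Hp) ∧
        Function.Bijective (D.blockDiag Hw Hp ∘ₗ D.saddle) ∧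
        MixedDim.condNumber D.tripleNorm (D.blockDiag Hw Hp ∘ₗ D.saddle) ≤
          ENNReal.ofReal (α * max c₂w c₂p / (β * min c₁w c₁p)) ∧
        MixedDim.condNumber (D.precondNorm (D.blockDiag Hw Hp))
            (D.blockDiag Hw Hp ∘ₗ D.saddle) ≤
          ENNReal.ofReal (α * max c₂w c₂p / (β * min c₁w c₁p))) :=
  mainTheorem5_general n
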